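/- Write $(a)_n=a(a+1)\cdots(a+n-1)$ and $(a_1,\dots,a_j)_n=(a_1)_n\cdots(a_j)_n$. Let $\lambda(x)=x(x+\gamma+\delta+1)$. The Racah polynomials are, for every $n\ge 0$, $$R_n(\lambda(x);\alpha,\beta,\gamma,\delta)=\frac{1}{(n+\alpha+\beta+1)_n}\sum_{k=0}^n\frac{(-n,\,n+\alpha+\beta+1,\,-x,\,x+\gamma+\delta+1)_k}{k!}\,(\alpha+1+k,\ \beta+\delta+1+k,\ \gamma+1+k)_{n-k},$$ and the Wilson polynomials are $$W_n(x^2;a,b,c,d)=\frac{(-1)^n}{(n+a+b+c+d-1)_n}\sum_{k=0}^n\frac{(-n,\,n+a+b+c+d-1,\,a+ix,\,a-ix)_k}{k!}\,(a+b+k,\ a+c+k,\ a+d+k)_{n-k}.$$ (When the lower parameters allow it, these are $R_n=\frac{(\alpha+1,\beta+\delta+1,\gamma+1)_n}{(n+\alpha+\beta+1)_n}\,{}_4F_3\!\left({-n,\,n+\alpha+\beta+1,\,-x,\,x+\gamma+\delta+1\atop \alpha+1,\ \beta+\delta+1,\ \gamma+1};1\right)$ and $W_n=\frac{(-1)^n(a+b,a+c,a+d)_n}{(n+a+b+c+d-1)_n}\,{}_4F_3\!\left({-n,\,n+a+b+c+d-1,\,a+ix,\,a-ix\atop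 a+b,\ a+c,\ a+d};1\right)$.) Let $N$ be a non-negative integer and let $\alpha,\beta,\gamma,\delta\in\mathbb C$ with $\alpha+1=-N$ and $\alpha+\beta\notin\{-2,-3,-4,\dots\}$. Then the following hold. 1. For every $n\ge 0$, $R_n$ is a monic polynomial of degree $n$ in the variable $\lambda$. 2. (Factorization.) For all $n>N$ and $x\in\mathbb C$, $$R_n(\lambda(x);\alpha,\beta,\gamma,\delta)=R_{N+1}(\lambda(x);-N-1,\beta,\gamma,\delta)\,(-1)^{n-N-1}\,W_{n-N-1}\!\left(\Big(i\big(x+\tfrac{\gamma+\delta+1}2\big)\Big)^2;\,N+\tfrac{\gamma+\delta+3}2,\ \tfrac{-\gamma-\delta+1}2,\ \beta+\tfrac{-\gamma+\delta+1}2,\ \tfrac{\gamma-\delta+1}2\right).$$ 3. ($\Delta$-Sobolev orthogonality.) Put $$a=1+\tfrac{\gamma+\delta+N}2,\quad b=-\tfrac{\gamma+\delta+N}2,\quad c=\beta+1+\tfrac{-\gamma+\delta+N}2,\quad d=1+\tfrac{\gamma-\delta+N}2,$$ $$\nu(z)=\frac{\Gamma(a+iz)\Gamma(b+iz)\Gamma(c+iz)\Gamma(d+iz)}{\Gamma(2iz)},$$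 and assume that none of the ten sums $2a,\ a+b,\ a+c,\ \dots,\ c+d,\ 2d$ of two of these parameters is in $\{0,-1,-2,\dots\}$ and that $(-\alpha+\gamma+\delta+1,\ -\beta+\gamma+1,\ \tfrac{\gamma+\delta+1}2,\ \delta+1)_N\ne0$. Let $C$ be the upward imaginary axis deformed, inside a bounded region, into a simple ($C^1$-parametrized, corners allowed) curve that has on its right the points $k$, $-1-\gamma-\delta-N+k$, $\beta-\gamma+k$, $-\delta+k$ and on its left the points $-\gamma-\delta-N-2-k$, $-1-k$, $-\beta-\delta-N-2-k$, $-\gamma-N-2-k$ $(k=0,1,2,\dots)$. For functions $f,g$ of the lattice variable $x$ put $$\langle f,g\rangle_S=\sum_{x=0}^N f(x)g(x)\,\frac{(\alpha+1,\ \beta+\delta+1,\ \gamma+1,\ \gamma+\delta+1,\ (\gamma+\delta+3)/2)_x}{(-\alpha+\gamma+\delta+1,\ -\beta+\gamma+1,\ (\gamma+\delta+1)/2,\ \delta+1,\ 1)_x}+\int_C (D^{N+1}f)(z)\,(D^{N+1}g)(z)\,\nu(\zeta)\,\nu(-\zeta)\,dz,$$ where $\zeta=i\big(z+1+\tfrac{\gamma+\delta+N}2\big)$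 and $D^k=(\Delta/\Delta\lambda)^k$ is the iterated divided difference on the lattice: $$D^0f=f,\qquad (D^{k+1}f)(x)=\frac{(D^kf)(x+1)-(D^kf)(x)}{\lambda(x+1+k/2)-\lambda(x+k/2)}.$$ Then the integral converges absolutely whenever $f$ and $g$ are polynomials in $\lambda(x)$, and, with $R_n$ standing for the function $x\mapsto R_n(\lambda(x);\alpha,\beta,\gamma,\delta)$, $$\langle R_n,R_m\rangle_S=0\quad\text{for all } n\neq m,\ n,m\ge 0,\qquad\text{and}\qquad \langle R_n,R_n\rangle_S\ne0\quad\text{for all } n>N;$$ if moreover $(\beta+\delta+1,\ \gamma+1,\ \gamma+\delta+2)_N\neq0$, then $\langle R_n,R_n\rangle_S\neq0$ also for $0\le n\le N$. 4. (Generating functions.) For all $x,t\in\mathbb C$ with $|t|<1$, $$\sum_{n=0}^\infty\frac{(n+\alpha+\beta+1)_n}{(\beta+\delta+1,\ \alpha-\delta+1)_n\,n!}R_n(\lambda(x);\alpha,\beta,\gamma,\delta)\,t^n={}_2F_1\!\left({-x,\ -x+\beta-\gamma\atop\beta+\delta+1};t\right){}_2F_1\!\left({x+\alpha+1,\ x+\gamma+1\atop\alpha-\delta+1};t\right)$$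 if neither $\beta+\delta+1$ nor $\alpha-\delta+1$ is in $\{0,-1,-2,\dots\}$, and $$\sum_{n=0}^\infty\frac{(n+\alpha+\beta+1)_n}{(\gamma+1,\ \alpha+\beta-\gamma+1)_n\,n!}R_n(\lambda(x);\alpha,\beta,\gamma,\delta)\,t^n={}_2F_1\!\left({-x,\ -x-\delta\atop\gamma+1};t\right){}_2F_1\!\left({x+\alpha+1,\ x+\beta+\delta+1\atop\alpha+\beta-\gamma+1};t\right)$$ if neither $\gamma+1$ nor $\alpha+\beta-\gamma+1$ is in $\{0,-1,-2,\dots\}$. -/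

import Mathlib

open Polynomial

/-- The Pochhammer symbol `(a)_n = a (a + 1) ⋯ (a + n - 1)`. -/
noncomputable def poch (a : ℂ) (n : ℕ) : ℂ := (ascPochhammer ℂ n).eval a

/-- The quadratic lattice `λ(x) = x (x + γ + δ + 1)`. -/
noncomputable def lam (γ δ x : ℂ) : ℂ := x * (x + γ + δ + 1)

/-- The monic Racah polynomial `R_n(·; α, β, γ, δ)`, a polynomial in the variable `λ`, for every `n`.
It is `r_n ₄F₃(-n, n+α+β+1, -x, x+γ+δ+1; α+1, β+δ+1, γ+1; 1)`, where
`r_n = (α+1, β+δ+1, γ+1)_n / (n+α+β+1)_n` is multiplied into the series by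
`(a)_n / (a)_k = (a + k)_{n-k}`, so that vanishing lower parameters do no harm, and
`(-x)_k (x+γ+δ+1)_k = ∏_{j<k} (j (j+γ+δ+1) - λ(x))`. -/
noncomputable def racah (n : ℕ) (α β γ δ : ℂ) : ℂ[X] :=
  C (poch (n + α + β + 1) n)⁻¹ * ∑ k ∈ Finset.range (n + 1),
    C (poch (-n) k * poch (n + α + β + 1) k *
        (poch (α + 1 + k) (n - k) * poch (β + δ + 1 + k) (n - k) * poch (γ + 1 + k) (n - k)) /
        (k.factorial : ℂ)) *
      ∏ j ∈ Finset.range k, (C (lam γ δ j) - X)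

/-- The Wilson polynomial `W_n(·; a, b, c, d)`, a polynomial in the variable `x²`, normalized to have
leading coefficient `1`. It is `w_n ₄F₃(-n, n+a+b+c+d-1, a+ix, a-ix; a+b, a+c, a+d; 1)`, where
`w_n = (-1)^n (a+b, a+c, a+d)_n / (n+a+b+c+d-1)_n` is multiplied into the series, and
`(a+ix)_k (a-ix)_k = ∏_{j<k} ((a+j)² + x²)`. -/
noncomputable def wilson (n : ℕ) (a b c d : ℂ) : ℂ[X] :=
  C ((-1) ^ n * (poch (n + a + b + c + d - 1) n)⁻¹) * ∑ k ∈ Finset.range (n + 1),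
    C (poch (-n) k * poch (n + a + b + c + d - 1) k *
        (poch (a + b + k) (n - k) * poch (a + c + k) (n - k) * poch (a + d + k) (n - k)) /
        (k.factorial : ℂ)) *
      ∏ j ∈ Finset.range k, (C ((a + j) ^ 2) + X)

/-- The terminating series `₄F₃(-n, a₁, a₂, a₃; b₁, b₂, b₃; 1)`. -/
noncomputable def hyp43 (n : ℕ) (a₁ a₂ a₃ b₁ b₂ b₃ : ℂ) : ℂ :=
  ∑ k ∈ Finset.range (n + 1), poch (-n) k * poch a₁ k * poch a₂ k * poch a₃ k /
    (poch b₁ k * poch b₂ k * poch b₃ k * (k.factorial : ℂ))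

theorem poch_eq_prod (a : ℂ) (n : ℕ) : poch a n = ∏ j ∈ Finset.range n, (a + j) := by
  unfold poch
  induction n with
  | zero => simp
  | succ n ih => rw [ascPochhammer_succ_eval, ih, Finset.prod_range_succ]

theorem poch_split (a : ℂ) {n k : ℕ} (h : k ≤ n) :
    poch a n = poch a k * poch (a + k) (n - k) := by
  obtain ⟨m, rfl⟩ := Nat.exists_eq_add_of_le h
  simp only [poch_eq_prod, Finset.prod_range_add, Nat.add_sub_cancel_left]
  congr 1
  exact Finset.prod_congr rfl fun j _ => by push_cast; ring

/-- The polynomial `racah` is the usual hypergeometric Racah polynomial where the latter is defined. -/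
theorem racah_eval (n : ℕ) (α β γ δ x : ℂ) (h₁ : poch (α + 1) n ≠ 0)
    (h₂ : poch (β + δ + 1) n ≠ 0) (h₃ : poch (γ + 1) n ≠ 0) :
    (racah n α β γ δ).eval (lam γ δ x) =
      poch (α + 1) n * poch (β + δ + 1) n * poch (γ + 1) n / poch (n + α + β + 1) n *
        hyp43 n (n + α + β + 1) (-x) (x + γ + δ + 1) (α + 1) (β + δ + 1) (γ + 1) := by
  simp only [racah, hyp43, eval_mul, eval_C, eval_finsetSum, Finset.mul_sum, eval_prod, eval_sub,
    eval_X]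
  refine Finset.sum_congr rfl fun k hk => ?_
  have hk' : k ≤ n := Nat.lt_succ_iff.1 (Finset.mem_range.1 hk)
  have e : ∏ j ∈ Finset.range k, (lam γ δ j - lam γ δ x) = poch (-x) k * poch (x + γ + δ + 1) k := by
    simp only [poch_eq_prod, ← Finset.prod_mul_distrib]
    exact Finset.prod_congr rfl fun j _ => by unfold lam; ring
  rw [poch_split _ hk'] at h₁ h₂ h₃
  rw [e, poch_split (α + 1) hk', poch_split (β + δ + 1) hk', poch_split (γ + 1) hk']
  have := left_ne_zero_of_mul h₁
  have := left_ne_zero_of_mul h₂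
  have := left_ne_zero_of_mul h₃
  have : (k.factorial : ℂ) ≠ 0 := Nat.cast_ne_zero.2 k.factorial_ne_zero
  field_simp

/-- The polynomial `wilson` is the usual hypergeometric Wilson polynomial where the latter is
defined. -/
theorem wilson_eval (n : ℕ) (a b c d x : ℂ) (h₁ : poch (a + b) n ≠ 0)
    (h₂ : poch (a + c) n ≠ 0) (h₃ : poch (a + d) n ≠ 0) :
    (wilson n a b c d).eval (x ^ 2) =
      (-1) ^ n * (poch (a + b) n * poch (a + c) n * poch (a + d) n) /
          poch (n + a + b + c + d - 1) n *
        hyp43 n (n + a + b + c + d - 1) (a + Complex.I * x) (a - Complex.I * x)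
          (a + b) (a + c) (a + d) := by
  simp only [wilson, hyp43, eval_mul, eval_C, eval_finsetSum, Finset.mul_sum, eval_prod, eval_add,
    eval_X]
  refine Finset.sum_congr rfl fun k hk => ?_
  have hk' : k ≤ n := Nat.lt_succ_iff.1 (Finset.mem_range.1 hk)
  have e : ∏ j ∈ Finset.range k, ((a + j) ^ 2 + x ^ 2) =
      poch (a + Complex.I * x) k * poch (a - Complex.I * x) k := by
    simp only [poch_eq_prod, ← Finset.prod_mul_distrib]
    exact Finset.prod_congr rfl fun j _ => by linear_combination x ^ 2 * (Complex.I_sq)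
  rw [poch_split _ hk'] at h₁ h₂ h₃
  rw [e, poch_split (a + b) hk', poch_split (a + c) hk', poch_split (a + d) hk']
  have := left_ne_zero_of_mul h₁
  have := left_ne_zero_of_mul h₂
  have := left_ne_zero_of_mul h₃
  have : (k.factorial : ℂ) ≠ 0 := Nat.cast_ne_zero.2 k.factorial_ne_zero
  field_simp

/-- The iterated divided difference `(Δ/Δλ)^k f` on the quadratic lattice: the `(k+1)`-st step divides
the forward difference by that of the shifted lattice `x ↦ λ(x + k/2)`. -/
noncomputable def divDiff (γ δ : ℂ) : ℕ → (ℂ → ℂ) → ℂ → ℂ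
  | 0, f => f
  | k + 1, f => fun x => (divDiff γ δ k f (x + 1) - divDiff γ δ k f x) /
      (lam γ δ (x + 1 + k / 2) - lam γ δ (x + k / 2))

/-- The discrete Racah weight at `x = 0, 1, …`. -/
noncomputable def racahWeight (α β γ δ : ℂ) (x : ℕ) : ℂ :=
  poch (α + 1) x * poch (β + δ + 1) x * poch (γ + 1) x * poch (γ + δ + 1) x *
      poch ((γ + δ + 3) / 2) x /
    (poch (-α + γ + δ + 1) x * poch (-β + γ + 1) x * poch ((γ + δ + 1) / 2) x *
      poch (δ + 1) x * poch 1 x)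

/-- `ν(z; a, b, c, d) = Γ(a+iz) Γ(b+iz) Γ(c+iz) Γ(d+iz) / Γ(2iz)`, where `e = (a, b, c, d)`. -/
noncomputable def nu (e : Fin 4 → ℂ) (z : ℂ) : ℂ :=
  (∏ i, Complex.Gamma (e i + Complex.I * z)) / Complex.Gamma (2 * Complex.I * z)

/-- The parameters `a, b, c, d` of the Wilson weight. -/
noncomputable def wpar (N : ℕ) (β γ δ : ℂ) : Fin 4 → ℂ :=
  ![1 + (γ + δ + N) / 2, -(γ + δ + N) / 2, β + 1 + (-γ + δ + N) / 2, 1 + (γ - δ + N) / 2]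

/-- The Wilson type weight, in the lattice variable `z`. -/
noncomputable def wilsonWeight (N : ℕ) (β γ δ z : ℂ) : ℂ :=
  nu (wpar N β γ δ) (Complex.I * (z + 1 + (γ + δ + N) / 2)) *
    nu (wpar N β γ δ) (-(Complex.I * (z + 1 + (γ + δ + N) / 2)))

/-- The poles of the weight in its four increasing sequences. -/
def increasingPoles (N : ℕ) (β γ δ : ℂ) : Set ℂ :=
  {p | ∃ k : ℕ, p = k ∨ p = -1 - γ - δ - N + k ∨ p = β - γ + k ∨ p = -δ + k}

/-- The poles of the weight in its four decreasing sequences. -/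
def decreasingPoles (N : ℕ) (β γ δ : ℂ) : Set ℂ :=
  {p | ∃ k : ℕ, p = -γ - δ - N - 2 - k ∨ p = -1 - k ∨ p = -β - δ - N - 2 - k ∨
    p = -γ - N - 2 - k}

/-- The principal value of `∫_K dz / (z - p)` along the curve `K` is `v`. For a simple curve that
coincides with the upward imaginary axis near both ends and avoids `p`, this value is `-iπ` if `p`
lies to the right of the curve (`arg (z - p)` changes by `-π` along it) and `iπ` if `p` lies to its
left. -/
def HasIndexIntegral (K : ℝ → ℂ) (p v : ℂ) : Prop :=
  Filter.Tendsto (fun T : ℝ => ∫ t in (-T)..T, deriv K t / (K t - p)) Filter.atTop (nhds v)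

/-- The curve `K` is the imaginary axis, directed upwards and deformed within a bounded region into a
simple curve that has the points of `inc` on its right and those of `dec` on its left. (The derivative
of the parametrization may vanish, so that corners are allowed.) -/
structure IsSeparatingContour (K : ℝ → ℂ) (inc dec : Set ℂ) : Prop where
  contDiff : ContDiff ℝ 1 K
  injective : Function.Injective K
  eq_axis : ∃ T : ℝ, ∀ t : ℝ, T ≤ |t| → K t = t * Complex.I
  right : ∀ p ∈ inc, p ∉ Set.range K ∧ HasIndexIntegral K p (-(Real.pi * Complex.I))
  left : ∀ p ∈ dec, p ∉ Set.range K ∧ HasIndexIntegral K p (Real.pi * Complex.I)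

/-- The integrand, pulled back to the line along `K`, of the continuous part of the Sobolev product of
two functions `f`, `g` of the lattice variable. -/
noncomputable def sobolevIntegrand (N : ℕ) (β γ δ : ℂ) (K : ℝ → ℂ) (f g : ℂ → ℂ) (t : ℝ) : ℂ :=
  divDiff γ δ (N + 1) f (K t) * divDiff γ δ (N + 1) g (K t) * wilsonWeight N β γ δ (K t) * deriv K t

/-- The `Δ`-Sobolev product: the sum over `x = 0, …, N` with the Racah weight plus the integral along
`K` of the `(N+1)`-st divided differences with the Wilson type weight. -/
noncomputable def sobolevProd (N : ℕ) (α β γ δ : ℂ) (K : ℝ → ℂ) (f g : ℂ → ℂ) : ℂ :=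
  ∑ x ∈ Finset.range (N + 1), f x * g x * racahWeight α β γ δ x +
    ∫ t : ℝ, sobolevIntegrand N β γ δ K f g t

/-! ### Pochhammer symbols and terminating hypergeometric sums -/

/-! In the symmetric variable s = x + (γ+δ+1)/2 the Racah and the Wilson polynomials are, up to
normalization, one family `wilsonRacah` in s², expanded in the basis `phi a k` = (a-s)_k (a+s)_k.
The condition α+1 = -N becomes a+b = -N. For n > N it kills the terms k ≤ N, so that `phi a (N+1)`
splits off and a Wilson sum remains: this is `wilsonRacah_factor`.

The factorization makes R_n vanish at x = 0, …, N when n > N, while D^{N+1} annihilates R_n when n ≤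
N. The Sobolev product is therefore block diagonal: the sum governs the degrees up to N, the
integral the degrees above N. On the upper block D^{N+1} maps R_{N+1+m} to a nonzero multiple of the
Wilson polynomial of degree m with all four parameters raised by (N+1)/2 (`divDiff_wilsonRacah`).

Both blocks follow from one algebraic principle. A functional with `IsPearson` kills every
polynomial produced from a difference of shifted products. Multiplication by `phi a k` raises the
parameter a by k, so the moments on `phi a k * phi b m` are explicit, and the Pfaff–Saalschütz sum
evaluates L(P_n · `phi b m`) in closed form. The result contains (m+1-n)_n, which vanishes for m <
n; the case m = n shows that the norm is nonzero if L(1) and the Pochhammer symbols of the pair sums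
are.

For the sum, the Pearson equation is summation by parts (`racahSum_isPearson`), and L(1) ≠ 0 follows
from a moment to which only the node x = N contributes. For the integral, it expresses that
translating the contour by one crosses no pole of a product of Gamma functions
(`wilsonFunctional_isPearson`). Contours are compared through `integral_contour_eq`: two contours
with the same index at every pole give the same integral. Convergence and the vanishing of the
horizontal edges come from exponential decay of Gamma in vertical strips (`stripBound_Gamma`).

That the Wilson integral is nonzero is proved without evaluating it. Raising parameters carries a
zero into the right half plane, where the contour may be taken vertical. Letting one parameter tend
to infinity shows that this parameter affects the integral only by a nonzero factor
(`integral_wilsonW₃_eq`). All four may then be replaced by 1, where the integrand is nonnegative and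
not identically zero.

The generating functions are Whipple's transformation: it turns each Racah polynomial into the
coefficient of a Cauchy product of two ₂F₁ series. -/

theorem poch_zero (a : ℂ) : poch a 0 = 1 := by simp [poch_eq_prod]

theorem poch_succ (a : ℂ) (n : ℕ) : poch a (n + 1) = poch a n * (a + n) := by
  simp [poch_eq_prod, Finset.prod_range_succ]

theorem poch_add (a : ℂ) (m n : ℕ) : poch a (m + n) = poch a m * poch (a + m) n := by
  rw [poch_split a (Nat.le_add_right m n), Nat.add_sub_cancel_left]

theorem poch_one (a : ℂ) : poch a 1 = a := by simp [poch_eq_prod]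

theorem poch_succ_left (a : ℂ) (n : ℕ) : poch a (n + 1) = a * poch (a + 1) n := by
  rw [add_comm, poch_add, poch_one]; simp

theorem poch_ne_zero_iff (a : ℂ) (n : ℕ) : poch a n ≠ 0 ↔ ∀ j < n, a + j ≠ 0 := by
  simp [poch_eq_prod, Finset.prod_ne_zero_iff]

theorem poch_ne_zero {a : ℂ} (h : ∀ j : ℕ, a + j ≠ 0) (n : ℕ) : poch a n ≠ 0 :=
  (poch_ne_zero_iff a n).2 fun j _ => h j

theorem poch_eq_zero {a : ℂ} {n j : ℕ} (hj : j < n) (h : a + j = 0) : poch a n = 0 := by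
  rw [poch_eq_prod]; exact Finset.prod_eq_zero (Finset.mem_range.2 hj) h

theorem poch_reflect (a : ℂ) (n : ℕ) : poch a n = (-1) ^ n * poch (1 - a - n) n := by
  rw [poch_eq_prod, poch_eq_prod, ← Finset.prod_range_reflect]
  nth_rw 3 [← Finset.card_range n]
  rw [← Finset.prod_const, ← Finset.prod_mul_distrib]
  refine Finset.prod_congr rfl fun j hj => ?_
  have : j + 1 ≤ n := Finset.mem_range.1 hj
  rw [Nat.sub_sub, Nat.cast_sub (by omega)]
  push_cast
  ring

theorem poch_one_eq_factorial (n : ℕ) : poch 1 n = n.factorial := by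
  induction n with
  | zero => simp [poch_zero]
  | succ n ih => rw [poch_succ, ih, Nat.factorial_succ]; push_cast; ring

theorem poch_nat_add_one (m n : ℕ) : poch (m + 1) n * m.factorial = (m + n).factorial := by
  rw [← poch_one_eq_factorial, ← poch_one_eq_factorial, poch_add, add_comm (1 : ℂ), mul_comm]

theorem poch_neg_add (i m : ℕ) :
    poch (-((i + m : ℕ) : ℂ)) i * m.factorial = (-1) ^ i * (i + m).factorial := by
  rw [poch_reflect, add_comm i m, ← poch_nat_add_one m i,
    show (1 - -((m + i : ℕ) : ℂ) - i) = m + 1 by push_cast; ring]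
  ring

theorem fact_ne (n : ℕ) : (n.factorial : ℂ) ≠ 0 := Nat.cast_ne_zero.2 n.factorial_ne_zero

open Finset in
/-- The Pfaff–Saalschütz sum, free of denominators. -/
theorem saalschutz (p q d : ℂ) (k : ℕ) :
    ∑ ij ∈ antidiagonal k, poch p ij.1 * poch q ij.1 * poch (d + ij.1) ij.2 *
      poch (d - p - q) ij.2 / (ij.1.factorial * ij.2.factorial : ℂ) =
      poch (d - p) k * poch (d - q) k / k.factorial := by
  induction k with
  | zero => simp [poch_zero]
  | succ k ih =>
    set T : ℕ × ℕ → ℂ := fun ij => poch p ij.1 * poch q ij.1 * poch (d + ij.1) ij.2 *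
      poch (d - p - q) ij.2 / (ij.1.factorial * ij.2.factorial : ℂ) with hT
    -- The telescoping certificate of the recurrence in `k`. It vanishes at i = 0, and its value at
    -- (k+1, 0) supplies exactly the term of `T` missed by the sum over `term`.
    set H : ℕ × ℕ → ℂ := fun ij => ij.1 * poch p ij.1 * poch q ij.1 * poch (d + ij.1 - 1) ij.2 *
      poch (d - p - q) ij.2 / (ij.1.factorial * ij.2.factorial : ℂ) with hH
    have term : ∀ ij ∈ antidiagonal k, (k + 1 : ℂ) * T (ij.1, ij.2 + 1) =
        (d - p + k) * (d - q + k) * T ij + (H (ij.1, ij.2 + 1) - H (ij.1 + 1, ij.2)) := by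
      rintro ⟨i, j⟩ hij
      have hk : k = i + j := (mem_antidiagonal.1 hij).symm
      simp only [hT, hH, hk]
      rw [poch_succ (d + i) j, poch_succ_left (d + i - 1) j, poch_succ p, poch_succ q,
        poch_succ (d - p - q), Nat.factorial_succ, Nat.factorial_succ,
        show d + (i : ℂ) - 1 + 1 = d + i by ring,
        show d + ((i + 1 : ℕ) : ℂ) - 1 = d + i by push_cast; ring]
      have := fact_ne i
      have := fact_ne j
      have : (i : ℂ) + 1 ≠ 0 := by exact_mod_cast i.succ_ne_zero
      have : (j : ℂ) + 1 ≠ 0 := by exact_mod_cast j.succ_ne_zero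
      push_cast
      field_simp
      ring
    have e₁ := Finset.Nat.sum_antidiagonal_succ' (n := k) (f := H)
    have e₂ := Finset.Nat.sum_antidiagonal_succ (n := k) (f := H)
    have e₃ := Finset.Nat.sum_antidiagonal_succ' (n := k) (f := T)
    have e₄ := Finset.sum_congr rfl term
    rw [← mul_sum, sum_add_distrib, sum_sub_distrib, ← mul_sum, ih] at e₄
    have e₅ : H (0, k + 1) = 0 := by simp [hH]
    have e₆ : H (k + 1, 0) = (k + 1) * T (k + 1, 0) := by
      simp only [hH, hT, poch_zero]; push_cast; ring
    have hk : (k : ℂ) + 1 ≠ 0 := by exact_mod_cast k.succ_ne_zero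
    rw [e₃, poch_succ, poch_succ, Nat.factorial_succ]
    apply mul_left_cancel₀ hk
    have := fact_ne k
    push_cast
    rw [show (k + 1 : ℂ) * (poch (d - p) k * (d - p + k) * (poch (d - q) k * (d - q + k)) /
      ((k + 1) * k.factorial)) =
      (d - p + k) * (d - q + k) * (poch (d - p) k * poch (d - q) k / k.factorial) by
        field_simp]
    linear_combination e₄ - e₁ + e₂ + e₅ - e₆

open Finset in
/-- The Pfaff–Saalschütz sum with a terminating upper parameter. -/
theorem saalschutz_neg (a g e f : ℂ) (m : ℕ) (h : e + f = a + g + 1 - m) :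
    ∑ ij ∈ antidiagonal m, poch (-m) ij.1 * poch a ij.1 * poch g ij.1 * poch (e + ij.1) ij.2 *
      poch (f + ij.1) ij.2 / (ij.1.factorial : ℂ) = poch (e - a) m * poch (f - a) m := by
  have hs := saalschutz a g e m
  have := fact_ne m
  rw [eq_div_iff this, sum_mul] at hs
  rw [poch_reflect (f - a), show 1 - (f - a) - m = e - g by linear_combination -h]
  rw [show poch (e - a) m * ((-1) ^ m * poch (e - g) m) =
    (-1) ^ m * (poch (e - a) m * poch (e - g) m) by ring, ← hs, mul_sum]
  refine sum_congr rfl ?_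
  rintro ⟨i, j⟩ hij
  have hm : m = i + j := (mem_antidiagonal.1 hij).symm
  subst hm
  have h₁ := poch_neg_add i j
  -- The balance condition `h` turns the reflected factor into (e-a-g)_j, the factor in
  -- `saalschutz`.
  have h₂ := poch_reflect (f + i) j
  rw [show 1 - (f + (i : ℂ)) - j = e - a - g by push_cast at h; linear_combination -h] at h₂
  have := fact_ne i
  have := fact_ne j
  rw [← eq_div_iff this] at h₁
  simp only
  rw [h₁, h₂, pow_add]
  field_simp

open Finset in
/-- Whipple's transformation between terminating balanced `₄F₃` series, free of denominators. -/
theorem whipple (a b c d e f : ℂ) (n : ℕ) (h : d + e + f = a + b + c + 1 - n) :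
    ∑ kl ∈ antidiagonal n, poch (-n) kl.1 * poch a kl.1 * poch b kl.1 * poch c kl.1 *
      (poch (d + kl.1) kl.2 * poch (e + kl.1) kl.2 * poch (f + kl.1) kl.2) /
        (kl.1.factorial : ℂ) =
    ∑ im ∈ antidiagonal n, poch (-n) im.1 * poch a im.1 * poch (d - b) im.1 *
      poch (d - c) im.1 * poch (d + im.1) im.2 * poch (e - a) im.2 * poch (f - a) im.2 /
        (im.1.factorial : ℂ) := by
  have e₁ : ∀ kl ∈ antidiagonal n, poch (-n) kl.1 * poch a kl.1 * poch b kl.1 * poch c kl.1 *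
      (poch (d + kl.1) kl.2 * poch (e + kl.1) kl.2 * poch (f + kl.1) kl.2) /
        (kl.1.factorial : ℂ) =
      ∑ ij ∈ antidiagonal kl.1, poch (-n) (ij.1 + ij.2) * poch a (ij.1 + ij.2) *
        (poch (d + (ij.1 + ij.2 : ℕ)) kl.2 * poch (e + (ij.1 + ij.2 : ℕ)) kl.2 *
          poch (f + (ij.1 + ij.2 : ℕ)) kl.2) *
        (poch (d - b) ij.1 * poch (d - c) ij.1 * poch (d + ij.1) ij.2 *
          poch (b + c - d) ij.2 / (ij.1.factorial * ij.2.factorial : ℂ)) := by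
    rintro ⟨k, l⟩ -
    -- The product (b)_k (c)_k / k! is expanded by Saalschütz; exchanging the sums then leaves an
    -- inner sum that is again balanced.
    have hs := saalschutz (d - b) (d - c) d k
    rw [show d - (d - b) - (d - c) = b + c - d by ring] at hs
    simp only [sub_sub_cancel] at hs
    simp only
    rw [show poch (-n) k * poch a k * poch b k * poch c k *
      (poch (d + k) l * poch (e + k) l * poch (f + k) l) / (k.factorial : ℂ) =
      poch (-n) k * poch a k * (poch (d + k) l * poch (e + k) l * poch (f + k) l) *
      (poch b k * poch c k / (k.factorial : ℂ)) by ring, ← hs, mul_sum]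
    refine sum_congr rfl fun ij hij => ?_
    rw [HasAntidiagonal.mem_antidiagonal.1 hij]
  rw [sum_congr rfl e₁]
  have e₂ : ∀ im ∈ antidiagonal n, poch (-n) im.1 * poch a im.1 * poch (d - b) im.1 *
      poch (d - c) im.1 * poch (d + im.1) im.2 * poch (e - a) im.2 * poch (f - a) im.2 /
        (im.1.factorial : ℂ) =
      ∑ jl ∈ antidiagonal im.2, poch (-n) im.1 * poch a im.1 * poch (d - b) im.1 *
        poch (d - c) im.1 * poch (d + im.1) im.2 / (im.1.factorial : ℂ) *
        (poch (-im.2) jl.1 * poch (a + im.1) jl.1 * poch (b + c - d) jl.1 *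
          poch (e + im.1 + jl.1) jl.2 * poch (f + im.1 + jl.1) jl.2 / (jl.1.factorial : ℂ)) := by
    rintro ⟨i, m⟩ him
    have hn : n = i + m := (HasAntidiagonal.mem_antidiagonal.1 him).symm
    rw [← mul_sum, saalschutz_neg, add_sub_add_right_eq_sub, add_sub_add_right_eq_sub]
    · ring
    · rw [hn] at h
      push_cast at h
      linear_combination h
  rw [sum_congr rfl e₂, sum_sigma', sum_sigma']
  -- Both sides run over triples i + j + l = n, grouped once as k = i + j and once as m = j + l.
  refine sum_nbij' (fun x => ⟨(x.2.1, x.2.2 + x.1.2), (x.2.2, x.1.2)⟩)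
    (fun x => ⟨(x.1.1 + x.2.1, x.2.2), (x.1.1, x.2.1)⟩) ?_ ?_ ?_ ?_ ?_
  · rintro ⟨⟨k, l⟩, ⟨i, j⟩⟩ h
    simp only [mem_sigma, HasAntidiagonal.mem_antidiagonal] at h ⊢
    exact ⟨by omega, trivial⟩
  · rintro ⟨⟨k, l⟩, ⟨i, j⟩⟩ h
    simp only [mem_sigma, HasAntidiagonal.mem_antidiagonal] at h ⊢
    exact ⟨by omega, trivial⟩
  · rintro ⟨⟨k, l⟩, ⟨i, j⟩⟩ h
    simp only [mem_sigma, HasAntidiagonal.mem_antidiagonal] at h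
    obtain ⟨rfl, rfl⟩ := h
    rfl
  · rintro ⟨⟨k, l⟩, ⟨i, j⟩⟩ h
    simp only [mem_sigma, HasAntidiagonal.mem_antidiagonal] at h
    obtain ⟨rfl, rfl⟩ := h
    rfl
  · rintro ⟨⟨k, l⟩, ⟨i, j⟩⟩ h
    simp only [mem_sigma, HasAntidiagonal.mem_antidiagonal] at h
    have hn : n = i + (j + l) := by omega
    simp only
    rw [poch_add (-n : ℂ) i j, poch_add a i j, poch_add (d + i) j l, hn]
    push_cast
    rw [show -((i : ℂ) + (j + l)) + i = -(j + l) by ring, add_assoc d, add_assoc e, add_assoc f]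
    simp only [div_eq_mul_inv, mul_inv]
    ring

/-! ### The polynomials in the symmetric variable `s ^ 2` -/

/-- `∏_{j<k} ((a + j)² - X)`, whose value at `s²` is `(a + s)_k (a - s)_k`. -/
noncomputable def phi (a : ℂ) (k : ℕ) : ℂ[X] := ∏ j ∈ Finset.range k, (C ((a + j) ^ 2) - X)

/-- The common form of the Wilson and Racah polynomials in the variable `s²`, not normalized. -/
noncomputable def wilsonRacah (n : ℕ) (a b c d : ℂ) : ℂ[X] :=
  ∑ kl ∈ Finset.HasAntidiagonal.antidiagonal n, C (poch (-n) kl.1 * poch (n + a + b + c + d - 1) kl.1 *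
    (poch (a + b + kl.1) kl.2 * poch (a + c + kl.1) kl.2 * poch (a + d + kl.1) kl.2) /
      (kl.1.factorial : ℂ)) * phi a kl.1

/-! ### Degrees and leading coefficients. -/

theorem natDegree_prod_C_sub_X_le (f : ℕ → ℂ) (k : ℕ) :
    (∏ j ∈ Finset.range k, (C (f j) - X)).natDegree ≤ k := by
  refine (natDegree_prod_le _ _).trans ?_
  refine (Finset.sum_le_card_nsmul _ _ 1 fun j _ => ?_).trans (by simp)
  exact natDegree_sub_le_of_le ((natDegree_C _).le.trans zero_le_one) natDegree_X_le

theorem coeff_prod_C_sub_X (f : ℕ → ℂ) (k : ℕ) :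
    (∏ j ∈ Finset.range k, (C (f j) - X)).coeff k = (-1) ^ k := by
  induction k with
  | zero => simp
  | succ k ih =>
    rw [Finset.prod_range_succ, mul_sub, coeff_sub, coeff_mul_X, ih, coeff_mul_C,
      coeff_eq_zero_of_natDegree_lt ((natDegree_prod_C_sub_X_le f k).trans_lt k.lt_succ_self)]
    ring

theorem natDegree_sum_prod_C_sub_X_le (c f : ℕ → ℂ) (n : ℕ) :
    (∑ k ∈ Finset.range (n + 1), C (c k) * ∏ j ∈ Finset.range k, (C (f j) - X)).natDegree ≤ n := by
  refine natDegree_sum_le_of_forall_le _ _ fun k hk => ?_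
  exact (natDegree_C_mul_le _ _).trans ((natDegree_prod_C_sub_X_le f k).trans
    (Nat.lt_succ_iff.1 (Finset.mem_range.1 hk)))

theorem coeff_sum_prod_C_sub_X (c f : ℕ → ℂ) (n : ℕ) :
    (∑ k ∈ Finset.range (n + 1), C (c k) * ∏ j ∈ Finset.range k, (C (f j) - X)).coeff n =
      c n * (-1) ^ n := by
  rw [Finset.sum_range_succ, coeff_add, coeff_C_mul, coeff_prod_C_sub_X, finsetSum_coeff,
    Finset.sum_eq_zero, zero_add]
  intro k hk
  rw [coeff_C_mul, coeff_eq_zero_of_natDegree_lt, mul_zero]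
  exact (natDegree_prod_C_sub_X_le f k).trans_lt (Finset.mem_range.1 hk)

theorem wilsonRacah_eq_sum_range (n : ℕ) (a b c d : ℂ) :
    wilsonRacah n a b c d = ∑ k ∈ Finset.range (n + 1),
      C (poch (-n) k * poch (n + a + b + c + d - 1) k *
        (poch (a + b + k) (n - k) * poch (a + c + k) (n - k) * poch (a + d + k) (n - k)) /
          (k.factorial : ℂ)) * ∏ j ∈ Finset.range k, (C ((a + j) ^ 2) - X) :=
  Finset.Nat.sum_antidiagonal_eq_sum_range_succ_mk _ n

theorem poch_neg_self (n : ℕ) : poch (-n) n = (-1) ^ n * (n.factorial : ℂ) := by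
  simpa using poch_neg_add n 0

theorem natDegree_wilsonRacah_le (n : ℕ) (a b c d : ℂ) :
    (wilsonRacah n a b c d).natDegree ≤ n := by
  rw [wilsonRacah_eq_sum_range]
  exact natDegree_sum_prod_C_sub_X_le _ (fun j => (a + j) ^ 2) n

theorem coeff_wilsonRacah (n : ℕ) (a b c d : ℂ) :
    (wilsonRacah n a b c d).coeff n = poch (n + a + b + c + d - 1) n := by
  rw [wilsonRacah_eq_sum_range, coeff_sum_prod_C_sub_X _ (fun j => (a + j) ^ 2)]
  have := fact_ne n
  rw [poch_neg_self]
  have h : ((-1 : ℂ) ^ n) * (-1) ^ n = 1 := by rw [← mul_pow]; simp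
  simp only [Nat.sub_self, poch_zero, mul_one]
  field_simp
  linear_combination poch (n + a + b + c + d - 1) n * h

theorem racah_monic (n : ℕ) (α β γ δ : ℂ) (h : poch (n + α + β + 1) n ≠ 0) :
    (racah n α β γ δ).Monic ∧ (racah n α β γ δ).natDegree = n := by
  have h₁ : (racah n α β γ δ).natDegree ≤ n :=
    (natDegree_C_mul_le _ _).trans (natDegree_sum_prod_C_sub_X_le _ (fun j => lam γ δ j) n)
  have h₂ : (racah n α β γ δ).coeff n = 1 := by
    rw [racah, coeff_C_mul, coeff_sum_prod_C_sub_X _ (fun j => lam γ δ j), poch_neg_self]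
    have := fact_ne n
    have h : ((-1 : ℂ) ^ n) * (-1) ^ n = 1 := by rw [← mul_pow]; simp
    simp only [Nat.sub_self, poch_zero, mul_one]
    field_simp
    linear_combination h
  refine ⟨monic_of_natDegree_le_of_coeff_eq_one n h₁ h₂, le_antisymm h₁ ?_⟩
  exact le_natDegree_of_ne_zero (by rw [h₂]; exact one_ne_zero)

theorem phi_eval_sq (a s : ℂ) (k : ℕ) : (phi a k).eval (s ^ 2) = poch (a - s) k * poch (a + s) k := by
  simp only [phi, poch_eq_prod, ← Finset.prod_mul_distrib, eval_prod, eval_sub, eval_C, eval_X]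
  exact Finset.prod_congr rfl fun j _ => by ring

theorem phi_succ (a : ℂ) (k : ℕ) : phi a (k + 1) = phi a k * (C ((a + k) ^ 2) - X) :=
  Finset.prod_range_succ _ _

theorem phi_zero (a : ℂ) : phi a 0 = 1 := Finset.prod_range_zero _

theorem phi_add (a : ℂ) (m n : ℕ) : phi a (m + n) = phi a m * phi (a + m) n := by
  simp only [phi, Finset.prod_range_add]
  congr 1
  exact Finset.prod_congr rfl fun j _ => by push_cast; ring_nf

/-- The discriminant shift of the Racah polynomials: `racah` in the symmetric variable. -/
theorem racah_eval_lam (n : ℕ) (α β γ δ x : ℂ) :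
    (racah n α β γ δ).eval (lam γ δ x) = (poch (n + α + β + 1) n)⁻¹ *
      (wilsonRacah n ((γ + δ + 1) / 2) (α + 1 - (γ + δ + 1) / 2) (β + δ + 1 - (γ + δ + 1) / 2)
        (γ + 1 - (γ + δ + 1) / 2)).eval ((x + (γ + δ + 1) / 2) ^ 2) := by
  rw [wilsonRacah_eq_sum_range, racah, eval_mul, eval_C]
  congr 1
  simp only [eval_finsetSum, eval_mul, eval_C, eval_prod, eval_sub, eval_X, add_sub_cancel]
  refine Finset.sum_congr rfl fun k _ => ?_
  congr 1
  · congr 4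
    ring
  · exact Finset.prod_congr rfl fun j _ => by unfold lam; ring

theorem wilson_eval_neg (n : ℕ) (a b c d y : ℂ) :
    (wilson n a b c d).eval (-y) = (-1) ^ n * (poch (n + a + b + c + d - 1) n)⁻¹ *
      (wilsonRacah n a b c d).eval y := by
  rw [wilsonRacah_eq_sum_range, wilson, eval_mul, eval_C]
  congr 1
  simp only [eval_finsetSum, eval_mul, eval_C, eval_prod, eval_sub, eval_X, eval_add]
  rfl

/-- If `a + b = -N`, the polynomials of degree `N + 1 + m` split off the factor of degree `N + 1`. -/
theorem wilsonRacah_factor (N m : ℕ) (a b c d : ℂ) (h : a + b = -N) :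
    wilsonRacah (N + 1 + m) a b c d =
      C ((-1) ^ (N + 1) * poch ((N + 1 + m : ℕ) + a + b + c + d - 1) (N + 1)) * phi a (N + 1) *
        wilsonRacah m (a + (N + 1 : ℕ)) (1 - a) c d := by
  rw [wilsonRacah_eq_sum_range, show N + 1 + m + 1 = N + 1 + (m + 1) by ring,
    Finset.sum_range_add, Finset.sum_eq_zero, zero_add, wilsonRacah_eq_sum_range, Finset.mul_sum]
  · refine Finset.sum_congr rfl fun k hk => ?_
    obtain ⟨l, rfl⟩ := Nat.exists_eq_add_of_le (Nat.lt_succ_iff.1 (Finset.mem_range.1 hk))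
    have e := phi_add a (N + 1) k
    simp only [phi] at e ⊢
    rw [e]
    rw [show N + 1 + (k + l) - (N + 1 + k) = l by omega, Nat.add_sub_cancel_left,
      mul_assoc (C _) (∏ _ ∈ _, _), mul_left_comm (∏ _ ∈ _, _) (C _), ← mul_assoc (C _) (C _),
      ← C_mul]
    congr 2
    rw [poch_add _ (N + 1) k, poch_add _ (N + 1) k]
    have h₁ := poch_neg_add (N + 1) (k + l)
    have h₂ := poch_nat_add_one k l
    have h₃ := poch_nat_add_one (N + 1 + k) l
    rw [← eq_div_iff (fact_ne _)] at h₁ h₂ h₃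
    -- Two factors exchange roles: (a+b+N+1+k)_l = (k+l)!/k! supplies the new 1/k!, while the old
    -- 1/(N+1+k)! becomes part of the Pochhammer symbol of the new pair sum (a+N+1) + (1-a) = N+2.
    have e₁ : a + b + ((N + 1 + k : ℕ) : ℂ) = k + 1 := by push_cast; linear_combination h
    have e₂ : a + ((N + 1 : ℕ) : ℂ) + (1 - a) + k = (N + 1 + k : ℕ) + 1 := by push_cast; ring
    have e₃ : ((k + l : ℕ) : ℂ) + (a + ((N + 1 : ℕ) : ℂ)) + (1 - a) + c + d - 1 =
        ((N + 1 + (k + l) : ℕ) : ℂ) + a + b + c + d - 1 + ((N + 1 : ℕ) : ℂ) := by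
      push_cast; linear_combination -h
    have e₄ : -((N + 1 + (k + l) : ℕ) : ℂ) + ((N + 1 : ℕ) : ℂ) = -((k + l : ℕ) : ℂ) := by
      push_cast; ring
    have e₅ : ∀ u : ℂ, u + ((N + 1 + k : ℕ) : ℂ) = u + ((N + 1 : ℕ) : ℂ) + k := by
      intro u; push_cast; ring
    rw [e₁, e₂, e₃, e₄, h₁, h₂, h₃, e₅, e₅, add_right_comm a _ c, add_right_comm a _ d,
      ← add_assoc (N + 1) k l]
    have := fact_ne (k + l)
    have := fact_ne (N + 1 + k + l)
    have := fact_ne (N + 1 + k)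
    have := fact_ne k
    field_simp
  · intro k hk
    have hk' := Finset.mem_range.1 hk
    -- For k ≤ N the symbol (-N+k)_{N+1+m-k} runs through zero.
    rw [poch_eq_zero (a := a + b + k) (j := N - k), mul_comm (poch _ _ * poch _ _) (_ * _ * _)]
    · simp
    · omega
    · rw [h, Nat.cast_sub (by omega)]; ring

theorem racah_factorization (N : ℕ) (α β γ δ : ℂ) (hα : α + 1 = -(N : ℂ))
    (hαβ : ∀ m : ℕ, α + β + 2 + m ≠ 0) (n : ℕ) (hn : N < n) (x : ℂ) :
    (racah n α β γ δ).eval (lam γ δ x) =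
      (racah (N + 1) (-N - 1) β γ δ).eval (lam γ δ x) * (-1) ^ (n - N - 1) *
        (wilson (n - N - 1) (N + (γ + δ + 3) / 2) ((-γ - δ + 1) / 2)
          (β + (-γ + δ + 1) / 2) ((γ - δ + 1) / 2)).eval
            ((Complex.I * (x + (γ + δ + 1) / 2)) ^ 2) := by
  obtain ⟨m, rfl⟩ := Nat.exists_eq_add_of_le (Nat.succ_le_of_lt hn)
  simp only [Nat.succ_eq_add_one] at *
  obtain rfl : α = -N - 1 := by linear_combination hα
  set e : ℂ := (γ + δ + 1) / 2 with he
  have h₁ := fun m => wilsonRacah_factor N m e (-N - 1 + 1 - e) (β + δ + 1 - e) (γ + 1 - e)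
    (by ring)
  -- The factor R_{N+1} is the case m = 0 of the same splitting, so only normalizing constants
  -- remain to be compared.
  rw [racah_eval_lam, racah_eval_lam, ← he, h₁, h₁ 0,
    show (Complex.I * (x + e)) ^ 2 = -(x + e) ^ 2 by rw [mul_pow, Complex.I_sq]; ring,
    wilson_eval_neg, show N + 1 + m - N - 1 = m by omega]
  have p₁ : poch ((N + 1 : ℕ) + (-N - 1) + β + 1) (N + 1) ≠ 0 := by
    refine poch_ne_zero (fun j => ?_) _
    have := hαβ (N + j)
    push_cast at this ⊢
    intro h
    exact this (by linear_combination h)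
  have p₂ : poch ((N + 1 + m : ℕ) + (-N - 1) + β + 1) (N + 1) ≠ 0 := by
    refine poch_ne_zero (fun j => ?_) _
    have := hαβ (N + m + j)
    push_cast at this ⊢
    intro h
    exact this (by linear_combination h)
  have q₁ : ((N + 1 + 0 : ℕ) : ℂ) + e + (-N - 1 + 1 - e) + (β + δ + 1 - e) + (γ + 1 - e) - 1 =
      (N + 1 : ℕ) + (-N - 1) + β + 1 := by rw [he]; push_cast; ring
  have q₂ : ((N + 1 + m : ℕ) : ℂ) + e + (-N - 1 + 1 - e) + (β + δ + 1 - e) + (γ + 1 - e) - 1 =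
      (N + 1 + m : ℕ) + (-N - 1) + β + 1 := by rw [he]; push_cast; ring
  have q₃ : (m : ℂ) + (N + (γ + δ + 3) / 2) + ((-γ - δ + 1) / 2) + (β + (-γ + δ + 1) / 2) +
      ((γ - δ + 1) / 2) - 1 = ((N + 1 + m : ℕ) + (-N - 1) + β + 1) + (N + 1 : ℕ) := by
    push_cast; ring
  have r₁ : (N : ℂ) + (γ + δ + 3) / 2 = e + (N + 1 : ℕ) := by rw [he]; push_cast; ring
  have r₂ : (-γ - δ + 1) / 2 = 1 - e := by rw [he]; ring
  have r₃ : β + (-γ + δ + 1) / 2 = β + δ + 1 - e := by rw [he]; ring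
  have r₄ : (γ - δ + 1) / 2 = γ + 1 - e := by rw [he]; ring
  rw [q₁, q₂, q₃, r₁, r₂, r₃, r₄, poch_add _ (N + 1) m]
  have w₀ : ∀ a b c d : ℂ, wilsonRacah 0 a b c d = 1 := by
    intro a b c d; simp [wilsonRacah, poch_zero, phi_zero]
  rw [w₀]
  have h : ((-1 : ℂ) ^ m) * (-1) ^ m = 1 := by rw [← mul_pow]; simp
  simp only [eval_mul, eval_C, eval_one, mul_inv]
  have p₃ : poch ((N + 1 + m : ℕ) + (-N - 1) + β + 1 + (N + 1 : ℕ)) m ≠ 0 := by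
    refine poch_ne_zero (fun j => ?_) _
    have := hαβ (N + m + j + (N + 1))
    push_cast at this ⊢
    intro h
    exact this (by linear_combination h)
  set V := (phi e (N + 1)).eval ((x + e) ^ 2)
  set Y := (wilsonRacah m (e + (N + 1 : ℕ)) (1 - e) (β + δ + 1 - e) (γ + 1 - e)).eval ((x + e) ^ 2)
  field_simp
  linear_combination -V * Y * h

/-! ### Generating functions. -/

/-- Whipple's transformation with -x as the retained upper parameter and β+δ+1 as the retained lower
one makes the i-th term a product of a factor in i and a factor in n - i. -/
theorem racah_generating_coeff (n : ℕ) (α β γ δ x : ℂ) (h : poch (n + α + β + 1) n ≠ 0)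
    (h₁ : ∀ m : ℕ, β + δ + 1 ≠ -(m : ℂ)) (h₂ : ∀ m : ℕ, α - δ + 1 ≠ -(m : ℂ)) :
    poch (n + α + β + 1) n / (poch (β + δ + 1) n * poch (α - δ + 1) n * (n.factorial : ℂ)) *
      (racah n α β γ δ).eval (lam γ δ x) =
    ∑ im ∈ Finset.HasAntidiagonal.antidiagonal n,
      (poch (-x) im.1 * poch (-x + β - γ) im.1 / (poch (β + δ + 1) im.1 * im.1.factorial)) *
      (poch (x + α + 1) im.2 * poch (x + γ + 1) im.2 /
        (poch (α - δ + 1) im.2 * im.2.factorial)) := by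
  have n₁ := fun n => poch_ne_zero (a := β + δ + 1) (fun j e => h₁ j (by linear_combination e)) n
  have n₂ := fun n => poch_ne_zero (a := α - δ + 1) (fun j e => h₂ j (by linear_combination e)) n
  have hw := whipple (-x) (x + γ + δ + 1) (n + α + β + 1) (β + δ + 1) (α + 1) (γ + 1) n (by ring)
  have hr : (racah n α β γ δ).eval (lam γ δ x) = (poch (n + α + β + 1) n)⁻¹ *
      ∑ kl ∈ Finset.HasAntidiagonal.antidiagonal n, poch (-n) kl.1 * poch (-x) kl.1 * poch (x + γ + δ + 1) kl.1 *
        poch (n + α + β + 1) kl.1 * (poch (β + δ + 1 + kl.1) kl.2 * poch (α + 1 + kl.1) kl.2 *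
          poch (γ + 1 + kl.1) kl.2) / (kl.1.factorial : ℂ) := by
    rw [Finset.Nat.sum_antidiagonal_eq_sum_range_succ_mk, racah, eval_mul, eval_C, eval_finsetSum]
    congr 1
    refine Finset.sum_congr rfl fun k _ => ?_
    have e : ∏ j ∈ Finset.range k, (lam γ δ j - lam γ δ x) =
        poch (-x) k * poch (x + γ + δ + 1) k := by
      simp only [poch_eq_prod, ← Finset.prod_mul_distrib]
      exact Finset.prod_congr rfl fun j _ => by unfold lam; ring
    simp only [eval_mul, eval_C, eval_prod, eval_sub, eval_X, e]
    ring
  rw [hr, hw, Finset.mul_sum, Finset.mul_sum]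
  refine Finset.sum_congr rfl ?_
  rintro ⟨i, m⟩ hi
  obtain rfl : n = i + m := (Finset.HasAntidiagonal.mem_antidiagonal.1 hi).symm
  have e₁ := poch_neg_add i m
  rw [← eq_div_iff (fact_ne _)] at e₁
  -- The one factor still mixing i and n is (δ-α-n)_i. Reflected, it is (α-δ+1+m)_i up to sign,
  -- which cancels against (α-δ+1)_n and leaves (α-δ+1)_m.
  have e₂ := poch_reflect (β + δ + 1 - ((i + m : ℕ) + α + β + 1)) i
  rw [show 1 - (β + δ + 1 - (((i + m : ℕ) : ℂ) + α + β + 1)) - i = α - δ + 1 + m by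
    push_cast; ring] at e₂
  have e₃ := poch_add (α - δ + 1) m i
  rw [add_comm m i] at e₃
  have e₄ := poch_add (β + δ + 1) i m
  have m₁ := n₁ i
  have m₂ := n₂ m
  have m₃ := n₁ (i + m)
  have m₄ := n₂ (i + m)
  rw [e₃] at m₄
  rw [e₄] at m₃
  have m₅ := right_ne_zero_of_mul m₃
  have m₆ := right_ne_zero_of_mul m₄
  have := fact_ne i
  have := fact_ne m
  have := fact_ne (i + m)
  have h' : ((-1 : ℂ) ^ i) * (-1) ^ i = 1 := by rw [← mul_pow]; simp
  simp only
  rw [e₁, e₂, e₃, e₄, show β + δ + 1 - (x + γ + δ + 1) = -x + β - γ by ring,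
    show α + 1 - -x = x + α + 1 by ring, show γ + 1 - -x = x + γ + 1 by ring]
  field_simp
  linear_combination (poch (-x) i * poch (-x + β - γ) i * poch (x + α + 1) m *
    poch (x + γ + 1) m) * h'

/-- The radius of convergence is infinite if an upper parameter is a non-positive integer, and 1
otherwise. -/
theorem hypergeometric_summable (a b c t : ℂ) (hc : ∀ m : ℕ, c ≠ -(m : ℂ)) (ht : ‖t‖ < 1) :
    Summable (fun n : ℕ => ‖poch a n * poch b n / (poch c n * n.factorial) * t ^ n‖) := by
  have hr : 1 ≤ (ordinaryHypergeometricSeries ℂ a b c).radius := by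
    by_cases ha : ∃ k : ℕ, a = -k
    · obtain ⟨k, rfl⟩ := ha
      rw [ordinaryHypergeometric_radius_top_of_neg_nat₁]; exact le_top
    by_cases hb : ∃ k : ℕ, b = -k
    · obtain ⟨k, rfl⟩ := hb
      rw [ordinaryHypergeometric_radius_top_of_neg_nat₂]; exact le_top
    push Not at ha hb
    rw [ordinaryHypergeometricSeries_radius_eq_one]
    exact fun k => ⟨fun e => ha k (by rw [e]; ring), fun e => hb k (by rw [e]; ring),
      fun e => hc k (by rw [e]; ring)⟩
  have := (ordinaryHypergeometricSeries ℂ a b c).summable_norm_apply (x := t)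
    (Metric.eball_subset_eball hr (by simpa [Metric.mem_eball, edist_zero_right] using
      (show ‖t‖ₑ < 1 by simpa [enorm] using (NNReal.coe_lt_coe.1 (by simpa using ht) : ‖t‖₊ < 1))))
  refine this.congr fun n => ?_
  rw [ordinaryHypergeometricSeries_apply_eq]
  congr 1
  simp only [smul_eq_mul, poch, div_eq_mul_inv, mul_inv]
  ring

theorem hypergeometric_eq_tsum (a b c t : ℂ) :
    ₂F₁ a b c t = ∑' n : ℕ, poch a n * poch b n / (poch c n * n.factorial) * t ^ n := by
  rw [ordinaryHypergeometric_eq_tsum]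
  refine tsum_congr fun n => ?_
  simp only [smul_eq_mul, poch, div_eq_mul_inv, mul_inv]
  ring

theorem racah_generating (α β γ δ : ℂ) (hαβ : ∀ m : ℕ, α + β + 2 + m ≠ 0)
    (h₁ : ∀ m : ℕ, β + δ + 1 ≠ -(m : ℂ)) (h₂ : ∀ m : ℕ, α - δ + 1 ≠ -(m : ℂ))
    (x t : ℂ) (ht : ‖t‖ < 1) :
    HasSum (fun n : ℕ => poch (n + α + β + 1) n /
        (poch (β + δ + 1) n * poch (α - δ + 1) n * (n.factorial : ℂ)) *
        (racah n α β γ δ).eval (lam γ δ x) * t ^ n)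
      (₂F₁ (-x) (-x + β - γ) (β + δ + 1) t * ₂F₁ (x + α + 1) (x + γ + 1) (α - δ + 1) t) := by
  have s₁ := hypergeometric_summable (-x) (-x + β - γ) (β + δ + 1) t h₁ ht
  have s₂ := hypergeometric_summable (x + α + 1) (x + γ + 1) (α - δ + 1) t h₂ ht
  rw [hypergeometric_eq_tsum, hypergeometric_eq_tsum,
    tsum_mul_tsum_eq_tsum_sum_antidiagonal_of_summable_norm s₁ s₂]
  have e : ∀ n : ℕ, poch (n + α + β + 1) n /
        (poch (β + δ + 1) n * poch (α - δ + 1) n * (n.factorial : ℂ)) *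
        (racah n α β γ δ).eval (lam γ δ x) * t ^ n =
      ∑ kl ∈ Finset.HasAntidiagonal.antidiagonal n,
        poch (-x) kl.1 * poch (-x + β - γ) kl.1 / (poch (β + δ + 1) kl.1 * kl.1.factorial) *
          t ^ kl.1 * (poch (x + α + 1) kl.2 * poch (x + γ + 1) kl.2 /
            (poch (α - δ + 1) kl.2 * kl.2.factorial) * t ^ kl.2) := by
    intro n
    have hn : poch (n + α + β + 1) n ≠ 0 := by
      cases n with
      | zero => simp [poch_zero]
      | succ n =>
        refine poch_ne_zero (fun j e => hαβ (n + j) ?_) _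
        push_cast at e ⊢
        linear_combination e
    rw [racah_generating_coeff n α β γ δ x hn h₁ h₂, Finset.sum_mul]
    refine Finset.sum_congr rfl fun kl hkl => ?_
    rw [← Finset.HasAntidiagonal.mem_antidiagonal.1 hkl, pow_add]
    ring
  simp only [e]
  exact (summable_norm_sum_mul_antidiagonal_of_summable_norm s₁ s₂).of_norm.hasSum

/-- The substitution keeps γ + δ, hence λ, and exchanges the lower parameters β+δ+1 and γ+1. It
carries the first generating function to the second. -/
theorem racah_eval_swap (n : ℕ) (α β γ δ x : ℂ) :
    (racah n α β γ δ).eval (lam γ δ x) =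
      (racah n α β (β + δ) (γ - β)).eval (lam (β + δ) (γ - β) x) := by
  rw [racah, racah, eval_mul, eval_mul, eval_C, eval_C]
  congr 1
  have e : ∀ x, lam (β + δ) (γ - β) x = lam γ δ x := fun x => by unfold lam; ring
  simp only [eval_finsetSum, eval_mul, eval_C, eval_prod, eval_sub, eval_X, e,
    show β + (γ - β) + 1 = γ + 1 by ring]
  exact Finset.sum_congr rfl fun k _ => by ring

/-! ### Functionals satisfying a Pearson equation -/

/-- A functional on polynomials in `s²` that satisfies the Pearson equation of the Wilson–Racah
weight with parameters `a`, `b`, `c`, `d`. -/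
def IsPearson (L : ℂ[X] →ₗ[ℂ] ℂ) (a b c d : ℂ) : Prop :=
  ∀ u p : ℂ[X], (∀ s : ℂ, 2 * s * p.eval (s ^ 2) =
    (a + s) * (b + s) * (c + s) * (d + s) * u.eval ((s + 1 / 2) ^ 2) -
      (a - s) * (b - s) * (c - s) * (d - s) * u.eval ((s - 1 / 2) ^ 2)) → L p = 0

namespace IsPearson

variable {L : ℂ[X] →ₗ[ℂ] ℂ} {a b c d : ℂ}

theorem swap (h : IsPearson L a b c d) : IsPearson L b a c d :=
  fun u p hp => h u p fun s => by rw [hp]; ring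

/-- The identity (a+1/2)² - (s+1/2)² = (a-s)(a+1+s), with its mirror image under s ↦ -s, lets the
extra factor of the test polynomial convert a ± s into (a² - s²)(a+1 ± s). -/
theorem shift_one (h : IsPearson L a b c d) :
    IsPearson (L ∘ₗ LinearMap.mulLeft ℂ (C (a ^ 2) - X)) (a + 1) b c d := by
  intro u p hp
  refine h ((C ((a + 1 / 2) ^ 2) - X) * u) _ fun s => ?_
  simp only [LinearMap.mulLeft_apply, eval_mul, eval_sub, eval_C, eval_X]
  linear_combination (a ^ 2 - s ^ 2) * hp s

theorem shift (h : IsPearson L a b c d) (k : ℕ) :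
    IsPearson (L ∘ₗ LinearMap.mulLeft ℂ (phi a k)) (a + k) b c d := by
  induction k with
  | zero =>
    convert! h using 1
    · ext; simp [phi_zero]
    · simp
  | succ k ih =>
    convert! ih.shift_one using 1
    · ext; simp [phi_succ]
    · push_cast; ring

/-- The Pearson equation with u = 1 produces a polynomial linear in s², hence a relation between the
first two moments. -/
theorem moment_one (h : IsPearson L a b c d) :
    (a + b + c + d) * L (C (a ^ 2) - X) = (a + b) * (a + c) * (a + d) * L 1 := by
  have h₁ := h 1 (C (b * c * d + a * c * d + a * b * d + a * b * c) + C (a + b + c + d) * X)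
    fun s => by simp only [eval_add, eval_mul, eval_C, eval_X, eval_one]; ring
  have h₂ : (a + b + c + d) • (C (a ^ 2) - X) + (C (b * c * d + a * c * d + a * b * d + a * b * c) +
      C (a + b + c + d) * X) = ((a + b) * (a + c) * (a + d)) • (1 : ℂ[X]) := by
    simp only [smul_eq_C_mul, map_add, map_mul, map_pow]
    ring
  have h₃ := congrArg L h₂
  rw [map_add, h₁, map_smul, map_smul, add_zero] at h₃
  exact h₃

theorem moment (h : IsPearson L a b c d) (k : ℕ) :
    poch (a + b + c + d) k * L (phi a k) =
      poch (a + b) k * poch (a + c) k * poch (a + d) k * L 1 := by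
  induction k with
  | zero => simp [poch_zero, phi_zero]
  | succ k ih =>
    have := (h.shift k).moment_one
    simp only [LinearMap.comp_apply, LinearMap.mulLeft_apply, mul_one, ← phi_succ] at this
    simp only [poch_succ]
    linear_combination poch (a + b + c + d) k * this +
      (a + b + k) * (a + c + k) * (a + d + k) * ih

/-- Raising a by k and then b by m keeps every moment explicit. This is why P_n, expanded in `phi
a`, is tested against `phi b`. -/
theorem moment₂ (h : IsPearson L a b c d) (k m : ℕ) :
    poch (a + b + c + d) (k + m) * L (phi a k * phi b m) =
      poch (a + b) (k + m) * poch (a + c) k * poch (a + d) k * poch (b + c) m * poch (b + d) m *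
        L 1 := by
  have h₁ := (h.shift k).swap.moment m
  have h₂ := h.moment k
  simp only [LinearMap.comp_apply, LinearMap.mulLeft_apply, mul_one] at h₁
  rw [show b + (a + k) + c + d = a + b + c + d + k by ring,
    show b + (a + (k : ℂ)) = a + b + k by ring] at h₁
  rw [poch_add, poch_add]
  linear_combination poch (a + b + c + d) k * h₁ +
    poch (a + b + k) m * poch (b + c) m * poch (b + d) m * h₂

/-- After `moment₂` the sum over k is of Saalschütz type. Its value contains (m+1-n)_n, the source
of orthogonality. -/
theorem apply_wilsonRacah_mul_phi (h : IsPearson L a b c d) (n m : ℕ) :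
    poch (a + b + c + d) (m + n) * L (wilsonRacah n a b c d * phi b m) =
      (-1) ^ n * poch (a + b) m * poch (a + c) n * poch (a + d) n * poch (b + c) m *
        poch (b + d) m * poch (c + d) n * poch (m + 1 - n) n * L 1 := by
  have hsum := saalschutz_neg (n + (a + b + c + d) - 1) (a + b + m) (a + b) (a + b + c + d + m) n
    (by ring)
  have hr := poch_reflect (c + d) n
  rw [show a + b - (n + (a + b + c + d) - 1) = 1 - (c + d) - n by ring,
    show a + b + c + d + m - (n + (a + b + c + d) - 1) = m + 1 - n by ring] at hsum
  have hsq : ((-1 : ℂ) ^ n) * (-1) ^ n = 1 := by rw [← mul_pow]; simp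
  have hr' : poch (1 - (c + d) - n) n = (-1) ^ n * poch (c + d) n := by
    rw [hr]; linear_combination -poch (1 - (c + d) - n) n * hsq
  rw [hr'] at hsum
  rw [wilsonRacah, Finset.sum_mul, map_sum]
  rw [show (-1) ^ n * poch (a + b) m * poch (a + c) n * poch (a + d) n * poch (b + c) m *
        poch (b + d) m * poch (c + d) n * poch (m + 1 - n) n * L 1 =
      poch (a + b) m * poch (a + c) n * poch (a + d) n * poch (b + c) m * poch (b + d) m * L 1 *
        ((-1) ^ n * poch (c + d) n * poch (m + 1 - n) n) by ring, ← hsum, Finset.mul_sum,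
    Finset.mul_sum]
  refine Finset.sum_congr rfl ?_
  rintro ⟨k, l⟩ hkl
  obtain rfl : n = k + l := (Finset.HasAntidiagonal.mem_antidiagonal.1 hkl).symm
  have hm := h.moment₂ k m
  simp only
  rw [mul_assoc (C _), ← smul_eq_C_mul, map_smul, smul_eq_mul]
  have e₁ : poch (a + b + c + d) (m + (k + l)) =
      poch (a + b + c + d) (k + m) * poch (a + b + c + d + m + k) l := by
    rw [← add_assoc, poch_add, add_comm m k]; push_cast; ring_nf
  have e₂ : poch (a + b) (k + m) = poch (a + b) m * poch (a + b + m) k := by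
    rw [Nat.add_comm, poch_add]
  rw [e₁, poch_add (a + c), poch_add (a + d)]
  rw [e₂] at hm
  rw [show ((k + l : ℕ) : ℂ) + a + b + c + d - 1 = (k + l : ℕ) + (a + b + c + d) - 1 by ring]
  linear_combination poch (a + b + c + d + m + k) l * (poch (-((k + l : ℕ) : ℂ)) k *
    poch ((k + l : ℕ) + (a + b + c + d) - 1) k *
    (poch (a + b + k) l * poch (a + c + k) l * poch (a + d + k) l) / (k.factorial : ℂ)) * hm

end IsPearson

/-! ### Orthogonality and norms from the Pearson equation. -/

theorem natDegree_phi_le (b : ℂ) (m : ℕ) : (phi b m).natDegree ≤ m :=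
  natDegree_prod_C_sub_X_le (fun j => (b + j) ^ 2) m

theorem coeff_phi (b : ℂ) (m : ℕ) : (phi b m).coeff m = (-1) ^ m :=
  coeff_prod_C_sub_X (fun j => (b + j) ^ 2) m

theorem degree_sub_phi_lt (b : ℂ) {n : ℕ} {Q : ℂ[X]} (hQ : Q.natDegree ≤ n) :
    (Q - (Q.coeff n * (-1) ^ n) • phi b n).degree < n := by
  rw [degree_lt_iff_coeff_zero]
  intro m hm
  rcases hm.eq_or_lt with rfl | hm
  · have h : ((-1 : ℂ) ^ n) * (-1) ^ n = 1 := by rw [← mul_pow]; simp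
    rw [coeff_sub, coeff_smul, coeff_phi, smul_eq_mul]
    linear_combination -Q.coeff n * h
  · rw [coeff_sub, coeff_smul, coeff_eq_zero_of_natDegree_lt (hQ.trans_lt hm),
      coeff_eq_zero_of_natDegree_lt ((natDegree_phi_le b n).trans_lt hm)]
    simp

theorem apply_eq_zero_of_phi (f : ℂ[X] →ₗ[ℂ] ℂ) (b : ℂ) (n : ℕ) (hf : ∀ m < n, f (phi b m) = 0)
    (Q : ℂ[X]) (hQ : Q.degree < n) : f Q = 0 := by
  induction n generalizing Q with
  | zero =>
    have h₀ : Q = 0 := degree_eq_bot.1 (by simpa using hQ)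
    rw [h₀]
    exact map_zero f
  | succ n ih =>
    have h := ih (fun m hm => hf m (hm.trans n.lt_succ_self)) _ (degree_sub_phi_lt b
      (natDegree_le_iff_degree_le.2 (Order.le_of_lt_succ (by exact_mod_cast hQ))))
    rw [map_sub, map_smul, hf n n.lt_succ_self, smul_zero, sub_zero] at h
    exact h

theorem apply_eq_of_phi (f : ℂ[X] →ₗ[ℂ] ℂ) (b : ℂ) (n : ℕ) (hf : ∀ m < n, f (phi b m) = 0)
    (Q : ℂ[X]) (hQ : Q.natDegree ≤ n) : f Q = Q.coeff n * (-1) ^ n * f (phi b n) := by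
  have h := apply_eq_zero_of_phi f b n hf _ (degree_sub_phi_lt b hQ)
  rw [map_sub, map_smul, sub_eq_zero, smul_eq_mul] at h
  exact h

namespace IsPearson

variable {L : ℂ[X] →ₗ[ℂ] ℂ} {a b c d : ℂ}

theorem apply_wilsonRacah_mul_phi_of_lt (h : IsPearson L a b c d)
    (hS : ∀ j : ℕ, a + b + c + d + j ≠ 0) {n m : ℕ} (hm : m < n) :
    L (wilsonRacah n a b c d * phi b m) = 0 := by
  have h₁ := h.apply_wilsonRacah_mul_phi n m
  rw [poch_eq_zero (a := (m : ℂ) + 1 - n) (j := n - m - 1) (by omega)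
    (by rw [Nat.sub_sub, Nat.cast_sub (by omega)]; push_cast; ring), mul_zero, zero_mul] at h₁
  exact (mul_eq_zero.1 h₁).resolve_left (poch_ne_zero hS _)

theorem wilsonRacah_orthogonal (h : IsPearson L a b c d)
    (hS : ∀ j : ℕ, a + b + c + d + j ≠ 0) {n m : ℕ} (hnm : n ≠ m) :
    L (wilsonRacah n a b c d * wilsonRacah m a b c d) = 0 := by
  wlog hm : m < n generalizing n m
  · rw [mul_comm]
    exact this hnm.symm (by omega)
  refine apply_eq_zero_of_phi (L ∘ₗ LinearMap.mulLeft ℂ (wilsonRacah n a b c d)) b n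
    (fun k hk => h.apply_wilsonRacah_mul_phi_of_lt hS hk) _ ?_
  exact lt_of_le_of_lt degree_le_natDegree (Nat.cast_lt.2 ((natDegree_wilsonRacah_le m _ _ _ _).trans_lt hm))

/-- By orthogonality only the leading term of the second factor counts, so the norm is a nonzero
multiple of L(P_n · `phi b n`), which is known in closed form. -/
theorem wilsonRacah_sq_ne_zero (h : IsPearson L a b c d)
    (hS : ∀ j : ℕ, a + b + c + d + j ≠ 0) (hL : L 1 ≠ 0) {n : ℕ}
    (hab : poch (a + b) n ≠ 0) (hac : poch (a + c) n ≠ 0) (had : poch (a + d) n ≠ 0)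
    (hbc : poch (b + c) n ≠ 0) (hbd : poch (b + d) n ≠ 0) (hcd : poch (c + d) n ≠ 0) :
    L (wilsonRacah n a b c d * wilsonRacah n a b c d) ≠ 0 := by
  have h₁ := apply_eq_of_phi (L ∘ₗ LinearMap.mulLeft ℂ (wilsonRacah n a b c d)) b n
    (fun k hk => h.apply_wilsonRacah_mul_phi_of_lt hS hk) _ (natDegree_wilsonRacah_le n a b c d)
  have h₂ := h.apply_wilsonRacah_mul_phi n n
  simp only [LinearMap.comp_apply, LinearMap.mulLeft_apply, coeff_wilsonRacah] at h₁
  rw [h₁]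
  have h₃ : poch (n + a + b + c + d - 1) n ≠ 0 := by
    cases n with
    | zero => simp [poch_zero]
    | succ n =>
      refine poch_ne_zero (fun j e => hS (n + j) ?_) _
      push_cast at e ⊢
      linear_combination e
  refine mul_ne_zero (mul_ne_zero h₃ (by simp)) fun h₄ => ?_
  rw [h₄, mul_zero, show (n : ℂ) + 1 - n = 1 by ring, poch_one_eq_factorial] at h₂
  have := fact_ne n
  have h₅ : (-1 : ℂ) ^ n ≠ 0 := by simp
  revert h₂
  simp [*]

end IsPearson

/-! ### The discrete part -/

/-- The sum over `x = 0, …, N` with the Racah weight, on polynomials in `(x + (γ + δ + 1) / 2)²`. -/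
noncomputable def racahSum (N : ℕ) (α β γ δ : ℂ) : ℂ[X] →ₗ[ℂ] ℂ :=
  ∑ x ∈ Finset.range (N + 1), racahWeight α β γ δ x • leval (((x : ℂ) + (γ + δ + 1) / 2) ^ 2)

theorem racahSum_apply (N : ℕ) (α β γ δ : ℂ) (p : ℂ[X]) :
    racahSum N α β γ δ p = ∑ x ∈ Finset.range (N + 1),
      racahWeight α β γ δ x * p.eval (((x : ℂ) + (γ + δ + 1) / 2) ^ 2) := by
  simp [racahSum, leval_apply]

theorem mul_div_four_cancel {P₁ P₂ P₃ P₄ n₁ n₂ n₃ n₄ Q₁ Q₂ Q₃ Q₄ b₁ b₂ b₃ b₄ t : ℂ}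
    (h₁ : b₁ ≠ 0) (h₂ : b₂ ≠ 0) (h₃ : b₃ ≠ 0) (h₄ : b₄ ≠ 0) :
    P₁ * n₁ * (P₂ * n₂) * (P₃ * n₃) * (P₄ * n₄) /
      (Q₁ * b₁ * (Q₂ * b₂) * (Q₃ * b₃) * (Q₄ * b₄)) / t * (b₁ * b₂ * b₃ * b₄) =
    P₁ * P₂ * P₃ * P₄ / (Q₁ * Q₂ * Q₃ * Q₄) / t * (n₁ * n₂ * n₃ * n₄) := by
  have h : b₁ * b₂ * b₃ * b₄ ≠ 0 := mul_ne_zero (mul_ne_zero (mul_ne_zero h₁ h₂) h₃) h₄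
  have e₁ : P₁ * n₁ * (P₂ * n₂) * (P₃ * n₃) * (P₄ * n₄) =
    (P₁ * P₂ * P₃ * P₄) * (n₁ * n₂ * n₃ * n₄) := by ring
  have e₂ : Q₁ * b₁ * (Q₂ * b₂) * (Q₃ * b₃) * (Q₄ * b₄) =
    (Q₁ * Q₂ * Q₃ * Q₄) * (b₁ * b₂ * b₃ * b₄) := by ring
  rw [e₁, e₂, mul_div_mul_comm, div_mul_eq_mul_div, mul_assoc, div_mul_cancel₀ _ h,
    div_mul_eq_mul_div, div_mul_eq_mul_div, div_mul_eq_mul_div]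

theorem racahWeight_eq (α β γ δ : ℂ) (x : ℕ) (h : poch ((γ + δ + 1) / 2) x ≠ 0)
    (h₀ : (γ + δ + 1) / 2 ≠ 0) :
    racahWeight α β γ δ x = poch (α + 1) x * poch (β + δ + 1) x * poch (γ + 1) x *
      poch (γ + δ + 1) x / (poch (-α + γ + δ + 1) x * poch (-β + γ + 1) x * poch (δ + 1) x *
      poch 1 x) / (2 * ((γ + δ + 1) / 2)) * (2 * (x + (γ + δ + 1) / 2)) := by
  set e : ℂ := (γ + δ + 1) / 2 with he
  have a₁ : poch e x * (e + x) = e * poch (e + 1) x := by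
    rw [← poch_succ, poch_succ_left]
  rw [racahWeight, ← he, show (γ + δ + 3) / 2 = e + 1 by rw [he]; ring]
  have a₃ : poch (e + 1) x = (x + e) / e * poch e x := by
    rw [div_mul_eq_mul_div, eq_div_iff h₀]; linear_combination -a₁
  rw [a₃]
  generalize poch (α + 1) x * poch (β + δ + 1) x * poch (γ + 1) x * poch (γ + δ + 1) x = A
  generalize poch (-α + γ + δ + 1) x = b₁
  generalize poch (-β + γ + 1) x = b₂
  generalize poch (δ + 1) x = b₃
  generalize poch 1 x = b₄
  generalize poch e x = b₅ at *
  rw [show b₁ * b₂ * b₅ * b₃ * b₄ = (b₁ * b₂ * b₃ * b₄) * b₅ by ring]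
  generalize b₁ * b₂ * b₃ * b₄ = B
  field_simp

/-- Summation by parts: at interior nodes the summand is a forward difference. The boundary terms
die at x = 0 through the factor -x and at x = N through α+1+x. Positivity of N extracts (γ+δ+1)/2 ≠
0 from `h₃`. -/
theorem racahSum_isPearson {N : ℕ} {α β γ δ : ℂ} (hN : 0 < N) (hα : α + 1 = -(N : ℂ))
    (h₁ : poch (-α + γ + δ + 1) N ≠ 0) (h₂ : poch (-β + γ + 1) N ≠ 0)
    (h₃ : poch ((γ + δ + 1) / 2) N ≠ 0) (h₄ : poch (δ + 1) N ≠ 0) :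
    IsPearson (racahSum N α β γ δ) ((γ + δ + 1) / 2) (α + 1 - (γ + δ + 1) / 2)
      (β + δ + 1 - (γ + δ + 1) / 2) (γ + 1 - (γ + δ + 1) / 2) := by
  intro u p hp
  have he' : γ + δ + 1 = 2 * ((γ + δ + 1) / 2) := by ring
  set e : ℂ := (γ + δ + 1) / 2 with he
  rw [poch_ne_zero_iff] at h₁ h₂ h₃ h₄
  have he0 : e ≠ 0 := by simpa using h₃ 0 hN
  -- The weight without its factor 2(x+e); that factor is the 2s on the left of the Pearson
  -- relation.
  set w : ℕ → ℂ := fun x => poch (α + 1) x * poch (β + δ + 1) x * poch (γ + 1) x *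
    poch (γ + δ + 1) x / (poch (-α + γ + δ + 1) x * poch (-β + γ + 1) x * poch (δ + 1) x *
      poch 1 x) / (2 * e) with hw
  set F : ℕ → ℂ := fun x => w x * ((e - (x + e)) * (α + 1 - e - (x + e)) *
    (β + δ + 1 - e - (x + e)) * (γ + 1 - e - (x + e)) * u.eval ((x + e - 1 / 2) ^ 2)) with hF
  have key : ∀ x < N + 1, racahWeight α β γ δ x * p.eval ((x + e) ^ 2) =
      w x * ((e + (x + e)) * (α + 1 - e + (x + e)) *
        (β + δ + 1 - e + (x + e)) * (γ + 1 - e + (x + e)) * u.eval ((x + e + 1 / 2) ^ 2)) - F x := by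
    intro x hx
    have h₅ : racahWeight α β γ δ x = w x * (2 * (x + e)) := by
      exact racahWeight_eq α β γ δ x ((poch_ne_zero_iff _ _).2 fun j hj => h₃ j (by omega)) he0
    simp only [hF]
    rw [h₅, ← mul_sub, ← hp (x + e)]
    ring
  have shift : ∀ x < N, F (x + 1) = w x * ((e + (x + e)) * (α + 1 - e + (x + e)) *
        (β + δ + 1 - e + (x + e)) * (γ + 1 - e + (x + e)) * u.eval ((x + e + 1 / 2) ^ 2)) := by
    intro x hx
    have b₁ := h₁ x hx
    have b₂ := h₂ x hx
    have b₄ := h₄ x hx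
    have b₅ : (1 + x : ℂ) ≠ 0 := by rw [add_comm]; exact_mod_cast x.succ_ne_zero
    have hwx : w (x + 1) * ((-α + γ + δ + 1 + x) * (-β + γ + 1 + x) * (δ + 1 + x) * (1 + x)) =
        w x * ((α + 1 + x) * (β + δ + 1 + x) * (γ + 1 + x) * (γ + δ + 1 + x)) := by
      simp only [hw, poch_succ]
      exact mul_div_four_cancel b₁ b₂ b₄ b₅
    simp only [hF]
    push_cast
    rw [show (x : ℂ) + 1 + e - 1 / 2 = x + e + 1 / 2 by ring]
    rw [show (e - (x + 1 + e)) * (α + 1 - e - (x + 1 + e)) * (β + δ + 1 - e - (x + 1 + e)) *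
      (γ + 1 - e - (x + 1 + e)) =
      (-α + γ + δ + 1 + x) * (-β + γ + 1 + x) * (δ + 1 + x) * (1 + x) by rw [he]; ring,
      ← mul_assoc, hwx]
    rw [he]
    ring
  rw [racahSum_apply, Finset.sum_congr rfl fun x hx => key x (Finset.mem_range.1 hx),
    Finset.sum_sub_distrib, Finset.sum_range_succ, Finset.sum_range_succ' F,
    Finset.sum_congr rfl fun x hx => shift x (Finset.mem_range.1 hx)]
  have z₁ : α + 1 - e + (N + e) = 0 := by rw [hα]; ring
  have z₂ : F 0 = 0 := by simp [hF]
  rw [z₁, z₂]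
  ring

/-- At the nodes, `phi e N` has the factor (-x)_N, which vanishes for x < N. Its moment is therefore
one nonzero term, whereas L(1) = 0 would force that moment to vanish. -/
theorem racahSum_one_ne_zero {N : ℕ} {α β γ δ : ℂ} (hα : α + 1 = -(N : ℂ))
    (hαβ : ∀ m : ℕ, α + β + 2 + m ≠ 0)
    (h₁ : poch (-α + γ + δ + 1) N ≠ 0) (h₂ : poch (-β + γ + 1) N ≠ 0)
    (h₃ : poch ((γ + δ + 1) / 2) N ≠ 0) (h₄ : poch (δ + 1) N ≠ 0)
    (h₅ : poch (β + δ + 1) N ≠ 0) (h₆ : poch (γ + 1) N ≠ 0) (h₇ : poch (γ + δ + 2) N ≠ 0) :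
    racahSum N α β γ δ 1 ≠ 0 := by
  rcases N.eq_zero_or_pos with rfl | hN
  · simp [racahSum_apply, racahWeight, poch_zero]
  intro h0
  have hm := (racahSum_isPearson hN hα h₁ h₂ h₃ h₄).moment N
  rw [h0, mul_zero, mul_eq_zero] at hm
  set e : ℂ := (γ + δ + 1) / 2 with he
  have hS : poch (e + (α + 1 - e) + (β + δ + 1 - e) + (γ + 1 - e)) N ≠ 0 :=
    poch_ne_zero (fun j => by convert! hαβ j using 1; rw [he]; ring) N
  have hm' := hm.resolve_left hS
  rw [racahSum_apply, Finset.sum_range_succ, Finset.sum_eq_zero, zero_add, phi_eval_sq,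
    show e - (N + e) = -N by ring] at hm'
  · have n₀ : poch (-N : ℂ) N ≠ 0 := by
      rw [poch_neg_self]; exact mul_ne_zero (by simp) (fact_ne N)
    rw [poch_ne_zero_iff] at h₁ h₇
    have he0 : e ≠ 0 := by simpa using (poch_ne_zero_iff _ _).1 h₃ 0 hN
    have hα' : α = -N - 1 := by linear_combination hα
    -- The lower half of the range is `h₇`; the upper half is `h₁`, since -α+γ+δ+1 = γ+δ+2+N.
    have n₁ : ∀ j < 2 * N, γ + δ + 2 + j ≠ 0 := by
      intro j hj
      by_cases hjN : j < N
      · exact h₇ j hjN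
      · have := h₁ (j - N) (by omega)
        rw [Nat.cast_sub (by omega), hα'] at this
        intro h
        exact this (by linear_combination h)
    have n₂ : poch (γ + δ + 1) N ≠ 0 := by
      rw [poch_ne_zero_iff]
      rintro (_ | j) hj h
      · exact he0 (by rw [he]; push_cast at h; linear_combination h / 2)
      · exact n₁ j (by omega) (by push_cast at h; linear_combination h)
    have n₃ : poch (e + (N + e)) N ≠ 0 := by
      rw [poch_ne_zero_iff]
      intro j hj h
      refine n₁ (N - 1 + j) (by omega) ?_
      rw [Nat.cast_add, Nat.cast_sub hN]
      rw [he] at h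
      push_cast
      linear_combination h
    have n₄ : poch ((γ + δ + 3) / 2) N ≠ 0 := by
      intro h
      have a₁ : poch e N * (e + N) = e * poch (e + 1) N := by
        rw [← poch_succ, poch_succ_left]
      rw [show e + 1 = (γ + δ + 3) / 2 by rw [he]; ring, h, mul_zero, mul_eq_zero] at a₁
      refine n₁ (2 * N - 1) (by omega) ?_
      have := a₁.resolve_left h₃
      rw [Nat.cast_sub (by omega)]
      rw [he] at this
      push_cast
      linear_combination 2 * this
    have n₅ : poch 1 N ≠ 0 := by rw [poch_one_eq_factorial]; exact fact_ne N
    rw [← poch_ne_zero_iff] at h₁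
    rw [racahWeight, hα, ← he] at hm'
    exact mul_ne_zero (div_ne_zero (mul_ne_zero (mul_ne_zero (mul_ne_zero (mul_ne_zero n₀ h₅) h₆)
      n₂) n₄) (mul_ne_zero (mul_ne_zero (mul_ne_zero (mul_ne_zero h₁ h₂) h₃) h₄) n₅))
      (mul_ne_zero n₀ n₃) hm'
  · intro x hx
    rw [phi_eval_sq, poch_eq_zero (a := e - (x + e)) (j := x) (Finset.mem_range.1 hx) (by ring)]
    simp

/-- The value of `racah` at the nodes, as a polynomial in the symmetric variable. -/
theorem sum_racah_mul_racah (N : ℕ) (α β γ δ : ℂ) (n m : ℕ) :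
    ∑ x ∈ Finset.range (N + 1), (racah n α β γ δ).eval (lam γ δ x) *
      (racah m α β γ δ).eval (lam γ δ x) * racahWeight α β γ δ x =
    (poch (n + α + β + 1) n)⁻¹ * (poch (m + α + β + 1) m)⁻¹ *
      racahSum N α β γ δ
        (wilsonRacah n ((γ + δ + 1) / 2) (α + 1 - (γ + δ + 1) / 2) (β + δ + 1 - (γ + δ + 1) / 2)
          (γ + 1 - (γ + δ + 1) / 2) *
         wilsonRacah m ((γ + δ + 1) / 2) (α + 1 - (γ + δ + 1) / 2) (β + δ + 1 - (γ + δ + 1) / 2)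
          (γ + 1 - (γ + δ + 1) / 2)) := by
  rw [racahSum_apply, Finset.mul_sum]
  refine Finset.sum_congr rfl fun x _ => ?_
  rw [racah_eval_lam, racah_eval_lam, eval_mul]
  ring

theorem sum_racah_orthogonal {N : ℕ} {α β γ δ : ℂ} (hα : α + 1 = -(N : ℂ))
    (hαβ : ∀ m : ℕ, α + β + 2 + m ≠ 0)
    (h₁ : poch (-α + γ + δ + 1) N ≠ 0) (h₂ : poch (-β + γ + 1) N ≠ 0)
    (h₃ : poch ((γ + δ + 1) / 2) N ≠ 0) (h₄ : poch (δ + 1) N ≠ 0)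
    {n m : ℕ} (hn : n ≤ N) (hm : m ≤ N) (hnm : n ≠ m) :
    ∑ x ∈ Finset.range (N + 1), (racah n α β γ δ).eval (lam γ δ x) *
      (racah m α β γ δ).eval (lam γ δ x) * racahWeight α β γ δ x = 0 := by
  rw [sum_racah_mul_racah, (racahSum_isPearson (by omega) hα h₁ h₂ h₃ h₄).wilsonRacah_orthogonal
    (fun j => by convert! hαβ j using 1; ring) hnm, mul_zero]

theorem poch_top_ne_zero {α β : ℂ} (hαβ : ∀ m : ℕ, α + β + 2 + m ≠ 0) (n : ℕ) :
    poch (n + α + β + 1) n ≠ 0 := by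
  cases n with
  | zero => simp [poch_zero]
  | succ n =>
    refine poch_ne_zero (fun j e => hαβ (n + j) ?_) _
    push_cast at e ⊢
    linear_combination e

theorem sum_racah_sq_ne_zero {N : ℕ} {α β γ δ : ℂ} (hα : α + 1 = -(N : ℂ))
    (hαβ : ∀ m : ℕ, α + β + 2 + m ≠ 0)
    (h₁ : poch (-α + γ + δ + 1) N ≠ 0) (h₂ : poch (-β + γ + 1) N ≠ 0)
    (h₃ : poch ((γ + δ + 1) / 2) N ≠ 0) (h₄ : poch (δ + 1) N ≠ 0)
    (h₅ : poch (β + δ + 1) N ≠ 0) (h₆ : poch (γ + 1) N ≠ 0) (h₇ : poch (γ + δ + 2) N ≠ 0)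
    {n : ℕ} (hn : n ≤ N) :
    ∑ x ∈ Finset.range (N + 1), (racah n α β γ δ).eval (lam γ δ x) *
      (racah n α β γ δ).eval (lam γ δ x) * racahWeight α β γ δ x ≠ 0 := by
  have hp := poch_top_ne_zero hαβ n
  have hL := racahSum_one_ne_zero hα hαβ h₁ h₂ h₃ h₄ h₅ h₆ h₇
  rw [sum_racah_mul_racah]
  refine mul_ne_zero (mul_ne_zero (inv_ne_zero hp) (inv_ne_zero hp)) ?_
  rcases N.eq_zero_or_pos with rfl | hN
  · obtain rfl : n = 0 := by omega
    simpa [wilsonRacah, poch_zero, phi_zero] using hL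
  have hα' : α = -N - 1 := by linear_combination hα
  rw [poch_ne_zero_iff] at h₂ h₄ h₅ h₆
  refine (racahSum_isPearson hN hα h₁ (by rwa [poch_ne_zero_iff]) h₃
    (by rwa [poch_ne_zero_iff])).wilsonRacah_sq_ne_zero
    (fun j => by convert! hαβ j using 1; ring) hL ?_ ?_ ?_ ?_ ?_ ?_ <;> rw [poch_ne_zero_iff] <;>
    intro j hj h
  · rw [add_sub_cancel, hα, neg_add_eq_zero] at h
    exact absurd (Nat.cast_injective h) (by omega)
  · exact h₅ j (by omega) (by linear_combination h)
  · exact h₆ j (by omega) (by linear_combination h)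
  -- Here b + c = β-γ-N, so the factors of (b+c)_n are, up to sign, factors of (-β+γ+1)_N in reverse
  -- order. The next case does the same with b + d = -N-δ.
  · refine h₂ (N - 1 - j) (by omega) ?_
    rw [Nat.sub_sub, Nat.cast_sub (by omega)]
    rw [hα'] at h
    push_cast
    linear_combination -h
  · refine h₄ (N - 1 - j) (by omega) ?_
    rw [Nat.sub_sub, Nat.cast_sub (by omega)]
    rw [hα'] at h
    push_cast
    linear_combination -h
  · refine hαβ (N + j) ?_
    rw [hα']
    push_cast
    linear_combination h

/-! ### Iterated divided differences -/

theorem divDiff_const_mul (γ δ c : ℂ) (k : ℕ) (f : ℂ → ℂ) :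
    divDiff γ δ k (fun x => c * f x) = fun x => c * divDiff γ δ k f x := by
  induction k with
  | zero => rfl
  | succ k ih => funext x; simp only [divDiff, ih]; ring

/-- None of the denominators of the iterated divided differences vanishes at `x`, `x + 1`, …. -/
def IsRegularPoint (γ δ x : ℂ) : Prop := ∀ i : ℕ, 2 * x + γ + δ + 2 + i ≠ 0

theorem IsRegularPoint.add_one {γ δ x : ℂ} (h : IsRegularPoint γ δ x) :
    IsRegularPoint γ δ (x + 1) := fun i => by
  have := h (i + 2)
  push_cast at this
  convert! this using 1
  ring

/-- Shifting the origin by a further 1/2 at each step keeps the k-th divided difference symmetric: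
with s = x + (γ+δ+1+k)/2 the denominator is 2s + 1 = (s+1)² - s². -/
theorem divDiff_step {γ δ : ℂ} {f g h : ℂ → ℂ} {k : ℕ}
    (hf : ∀ x, IsRegularPoint γ δ x → divDiff γ δ k f x = g (x + (γ + δ + 1 + k) / 2))
    (hg : ∀ s, g (s + 1) - g s = (2 * s + 1) * h (s + 1 / 2)) {x : ℂ}
    (hx : IsRegularPoint γ δ x) :
    divDiff γ δ (k + 1) f x = h (x + (γ + δ + 1 + (k + 1 : ℕ)) / 2) := by
  have h₁ := hg (x + (γ + δ + 1 + k) / 2)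
  have h₂ : lam γ δ (x + 1 + k / 2) - lam γ δ (x + k / 2) =
      2 * (x + (γ + δ + 1 + k) / 2) + 1 := by unfold lam; ring
  have h₃ : 2 * (x + (γ + δ + 1 + k) / 2) + 1 ≠ 0 := by
    convert! hx k using 1; ring
  rw [divDiff]
  beta_reduce
  rw [hf _ hx, hf _ hx.add_one, h₂, div_eq_iff h₃,
    show x + 1 + (γ + δ + 1 + k) / 2 = x + (γ + δ + 1 + k) / 2 + 1 by ring, h₁, mul_comm]
  congr 2
  push_cast
  ring

/-- The numbers (s+1)² and s² have sum 2Y + 1/2 and product (Y - 1/4)², where Y = (s+1/2)², so their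
powers obey a two-term recursion with coefficients polynomial in Y. -/
theorem exists_divDiff_pow (n : ℕ) : ∃ q : ℂ[X], ∀ s : ℂ,
    ((s + 1) ^ 2) ^ n - (s ^ 2) ^ n = (2 * s + 1) * q.eval ((s + 1 / 2) ^ 2) := by
  induction n using Nat.strong_induction_on with
  | _ n ih =>
    match n with
    | 0 => exact ⟨0, fun s => by simp⟩
    | 1 => exact ⟨1, fun s => by simp; ring⟩
    | n + 2 =>
      obtain ⟨q₁, h₁⟩ := ih (n + 1) (by omega)
      obtain ⟨q₀, h₀⟩ := ih n (by omega)
      refine ⟨(2 * X + C (1 / 2)) * q₁ - (X - C (1 / 4)) ^ 2 * q₀, fun s => ?_⟩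
      simp only [eval_sub, eval_mul, eval_add, eval_pow, eval_X, eval_C, eval_ofNat]
      linear_combination (2 * (s + 1 / 2) ^ 2 + 1 / 2) * h₁ s - ((s + 1 / 2) ^ 2 - 1 / 4) ^ 2 * h₀ s

theorem exists_divDiff_eval_sq (p : ℂ[X]) : ∃ q : ℂ[X], ∀ s : ℂ,
    p.eval ((s + 1) ^ 2) - p.eval (s ^ 2) = (2 * s + 1) * q.eval ((s + 1 / 2) ^ 2) := by
  induction p using Polynomial.induction_on' with
  | add p q hp hq =>
    obtain ⟨p', hp⟩ := hp
    obtain ⟨q', hq⟩ := hq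
    refine ⟨p' + q', fun s => ?_⟩
    simp only [eval_add]
    linear_combination hp s + hq s
  | monomial n a =>
    obtain ⟨q, hq⟩ := exists_divDiff_pow n
    refine ⟨C a * q, fun s => ?_⟩
    simp only [eval_monomial, eval_mul, eval_C]
    linear_combination a * hq s

theorem exists_divDiff_eval_lam (γ δ : ℂ) (k : ℕ) (p : ℂ[X]) : ∃ q : ℂ[X], ∀ x,
    IsRegularPoint γ δ x → divDiff γ δ k (fun x => p.eval (lam γ δ x)) x =
      q.eval ((x + (γ + δ + 1 + k) / 2) ^ 2) := by
  induction k with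
  | zero =>
    refine ⟨p.comp (X - C (((γ + δ + 1) / 2) ^ 2)), fun x _ => ?_⟩
    simp only [divDiff, eval_comp, eval_sub, eval_X, eval_C, lam]
    congr 1
    push_cast
    ring
  | succ k ih =>
    obtain ⟨q, hq⟩ := ih
    obtain ⟨q', hq'⟩ := exists_divDiff_eval_sq q
    exact ⟨q', fun x hx => divDiff_step (g := fun s => q.eval (s ^ 2))
      (h := fun s => q'.eval (s ^ 2)) hq hq' hx⟩

theorem phi_divDiff (a s : ℂ) (k : ℕ) :
    (phi a k).eval ((s + 1) ^ 2) - (phi a k).eval (s ^ 2) =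
      (2 * s + 1) * (-k * (phi (a + 1 / 2) (k - 1)).eval ((s + 1 / 2) ^ 2)) := by
  cases k with
  | zero => simp [phi_zero]
  | succ k =>
    simp only [phi_eval_sq, Nat.add_sub_cancel]
    rw [poch_succ_left (a - (s + 1)), poch_succ (a + (s + 1)), poch_succ (a - s),
      poch_succ_left (a + s), show a - (s + 1) + 1 = a - s by ring,
      show a + s + 1 = a + (s + 1) by ring,
      show a + 1 / 2 - (s + 1 / 2) = a - s by ring,
      show a + 1 / 2 + (s + 1 / 2) = a + (s + 1) by ring]
    push_cast
    ring

theorem divDiff_sum_phi (γ δ a : ℂ) (c : ℕ → ℂ) (n j : ℕ) (x : ℂ) (hx : IsRegularPoint γ δ x) :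
    divDiff γ δ j (fun x => ∑ k ∈ Finset.range n, c k *
      (phi a k).eval ((x + (γ + δ + 1) / 2) ^ 2)) x =
    ∑ k ∈ Finset.range n, c k * ((-1) ^ j * (k.descFactorial j : ℂ) *
      (phi (a + j / 2) (k - j)).eval ((x + (γ + δ + 1 + j) / 2) ^ 2)) := by
  induction j generalizing x with
  | zero => simp [divDiff]
  | succ j ih =>
    refine divDiff_step (g := fun s => ∑ k ∈ Finset.range n, c k * ((-1) ^ j *
      (k.descFactorial j : ℂ) * (phi (a + j / 2) (k - j)).eval (s ^ 2)))
      (h := fun s => ∑ k ∈ Finset.range n, c k * ((-1) ^ (j + 1) *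
      (k.descFactorial (j + 1) : ℂ) * (phi (a + (j + 1 : ℕ) / 2) (k - (j + 1))).eval (s ^ 2)))
      ih (fun s => ?_) hx
    rw [← Finset.sum_sub_distrib, Finset.mul_sum]
    refine Finset.sum_congr rfl fun k _ => ?_
    have h := phi_divDiff (a + j / 2) s (k - j)
    rw [Nat.descFactorial_succ, ← Nat.sub_sub, show a + ((j + 1 : ℕ) : ℂ) / 2 = a + j / 2 + 1 / 2 by
      push_cast; ring]
    push_cast
    linear_combination c k * (-1) ^ j * (k.descFactorial j : ℂ) * h

theorem divDiff_wilsonRacah_of_lt (γ δ a b c d : ℂ) {n j : ℕ} (hj : n < j) {x : ℂ}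
    (hx : IsRegularPoint γ δ x) :
    divDiff γ δ j (fun x => (wilsonRacah n a b c d).eval ((x + (γ + δ + 1) / 2) ^ 2)) x = 0 := by
  simp only [wilsonRacah_eq_sum_range, eval_finsetSum, eval_mul, eval_C]
  refine (divDiff_sum_phi γ δ a _ (n + 1) j x hx).trans (Finset.sum_eq_zero fun k hk => ?_)
  rw [Nat.descFactorial_of_lt ((Nat.lt_succ_iff.1 (Finset.mem_range.1 hk)).trans_lt hj)]
  simp

/-- Each difference lowers `phi a k` to a multiple of `phi (a + 1/2) (k - 1)`. Hence the terms k < j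
disappear and the rest reassemble with every parameter raised by j/2. -/
theorem divDiff_wilsonRacah (γ δ a b c d : ℂ) (m j : ℕ) {x : ℂ} (hx : IsRegularPoint γ δ x) :
    divDiff γ δ j (fun x => (wilsonRacah (j + m) a b c d).eval ((x + (γ + δ + 1) / 2) ^ 2)) x =
      (-1) ^ j * poch (-(j + m : ℕ)) j * poch ((j + m : ℕ) + a + b + c + d - 1) j *
        (wilsonRacah m (a + j / 2) (b + j / 2) (c + j / 2) (d + j / 2)).eval
          ((x + (γ + δ + 1 + j) / 2) ^ 2) := by
  simp only [wilsonRacah_eq_sum_range, eval_finsetSum, eval_mul, eval_C]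
  refine (divDiff_sum_phi γ δ a _ (j + m + 1) j x hx).trans ?_
  rw [add_assoc j m 1, Finset.sum_range_add, Finset.sum_eq_zero, zero_add, Finset.mul_sum]
  · refine Finset.sum_congr rfl fun k hk => ?_
    obtain ⟨l, rfl⟩ := Nat.exists_eq_add_of_le (Nat.lt_succ_iff.1 (Finset.mem_range.1 hk))
    rw [show j + (k + l) - (j + k) = l by omega, Nat.add_sub_cancel_left, Nat.add_sub_cancel_left,
      poch_add _ j k, poch_add _ j k]
    have h₁ : ((j + k).descFactorial j : ℂ) * k.factorial = (j + k).factorial := by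
      have := Nat.factorial_mul_descFactorial (Nat.le_add_right j k)
      rw [Nat.add_sub_cancel_left] at this
      rw [← this]; push_cast; ring
    rw [← eq_div_iff (fact_ne _)] at h₁
    have e₁ : ∀ u v : ℂ, u + v + ((j + k : ℕ) : ℂ) = u + j / 2 + (v + j / 2) + k := by
      intro u v; push_cast; ring
    have e₂ : ((k + l : ℕ) : ℂ) + (a + j / 2) + (b + j / 2) + (c + j / 2) + (d + j / 2) - 1 =
        ((j + (k + l) : ℕ) : ℂ) + a + b + c + d - 1 + j := by push_cast; ring
    have e₃ : -((j + (k + l) : ℕ) : ℂ) + j = -((k + l : ℕ) : ℂ) := by push_cast; ring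
    rw [e₁, e₁, e₁, e₂, e₃, h₁, phi]
    simp only [eval_prod, eval_sub, eval_C, eval_X]
    have := fact_ne (j + k)
    have := fact_ne k
    field_simp
  · intro k hk
    rw [Nat.descFactorial_of_lt (Finset.mem_range.1 hk)]
    simp

theorem divDiff_racah_of_lt (α β γ δ : ℂ) {n j : ℕ} (hj : n < j) {x : ℂ}
    (hx : IsRegularPoint γ δ x) :
    divDiff γ δ j (fun x => (racah n α β γ δ).eval (lam γ δ x)) x = 0 := by
  simp only [racah_eval_lam]
  rw [divDiff_const_mul]
  simp only
  rw [divDiff_wilsonRacah_of_lt _ _ _ _ _ _ hj hx, mul_zero]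

theorem exists_divDiff_racah {N : ℕ} {α β : ℂ} (γ δ : ℂ) (hα : α + 1 = -(N : ℂ))
    (hαβ : ∀ m : ℕ, α + β + 2 + m ≠ 0) (m : ℕ) : ∃ C : ℂ, C ≠ 0 ∧ ∀ x, IsRegularPoint γ δ x →
      divDiff γ δ (N + 1) (fun x => (racah (N + 1 + m) α β γ δ).eval (lam γ δ x)) x =
      C * (wilsonRacah m (wpar N β γ δ 0) (wpar N β γ δ 1) (wpar N β γ δ 2)
        (wpar N β γ δ 3)).eval ((x + (1 + (γ + δ + N) / 2)) ^ 2) := by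
  set e : ℂ := (γ + δ + 1) / 2 with he
  refine ⟨(poch ((N + 1 + m : ℕ) + α + β + 1) (N + 1 + m))⁻¹ * ((-1) ^ (N + 1) *
    poch (-(N + 1 + m : ℕ)) (N + 1) * poch ((N + 1 + m : ℕ) + e + (α + 1 - e) + (β + δ + 1 - e) +
      (γ + 1 - e) - 1) (N + 1)), ?_, fun x hx => ?_⟩
  · refine mul_ne_zero (inv_ne_zero (poch_top_ne_zero hαβ _)) (mul_ne_zero (mul_ne_zero
      (by simp) ?_) ?_)
    · have := poch_neg_add (N + 1) m
      intro h
      rw [h, zero_mul] at this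
      exact mul_ne_zero (by simp) (fact_ne _) this.symm
    · refine poch_ne_zero (fun j h => hαβ (N + m + j) ?_) _
      rw [he] at h
      push_cast at h ⊢
      linear_combination h
  · simp only [racah_eval_lam, ← he]
    rw [divDiff_const_mul]
    simp only
    rw [he, divDiff_wilsonRacah _ _ _ _ _ _ _ _ hx, ← he, ← mul_assoc]
    congr 2
    · push_cast; ring
    · have hα' : α = -N - 1 := by linear_combination hα
      have w₀ : wpar N β γ δ 0 = e + (N + 1 : ℕ) / 2 := by
        rw [wpar, he, Matrix.cons_val_zero]; push_cast; ring
      have w₁ : wpar N β γ δ 1 = α + 1 - e + (N + 1 : ℕ) / 2 := by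
        rw [wpar, he, hα', Matrix.cons_val_one]; push_cast; ring
      have w₂ : wpar N β γ δ 2 = β + δ + 1 - e + (N + 1 : ℕ) / 2 := by
        simp only [wpar, he, Matrix.cons_val]; push_cast; ring
      have w₃ : wpar N β γ δ 3 = γ + 1 - e + (N + 1 : ℕ) / 2 := by
        simp only [wpar, he, Matrix.cons_val]; push_cast; ring
      rw [w₀, w₁, w₂, w₃]

open MeasureTheory Filter Topology

/-! ### Comparison of contours -/

/-- `A` behaves like the integral along a closed chain of paths whose image is `S`. -/
structure IsClosedChainIntegral (S : Set ℂ) (A : (ℂ → ℂ) → ℂ) : Prop where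
  add : ∀ f g, ContinuousOn f S → ContinuousOn g S → A (fun z => f z + g z) = A f + A g
  mul : ∀ c f, A (fun z => c * f z) = c * A f
  congr : ∀ f g, Set.EqOn f g S → A f = A g
  prim : ∀ P f, (∀ z ∈ S, HasDerivAt P (f z) z) → ContinuousOn f S → A f = 0

namespace IsClosedChainIntegral

variable {S : Set ℂ} {A : (ℂ → ℂ) → ℂ}

theorem continuousOn_inv_prod (m : Multiset ℂ) (hm : ∀ p ∈ m, p ∉ S) :
    ContinuousOn (fun z => ((m.map fun p => z - p).prod)⁻¹) S := by
  refine ContinuousOn.inv₀ ?_ ?_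
  · exact (continuous_multiset_prod m fun p _ => by fun_prop).continuousOn
  · intro z hz h
    obtain ⟨p, hp, h⟩ := Multiset.mem_map.1 (Multiset.prod_eq_zero_iff.1 h)
    exact hm p hp (sub_eq_zero.1 h ▸ hz)

/-- Partial fractions: two distinct poles are separated, lowering the number of factors; a power of
a single pole has a primitive unless it is simple, and that case is the hypothesis. -/
theorem inv_prod_eq_zero (hA : IsClosedChainIntegral S A) (m : Multiset ℂ)
    (hm : ∀ p ∈ m, p ∉ S ∧ A (fun z => (z - p)⁻¹) = 0) :
    A (fun z => ((m.map fun p => z - p).prod)⁻¹) = 0 := by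
  induction m using Multiset.strongInductionOn with
  | _ m ih =>
  rcases m.empty_or_exists_mem with rfl | ⟨p, hp⟩
  · refine hA.prim id _ (fun z _ => by simpa using hasDerivAt_id z) ?_
    simpa using continuousOn_const
  obtain ⟨m, rfl⟩ := Multiset.exists_cons_of_mem hp
  by_cases hall : ∀ q ∈ m, q = p
  · obtain hmr := Multiset.eq_replicate_card.2 hall
    generalize m.card = k at hmr
    subst hmr
    have hpS := (hm p (Multiset.mem_cons_self _ _)).1
    cases k with
    | zero => simpa using (hm p (Multiset.mem_cons_self _ _)).2
    | succ k =>
      refine hA.prim (fun z => -((k + 1 : ℂ))⁻¹ * ((z - p) ^ (k + 1))⁻¹) _ (fun z hz => ?_)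
        (continuousOn_inv_prod _ fun q hq => (hm q hq).1)
      have hz' : z - p ≠ 0 := fun h => hpS (sub_eq_zero.1 h ▸ hz)
      have h := ((((hasDerivAt_id z).sub_const p).pow (k + 1)).inv (pow_ne_zero _ hz')).const_mul
        (-((k + 1 : ℂ))⁻¹)
      have hk : (k + 1 : ℂ) ≠ 0 := by exact_mod_cast k.succ_ne_zero
      convert! h using 1
      simp only [Multiset.map_cons, Multiset.map_replicate, Multiset.prod_cons,
        Multiset.prod_replicate, id, Nat.add_sub_cancel]
      push_cast
      field_simp
      simp only [Pi.pow_apply]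
      ring
  · push Not at hall
    obtain ⟨q, hq, hqp⟩ := hall
    obtain ⟨m, rfl⟩ := Multiset.exists_cons_of_mem hq
    have h₁ := ih (p ::ₘ m) (by rw [Multiset.cons_swap]; exact Multiset.lt_cons_self _ _)
      (fun r hr => hm r (by rw [Multiset.cons_swap]; exact Multiset.mem_cons_of_mem hr))
    have h₂ := ih (q ::ₘ m) (Multiset.lt_cons_self _ _)
      (fun r hr => hm r (Multiset.mem_cons_of_mem hr))
    have c₁ := continuousOn_inv_prod (S := S) (p ::ₘ m) fun r hr =>
      (hm r (by rw [Multiset.cons_swap]; exact Multiset.mem_cons_of_mem hr)).1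
    have c₂ := continuousOn_inv_prod (S := S) (q ::ₘ m) fun r hr =>
      (hm r (Multiset.mem_cons_of_mem hr)).1
    have hpS := (hm p (Multiset.mem_cons_self _ _)).1
    have hqS := (hm q (by simp)).1
    rw [hA.congr _ (fun z => (p - q)⁻¹ * (((p ::ₘ m).map fun r => z - r).prod)⁻¹ +
      (-(p - q)⁻¹) * (((q ::ₘ m).map fun r => z - r).prod)⁻¹), hA.add, hA.mul, hA.mul, h₁, h₂]
    · simp
    · exact continuousOn_const.mul c₁
    · exact continuousOn_const.mul c₂
    · intro z hz
      have hz₁ : z - p ≠ 0 := fun h => hpS (sub_eq_zero.1 h ▸ hz)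
      have hz₂ : z - q ≠ 0 := fun h => hqS (sub_eq_zero.1 h ▸ hz)
      have hz₃ : p - q ≠ 0 := sub_ne_zero.2 hqp.symm
      simp only [Multiset.map_cons, Multiset.prod_cons, mul_inv]
      generalize (Multiset.map (fun r => z - r) m).prod⁻¹ = Q
      field_simp
      ring

/-- The poles are removed one at a time by F(z) = F(p) + (z-p)·`dslope F p z`; a pole outside the
ball is absorbed into the holomorphic factor. What remains is holomorphic on a disc and has a
primitive there. -/
theorem meromorphic_eq_zero (hA : IsClosedChainIntegral S A) {R : ℝ} (hS : S ⊆ Metric.ball 0 R)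
    (m : Multiset ℂ) (hm : ∀ p ∈ m, p ∉ S ∧ A (fun z => (z - p)⁻¹) = 0) (F : ℂ → ℂ)
    (hF : DifferentiableOn ℂ F (Metric.ball 0 R)) :
    A (fun z => F z * ((m.map fun p => z - p).prod)⁻¹) = 0 := by
  induction m using Multiset.induction generalizing F with
  | empty =>
    obtain ⟨P, hP⟩ := hF.isExactOn_ball
    simp only [Multiset.map_zero, Multiset.prod_zero, inv_one, mul_one]
    exact hA.prim P F (fun z hz => hP z (hS hz)) (hF.continuousOn.mono hS)
  | cons p m ih =>
    have hm' : ∀ q ∈ m, q ∉ S ∧ A (fun z => (z - q)⁻¹) = 0 :=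
      fun q hq => hm q (Multiset.mem_cons_of_mem hq)
    have hpS := (hm p (Multiset.mem_cons_self _ _)).1
    by_cases hp : p ∈ Metric.ball (0 : ℂ) R
    · have hd : DifferentiableOn ℂ (dslope F p) (Metric.ball 0 R) :=
        (Complex.differentiableOn_dslope (Metric.isOpen_ball.mem_nhds hp)).2 hF
      rw [hA.congr _ (fun z => F p * (((p ::ₘ m).map fun q => z - q).prod)⁻¹ +
        dslope F p z * ((m.map fun q => z - q).prod)⁻¹), hA.add, hA.mul, hA.inv_prod_eq_zero _ hm,
        ih hm' _ hd]
      · simp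
      · exact continuousOn_const.mul (continuousOn_inv_prod _ fun q hq => (hm q hq).1)
      · exact (hd.continuousOn.mono hS).mul (continuousOn_inv_prod _ fun q hq => (hm' q hq).1)
      · intro z hz
        have hz₁ : z - p ≠ 0 := fun h => hpS (sub_eq_zero.1 h ▸ hz)
        have h := sub_smul_dslope F p z
        rw [smul_eq_mul] at h
        simp only [Multiset.map_cons, Multiset.prod_cons, mul_inv]
        generalize (Multiset.map (fun r => z - r) m).prod⁻¹ = Q
        rw [show F z = F p + (z - p) * dslope F p z by rw [h]; ring]
        field_simp
    · have hd : DifferentiableOn ℂ (fun z => F z * (z - p)⁻¹) (Metric.ball 0 R) := by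
        refine hF.mul (DifferentiableOn.inv (by fun_prop) fun z hz h => hp ?_)
        exact sub_eq_zero.1 h ▸ hz
      rw [← ih hm' _ hd]
      congr 1
      funext z
      simp only [Multiset.map_cons, Multiset.prod_cons, mul_inv]
      ring

end IsClosedChainIntegral


/-- The integral along `K₁` upwards between the heights `±T`, then along the upper edge, back along
`K₂` and along the lower edge. -/
noncomputable def contourDiff (K₁ K₂ : ℝ → ℂ) (c₁ c₂ T : ℝ) (f : ℂ → ℂ) : ℂ :=
  (∫ t in (-T)..T, f (K₁ t) * deriv K₁ t) - (∫ t in (-T)..T, f (K₂ t) * deriv K₂ t) +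
    (∫ u in c₁..c₂, f (u + T * Complex.I)) - ∫ u in c₁..c₂, f (u + (-T : ℝ) * Complex.I)

/-- The image of the chain underlying `contourDiff`. -/
def contourDiffSupport (K₁ K₂ : ℝ → ℂ) (c₁ c₂ T : ℝ) : Set ℂ :=
  K₁ '' Set.uIcc (-T) T ∪ K₂ '' Set.uIcc (-T) T ∪
    ((fun u : ℝ => (u + T * Complex.I : ℂ)) '' Set.uIcc c₁ c₂ ∪
      (fun u : ℝ => (u + (-T : ℝ) * Complex.I : ℂ)) '' Set.uIcc c₁ c₂)

theorem integral_deriv_path {P f : ℂ → ℂ} {K : ℝ → ℂ} (hK : ContDiff ℝ 1 K) {a b : ℝ}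
    (hP : ∀ z ∈ K '' Set.uIcc a b, HasDerivAt P (f z) z)
    (hf : ContinuousOn f (K '' Set.uIcc a b)) :
    ∫ t in a..b, f (K t) * deriv K t = P (K b) - P (K a) := by
  refine intervalIntegral.integral_eq_sub_of_hasDerivAt (f := fun t => P (K t)) (fun t ht => ?_) ?_
  · have h := (hP (K t) (Set.mem_image_of_mem K ht)).scomp t
      ((hK.differentiable one_ne_zero).differentiableAt.hasDerivAt (x := t))
    rw [smul_eq_mul, mul_comm] at h
    exact h
  · refine ContinuousOn.intervalIntegrable ?_
    exact (hf.comp hK.continuous.continuousOn (Set.mapsTo_image K _)).mul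
      (hK.continuous_deriv le_rfl).continuousOn

theorem deriv_horizontal (w : ℂ) (t : ℝ) : deriv (fun u : ℝ => (u + w : ℂ)) t = 1 := by
  have : HasDerivAt (fun u : ℝ => (u + w : ℂ)) 1 t := by
    simpa using (Complex.ofRealCLM.hasDerivAt (x := t)).add_const w
  exact this.deriv

theorem contDiff_horizontal (w : ℂ) : ContDiff ℝ 1 (fun u : ℝ => (u + w : ℂ)) :=
  Complex.ofRealCLM.contDiff.add contDiff_const

theorem contourDiff_isClosedChainIntegral {K₁ K₂ : ℝ → ℂ} (h₁ : ContDiff ℝ 1 K₁)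
    (h₂ : ContDiff ℝ 1 K₂) {c₁ c₂ T : ℝ} (e₁ : K₁ T = c₁ + T * Complex.I)
    (e₂ : K₂ T = c₂ + T * Complex.I) (e₁' : K₁ (-T) = c₁ + (-T : ℝ) * Complex.I)
    (e₂' : K₂ (-T) = c₂ + (-T : ℝ) * Complex.I) :
    IsClosedChainIntegral (contourDiffSupport K₁ K₂ c₁ c₂ T) (contourDiff K₁ K₂ c₁ c₂ T) := by
  have s₁ : K₁ '' Set.uIcc (-T) T ⊆ contourDiffSupport K₁ K₂ c₁ c₂ T := fun z hz => Or.inl (Or.inl hz)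
  have s₂ : K₂ '' Set.uIcc (-T) T ⊆ contourDiffSupport K₁ K₂ c₁ c₂ T := fun z hz => Or.inl (Or.inr hz)
  have s₃ : (fun u : ℝ => (u + T * Complex.I : ℂ)) '' Set.uIcc c₁ c₂ ⊆
      contourDiffSupport K₁ K₂ c₁ c₂ T := fun z hz => Or.inr (Or.inl hz)
  have s₄ : (fun u : ℝ => (u + (-T : ℝ) * Complex.I : ℂ)) '' Set.uIcc c₁ c₂ ⊆
      contourDiffSupport K₁ K₂ c₁ c₂ T := fun z hz => Or.inr (Or.inr hz)
  have ii : ∀ {K : ℝ → ℂ} (_ : ContDiff ℝ 1 K) {f : ℂ → ℂ} {a b : ℝ}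
      (_ : ContinuousOn f (K '' Set.uIcc a b)),
      IntervalIntegrable (fun t => f (K t) * deriv K t) volume a b := fun hK f a b hf =>
    ((hf.comp hK.continuous.continuousOn (Set.mapsTo_image _ _)).mul
      (hK.continuous_deriv le_rfl).continuousOn).intervalIntegrable
  have jj : ∀ (w : ℂ) {f : ℂ → ℂ} {a b : ℝ}
      (_ : ContinuousOn f ((fun u : ℝ => (u + w : ℂ)) '' Set.uIcc a b)),
      IntervalIntegrable (fun t : ℝ => f (t + w)) volume a b := fun w f a b hf =>
    (hf.comp (contDiff_horizontal w).continuous.continuousOn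
      (Set.mapsTo_image _ _)).intervalIntegrable
  constructor
  · intro f g hf hg
    simp only [contourDiff, add_mul]
    rw [intervalIntegral.integral_add (ii h₁ (hf.mono s₁)) (ii h₁ (hg.mono s₁)),
      intervalIntegral.integral_add (ii h₂ (hf.mono s₂)) (ii h₂ (hg.mono s₂)),
      intervalIntegral.integral_add (jj _ (hf.mono s₃)) (jj _ (hg.mono s₃)),
      intervalIntegral.integral_add (jj _ (hf.mono s₄)) (jj _ (hg.mono s₄))]
    ring
  · intro c f
    simp only [contourDiff, mul_assoc, intervalIntegral.integral_const_mul]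
    ring
  · intro f g hfg
    simp only [contourDiff]
    rw [intervalIntegral.integral_congr (g := fun t => g (K₁ t) * deriv K₁ t)
        fun t ht => congrArg (· * deriv K₁ t) (hfg (s₁ (Set.mem_image_of_mem _ ht))),
      intervalIntegral.integral_congr (f := fun t => f (K₂ t) * deriv K₂ t)
        (g := fun t => g (K₂ t) * deriv K₂ t)
        fun t ht => congrArg (· * deriv K₂ t) (hfg (s₂ (Set.mem_image_of_mem _ ht))),
      intervalIntegral.integral_congr (g := fun u : ℝ => g (u + T * Complex.I))
        fun t ht => hfg (s₃ (Set.mem_image_of_mem _ ht)),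
      intervalIntegral.integral_congr (g := fun u : ℝ => g (u + (-T : ℝ) * Complex.I))
        fun t ht => hfg (s₄ (Set.mem_image_of_mem _ ht))]
  · intro P f hP hf
    have k₁ := integral_deriv_path h₁ (fun z hz => hP z (s₁ hz)) (hf.mono s₁)
    have k₂ := integral_deriv_path h₂ (fun z hz => hP z (s₂ hz)) (hf.mono s₂)
    have k₃ := integral_deriv_path (contDiff_horizontal _) (fun z hz => hP z (s₃ hz)) (hf.mono s₃)
    have k₄ := integral_deriv_path (contDiff_horizontal _) (fun z hz => hP z (s₄ hz)) (hf.mono s₄)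
    simp only [deriv_horizontal, mul_one] at k₃ k₄
    rw [contourDiff, k₁, k₂, k₃, k₄, e₁, e₂, e₁', e₂']
    ring

theorem vertical_of_abs_ge {K : ℝ → ℂ} {c T₀ : ℝ}
    (hK : ∀ t : ℝ, T₀ ≤ |t| → K t = c + t * Complex.I) {t : ℝ} (ht : T₀ < |t|) :
    deriv K t = Complex.I := by
  have h : K =ᶠ[𝓝 t] fun t => c + t * Complex.I := by
    filter_upwards [(continuous_abs.tendsto t).eventually (lt_mem_nhds ht)] with s hs
    exact hK s (le_of_lt hs)
  rw [h.deriv_eq]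
  have : HasDerivAt (fun t : ℝ => (c + t * Complex.I : ℂ)) Complex.I t := by
    simpa using ((Complex.ofRealCLM.hasDerivAt (x := t)).mul_const Complex.I).const_add (c : ℂ)
  exact this.deriv

/-- Enlarging the height adds the boundaries of two rectangles in the region |Im z| > T₀, where `f`
is holomorphic. -/
theorem contourDiff_eq_of_le {K₁ K₂ : ℝ → ℂ} (h₁ : ContDiff ℝ 1 K₁)
    (h₂ : ContDiff ℝ 1 K₂) {c₁ c₂ T₀ : ℝ}
    (e₁ : ∀ t : ℝ, T₀ ≤ |t| → K₁ t = c₁ + t * Complex.I)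
    (e₂ : ∀ t : ℝ, T₀ ≤ |t| → K₂ t = c₂ + t * Complex.I) {f : ℂ → ℂ}
    (hf₁ : ContinuousOn f (Set.range K₁)) (hf₂ : ContinuousOn f (Set.range K₂))
    (hf : DifferentiableOn ℂ f {z | T₀ < |z.im|}) {T T' : ℝ} (hT : T₀ < T) (hTT' : T ≤ T') :
    contourDiff K₁ K₂ c₁ c₂ T' f = contourDiff K₁ K₂ c₁ c₂ T f := by
  have tail : ∀ {K : ℝ → ℂ} {c : ℝ} (_ : ContDiff ℝ 1 K)
      (_ : ∀ t : ℝ, T₀ ≤ |t| → K t = c + t * Complex.I) (_ : ContinuousOn f (Set.range K)),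
      ∫ t in (-T')..T', f (K t) * deriv K t = (∫ t in (-T)..T, f (K t) * deriv K t) +
        Complex.I * (∫ t in T..T', f (c + t * Complex.I)) +
        Complex.I * (∫ t in (-T')..(-T), f (c + t * Complex.I)) := by
    intro K c hK eK hfK
    have hi : ∀ a b, IntervalIntegrable (fun t => f (K t) * deriv K t) volume a b := fun a b =>
      ((hfK.comp_continuous hK.continuous fun t => Set.mem_range_self t).mul
        (hK.continuous_deriv le_rfl)).intervalIntegrable a b
    rw [← intervalIntegral.integral_add_adjacent_intervals (hi (-T') (-T)) (hi (-T) T'),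
      ← intervalIntegral.integral_add_adjacent_intervals (hi (-T) T) (hi T T')]
    have k₁ : ∫ t in T..T', f (K t) * deriv K t =
        Complex.I * ∫ t in T..T', f (c + t * Complex.I) := by
      rw [← intervalIntegral.integral_const_mul]
      refine intervalIntegral.integral_congr fun t ht => ?_
      rw [Set.uIcc_of_le hTT'] at ht
      have : T₀ < |t| := (hT.trans_le ht.1).trans_le (le_abs_self t)
      simp only [vertical_of_abs_ge eK this, eK t this.le, mul_comm]
    have k₂ : ∫ t in (-T')..(-T), f (K t) * deriv K t =
        Complex.I * ∫ t in (-T')..(-T), f (c + t * Complex.I) := by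
      rw [← intervalIntegral.integral_const_mul]
      refine intervalIntegral.integral_congr fun t ht => ?_
      rw [Set.uIcc_of_le (neg_le_neg hTT')] at ht
      have : T₀ < |t| := (hT.trans_le (le_neg.1 ht.2)).trans_le (neg_le_abs t)
      simp only [vertical_of_abs_ge eK this, eK t this.le, mul_comm]
    rw [k₁, k₂]
    ring
  have r₁ := Complex.integral_boundary_rect_eq_zero_of_differentiableOn f (c₁ + T * Complex.I)
    (c₂ + T' * Complex.I) (hf.mono fun z hz => by
      have := (Complex.mem_reProdIm.1 hz).2
      simp only [Complex.add_im, Complex.ofReal_im, Complex.mul_im, Complex.ofReal_re,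
        Complex.I_im, Complex.I_re, mul_one, mul_zero, add_zero, zero_add] at this
      rw [Set.uIcc_of_le hTT'] at this
      exact (hT.trans_le this.1).trans_le (le_abs_self _))
  have r₂ := Complex.integral_boundary_rect_eq_zero_of_differentiableOn f
    (c₁ + (-T' : ℝ) * Complex.I) (c₂ + (-T : ℝ) * Complex.I) (hf.mono fun z hz => by
      have := (Complex.mem_reProdIm.1 hz).2
      simp only [Complex.add_im, Complex.ofReal_im, Complex.mul_im, Complex.ofReal_re,
        Complex.I_im, Complex.I_re, mul_one, mul_zero, add_zero, zero_add] at this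
      rw [Set.uIcc_of_le (neg_le_neg hTT')] at this
      exact (hT.trans_le (le_neg.1 this.2)).trans_le (neg_le_abs _))
  simp only [Complex.add_im, Complex.ofReal_im, Complex.mul_im, Complex.ofReal_re,
    Complex.I_im, Complex.I_re, mul_one, mul_zero, add_zero, zero_add, Complex.add_re,
    Complex.mul_re, smul_eq_mul, sub_self] at r₁ r₂
  simp only [contourDiff]
  rw [tail h₁ e₁ hf₁, tail h₂ e₂ hf₂]
  linear_combination -r₁ - r₂

theorem tendsto_horizontal_integral {f : ℂ → ℂ} {c₁ c₂ T₀ : ℝ} {g : ℝ → ℝ}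
    (hg : Tendsto g atTop (𝓝 0))
    (hf : ∀ z : ℂ, z.re ∈ Set.uIcc c₁ c₂ → T₀ ≤ |z.im| → ‖f z‖ ≤ g |z.im|) :
    Tendsto (fun T : ℝ => (∫ u in c₁..c₂, f (u + T * Complex.I)) -
      ∫ u in c₁..c₂, f (u + (-T : ℝ) * Complex.I)) atTop (𝓝 0) := by
  have key : ∀ (s : ℝ → ℝ), (∀ T, |s T| = |T|) →
      Tendsto (fun T : ℝ => ∫ u in c₁..c₂, f (u + s T * Complex.I)) atTop (𝓝 0) := by
    intro s hs
    refine squeeze_zero_norm' (a := fun T => g T * |c₂ - c₁|) ?_ (by simpa using hg.mul_const _)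
    filter_upwards [eventually_ge_atTop T₀, eventually_ge_atTop 0] with T hT hT0
    refine intervalIntegral.norm_integral_le_of_norm_le_const fun u hu => ?_
    have h₁ : ((u : ℂ) + s T * Complex.I).re = u := by simp
    have h₂ : ((u : ℂ) + s T * Complex.I).im = s T := by simp
    have := hf (u + s T * Complex.I) (by rw [h₁]; exact Set.uIoc_subset_uIcc hu)
      (by rw [h₂, hs, abs_of_nonneg hT0]; exact hT)
    rwa [h₂, hs, abs_of_nonneg hT0] at this
  simpa using (key (fun T => T) fun _ => rfl).sub (key (fun T => -T) fun T => abs_neg T)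

/-- The closed integral does not depend on T > T₀ and tends to v - v = 0. Equality of the limiting
indices thus becomes exact vanishing at finite height. -/
theorem contourDiff_inv_eq_zero {K₁ K₂ : ℝ → ℂ} (h₁ : ContDiff ℝ 1 K₁)
    (h₂ : ContDiff ℝ 1 K₂) {c₁ c₂ T₀ : ℝ}
    (e₁ : ∀ t : ℝ, T₀ ≤ |t| → K₁ t = c₁ + t * Complex.I)
    (e₂ : ∀ t : ℝ, T₀ ≤ |t| → K₂ t = c₂ + t * Complex.I) {p v : ℂ}
    (hp₁ : p ∉ Set.range K₁) (hp₂ : p ∉ Set.range K₂)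
    (i₁ : HasIndexIntegral K₁ p v) (i₂ : HasIndexIntegral K₂ p v) (hp : |p.im| ≤ T₀)
    {T : ℝ} (hT : T₀ < T) :
    contourDiff K₁ K₂ c₁ c₂ T (fun z => (z - p)⁻¹) = 0 := by
  have hz : ∀ {S : Set ℂ}, p ∉ S → ContinuousOn (fun z => (z - p)⁻¹) S := fun hS =>
    ContinuousOn.inv₀ (by fun_prop) fun z hz h => hS (sub_eq_zero.1 h ▸ hz)
  have hd : DifferentiableOn ℂ (fun z => (z - p)⁻¹) {z | T₀ < |z.im|} :=
    DifferentiableOn.inv (by fun_prop) fun z hz h => by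
      rw [sub_eq_zero.1 h] at hz
      exact absurd hz (not_lt.2 hp)
  have hlim : Tendsto (fun T : ℝ => contourDiff K₁ K₂ c₁ c₂ T (fun z => (z - p)⁻¹)) atTop
      (𝓝 0) := by
    have hh := tendsto_horizontal_integral (f := fun z => (z - p)⁻¹) (c₁ := c₁) (c₂ := c₂)
      (T₀ := T₀ + 1) (g := fun y => (y - T₀)⁻¹)
      (tendsto_inv_atTop_zero.comp (tendsto_atTop_add_const_right _ (-T₀) tendsto_id))
      (fun z _ hz => by
        rw [norm_inv]
        refine inv_anti₀ (by linarith) ?_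
        refine le_trans ?_ (Complex.abs_im_le_norm (z - p))
        rw [Complex.sub_im]
        have := abs_sub_abs_le_abs_sub z.im p.im
        linarith)
    have := (i₁.sub i₂).add hh
    simp only [sub_self, add_zero] at this
    refine this.congr fun T => ?_
    simp only [contourDiff, div_eq_inv_mul]
    ring
  refine tendsto_nhds_unique (tendsto_const_nhds.congr' ?_) hlim
  filter_upwards [eventually_ge_atTop T] with T' hT'
  exact (contourDiff_eq_of_le h₁ h₂ e₁ e₂ (hz hp₁) (hz hp₂) hd hT hT').symm

/-- Two contours that are vertical outside a bounded set and have the same index with respect to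
all the poles of a rapidly decreasing meromorphic function yield the same integral. -/
theorem integral_contour_eq {K₁ K₂ : ℝ → ℂ} (h₁ : ContDiff ℝ 1 K₁)
    (h₂ : ContDiff ℝ 1 K₂) {c₁ c₂ T₀ : ℝ}
    (e₁ : ∀ t : ℝ, T₀ ≤ |t| → K₁ t = c₁ + t * Complex.I)
    (e₂ : ∀ t : ℝ, T₀ ≤ |t| → K₂ t = c₂ + t * Complex.I) {G : ℂ → ℂ} {Z : Set ℂ}
    (hZ : ∀ p ∈ Z, p ∉ Set.range K₁ ∧ p ∉ Set.range K₂ ∧ |p.im| ≤ T₀ ∧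
      ∃ v, HasIndexIntegral K₁ p v ∧ HasIndexIntegral K₂ p v)
    (hG : ∀ R : ℝ, ∃ (F : ℂ → ℂ) (m : Multiset ℂ), DifferentiableOn ℂ F (Metric.ball 0 R) ∧
      (∀ p ∈ m, p ∈ Z) ∧ ∀ z ∈ Metric.ball (0 : ℂ) R, (∀ p ∈ m, z ≠ p) →
        G z = F z * ((m.map fun p => z - p).prod)⁻¹)
    {g : ℝ → ℝ} (hg : Tendsto g atTop (𝓝 0))
    (hGg : ∀ z : ℂ, z.re ∈ Set.uIcc c₁ c₂ → T₀ ≤ |z.im| → ‖G z‖ ≤ g |z.im|)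
    (i₁ : Integrable fun t => G (K₁ t) * deriv K₁ t)
    (i₂ : Integrable fun t => G (K₂ t) * deriv K₂ t) :
    ∫ t, G (K₁ t) * deriv K₁ t = ∫ t, G (K₂ t) * deriv K₂ t := by
  have hlim : Tendsto (fun T : ℝ => contourDiff K₁ K₂ c₁ c₂ T G) atTop
      (𝓝 ((∫ t, G (K₁ t) * deriv K₁ t) - ∫ t, G (K₂ t) * deriv K₂ t)) := by
    have l₁ := intervalIntegral_tendsto_integral i₁ tendsto_neg_atTop_atBot tendsto_id
    have l₂ := intervalIntegral_tendsto_integral i₂ tendsto_neg_atTop_atBot tendsto_id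
    have := (l₁.sub l₂).add (tendsto_horizontal_integral hg hGg)
    rw [add_zero] at this
    refine this.congr fun T => ?_
    simp only [contourDiff, id]
    ring
  rw [← sub_eq_zero]
  refine tendsto_nhds_unique hlim (tendsto_const_nhds.congr' ?_)
  filter_upwards [eventually_gt_atTop T₀] with T hT
  have hTabs : T₀ ≤ |T| := hT.le.trans (le_abs_self T)
  have hA := contourDiff_isClosedChainIntegral h₁ h₂ (e₁ T hTabs) (e₂ T hTabs)
    (e₁ (-T) (by rwa [abs_neg])) (e₂ (-T) (by rwa [abs_neg]))
  have hcomp : IsCompact (contourDiffSupport K₁ K₂ c₁ c₂ T) :=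
    ((isCompact_uIcc.image h₁.continuous).union (isCompact_uIcc.image h₂.continuous)).union
      ((isCompact_uIcc.image (contDiff_horizontal _).continuous).union
        (isCompact_uIcc.image (contDiff_horizontal _).continuous))
  obtain ⟨R, hR⟩ := hcomp.isBounded.subset_ball 0
  obtain ⟨F, m, hF, hm, hGF⟩ := hG R
  have hS : ∀ p ∈ m, p ∉ contourDiffSupport K₁ K₂ c₁ c₂ T := by
    intro p hp hpS
    obtain ⟨a₁, a₂, a₃, -⟩ := hZ p (hm p hp)
    rcases hpS with (h | h) | h | h
    · exact a₁ (Set.image_subset_range _ _ h)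
    · exact a₂ (Set.image_subset_range _ _ h)
    · obtain ⟨u, -, rfl⟩ := h
      simp at a₃
      linarith [le_abs_self T]
    · obtain ⟨u, -, rfl⟩ := h
      simp at a₃
      linarith [le_abs_self T]
  rw [hA.congr G _ fun z hz => hGF z (hR hz) fun p hp h => hS p hp (h ▸ hz)]
  refine (hA.meromorphic_eq_zero hR m (fun p hp => ⟨hS p hp, ?_⟩) F hF).symm
  obtain ⟨a₁, a₂, a₃, v, v₁, v₂⟩ := hZ p (hm p hp)
  exact contourDiff_inv_eq_zero h₁ h₂ e₁ e₂ a₁ a₂ v₁ v₂ a₃ hT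

/-! ### Growth of the Gamma function in vertical strips -/

/-- `f` is `O(exp (r |Im s|))` in every vertical strip. -/
def StripBound (r : ℝ) (f : ℂ → ℂ) : Prop :=
  ∀ c₁ c₂ : ℝ, ∃ C T : ℝ, ∀ s : ℂ, c₁ ≤ s.re → s.re ≤ c₂ → T ≤ |s.im| →
    ‖f s‖ ≤ C * Real.exp (r * |s.im|)

namespace StripBound

variable {r r' : ℝ} {f g : ℂ → ℂ}

theorem mul (hf : StripBound r f) (hg : StripBound r' g) :
    StripBound (r + r') (fun s => f s * g s) := by
  intro c₁ c₂
  obtain ⟨C, T, h⟩ := hf c₁ c₂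
  obtain ⟨C', T', h'⟩ := hg c₁ c₂
  refine ⟨C * C', max T T', fun s h₁ h₂ h₃ => ?_⟩
  have b := h s h₁ h₂ ((le_max_left _ _).trans h₃)
  have b' := h' s h₁ h₂ ((le_max_right _ _).trans h₃)
  rw [norm_mul, add_mul, Real.exp_add, mul_mul_mul_comm]
  exact mul_le_mul b b' (norm_nonneg _) ((norm_nonneg _).trans b)

theorem mono (hf : StripBound r f) (hr : r ≤ r') : StripBound r' f := by
  intro c₁ c₂
  obtain ⟨C, T, h⟩ := hf c₁ c₂
  refine ⟨|C|, T, fun s h₁ h₂ h₃ => (h s h₁ h₂ h₃).trans ?_⟩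
  exact mul_le_mul (le_abs_self C) (Real.exp_le_exp.2
    (mul_le_mul_of_nonneg_right hr (abs_nonneg _))) (Real.exp_nonneg _) (abs_nonneg _)

theorem add (hf : StripBound r f) (hg : StripBound r g) :
    StripBound r (fun s => f s + g s) := by
  intro c₁ c₂
  obtain ⟨C, T, h⟩ := hf c₁ c₂
  obtain ⟨C', T', h'⟩ := hg c₁ c₂
  refine ⟨C + C', max T T', fun s h₁ h₂ h₃ => ?_⟩
  have b := h s h₁ h₂ ((le_max_left _ _).trans h₃)
  have b' := h' s h₁ h₂ ((le_max_right _ _).trans h₃)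
  rw [add_mul]
  exact (norm_add_le _ _).trans (add_le_add b b')

theorem const (c : ℂ) (hr : 0 ≤ r) : StripBound r (fun _ => c) := by
  refine fun _ _ => ⟨‖c‖, 0, fun s _ _ _ => ?_⟩
  exact le_mul_of_one_le_right (norm_nonneg c) (Real.one_le_exp (by positivity))

theorem ident (hr : 0 < r) : StripBound r (fun s => s) := by
  intro c₁ c₂
  refine ⟨max |c₁| |c₂| + 1 / r, 0, fun s h₁ h₂ _ => ?_⟩
  have a₁ : |s.re| ≤ max |c₁| |c₂| := abs_le_max_abs_abs h₁ h₂
  have a₂ : r * |s.im| + 1 ≤ Real.exp (r * |s.im|) := Real.add_one_le_exp _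
  have a₃ : (1 : ℝ) ≤ Real.exp (r * |s.im|) := Real.one_le_exp (by positivity)
  have a₄ : |s.im| ≤ 1 / r * Real.exp (r * |s.im|) := by
    rw [one_div, inv_mul_eq_div, le_div_iff₀ hr]
    linarith
  have a₅ : |s.re| ≤ max |c₁| |c₂| * Real.exp (r * |s.im|) :=
    a₁.trans (le_mul_of_one_le_right ((abs_nonneg _).trans a₁) a₃)
  rw [add_mul]
  exact (Complex.norm_le_abs_re_add_abs_im s).trans (add_le_add a₅ a₄)

theorem pow_ident (n : ℕ) (hr : 0 < r) : StripBound r (fun s => s ^ n) := by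
  induction n generalizing r with
  | zero => simpa using const 1 hr.le
  | succ n ih =>
    have := (ih (half_pos hr)).mul (ident (half_pos hr))
    simpa [pow_succ] using this

theorem polynomial (p : ℂ[X]) (hr : 0 < r) : StripBound r (fun s => p.eval s) := by
  induction p using Polynomial.induction_on' with
  | add p q hp hq => simpa using hp.add hq
  | monomial n a =>
    have := (const a (half_pos hr).le).mul (pow_ident n (half_pos hr))
    simpa using this

theorem comp_neg (hf : StripBound r f) : StripBound r (fun s => f (-s)) := by
  intro c₁ c₂
  obtain ⟨C, T, h⟩ := hf (-c₂) (-c₁)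
  refine ⟨C, T, fun s h₁ h₂ h₃ => ?_⟩
  simpa using h (-s) (by simpa using h₂) (by simpa using h₁) (by simpa using h₃)

theorem comp_add (hf : StripBound r f) (a : ℂ) : StripBound r (fun s => f (a + s)) := by
  intro c₁ c₂
  obtain ⟨C, T, h⟩ := hf (a.re + c₁) (a.re + c₂)
  refine ⟨|C| * Real.exp (|r| * |a.im|), T + |a.im|, fun s h₁ h₂ h₃ => ?_⟩
  have e₁ : |s.im| - |a.im| ≤ |a.im + s.im| := by
    have := abs_sub_abs_le_abs_sub s.im (-a.im)
    rwa [abs_neg, sub_neg_eq_add, add_comm s.im] at this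
  have e₂ : |a.im + s.im| - |s.im| ≤ |a.im| := by linarith [abs_add_le a.im s.im]
  have e₃ : r * |a.im + s.im| ≤ |r| * |a.im| + r * |s.im| := by
    have : r * (|a.im + s.im| - |s.im|) ≤ |r| * |a.im| := by
      refine (le_abs_self _).trans ?_
      rw [abs_mul]
      exact mul_le_mul_of_nonneg_left (abs_le.2 ⟨by linarith, e₂⟩) (abs_nonneg r)
    linarith
  have b := h (a + s) (by simpa using h₁) (by simpa using h₂)
    (by rw [Complex.add_im]; linarith)
  rw [Complex.add_im] at b
  refine b.trans ?_
  rw [mul_assoc, ← Real.exp_add]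
  exact mul_le_mul (le_abs_self C) (Real.exp_le_exp.2 e₃) (Real.exp_nonneg _) (abs_nonneg _)

end StripBound

theorem norm_Gamma_le {s : ℂ} (hs : 0 < s.re) : ‖Complex.Gamma s‖ ≤ Real.Gamma s.re := by
  rw [Complex.Gamma_eq_integral hs, Real.Gamma_eq_integral hs, Complex.GammaIntegral]
  refine (norm_integral_le_integral_norm _).trans (le_of_eq ?_)
  refine setIntegral_congr_fun measurableSet_Ioi fun x hx => ?_
  simp only [norm_mul, Complex.norm_cpow_eq_rpow_re_of_pos hx, Complex.sub_re, Complex.one_re,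
    Complex.norm_real, Real.norm_eq_abs, abs_of_pos (Real.exp_pos _)]

/-- On (0, 1) the modulus of the integrand depends only on the real parts of the exponents. -/
theorem norm_betaIntegral_le (u v : ℂ) :
    ‖Complex.betaIntegral u v‖ ≤ ‖Complex.betaIntegral u.re v.re‖ := by
  have h : Complex.betaIntegral u.re v.re =
      ((∫ x : ℝ in (0 : ℝ)..1, ‖(x : ℂ) ^ (u - 1) * (1 - (x : ℂ)) ^ (v - 1)‖ : ℝ) : ℂ) := by
    rw [Complex.betaIntegral, ← intervalIntegral.integral_ofReal]
    refine intervalIntegral.integral_congr_ae ?_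
    have : ∀ᵐ x : ℝ, x ≠ 1 := by simp [ae_iff]
    filter_upwards [this] with x hx1 hx
    rw [Set.uIoc_of_le zero_le_one] at hx
    have h₁ : 0 < 1 - x := sub_pos.2 (lt_of_le_of_ne hx.2 hx1)
    rw [show (1 : ℂ) - x = ((1 - x : ℝ) : ℂ) by push_cast; rfl, norm_mul,
      Complex.norm_cpow_eq_rpow_re_of_pos hx.1, Complex.norm_cpow_eq_rpow_re_of_pos h₁]
    push_cast
    rw [Complex.ofReal_cpow hx.1.le, show (1 : ℂ) - x = ((1 - x : ℝ) : ℂ) by push_cast; rfl,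
      Complex.ofReal_cpow h₁.le]
    simp
  rw [h, Complex.norm_real, Complex.betaIntegral]
  exact (intervalIntegral.norm_integral_le_integral_norm zero_le_one).trans (le_abs_self _)

theorem norm_Gamma_mul_le {s t : ℂ} (hs : 0 < s.re) (ht : 0 < t.re) :
    ‖Complex.Gamma s‖ * ‖Complex.Gamma t‖ * Real.Gamma (s.re + t.re) ≤
      ‖Complex.Gamma (s + t)‖ * (Real.Gamma s.re * Real.Gamma t.re) := by
  have h₁ := congrArg norm (Complex.Gamma_mul_Gamma_eq_betaIntegral hs ht)
  have h₂ := congrArg norm (Complex.Gamma_mul_Gamma_eq_betaIntegral (s := s.re) (t := t.re)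
    (by simpa using hs) (by simpa using ht))
  have h₃ := norm_betaIntegral_le s t
  rw [norm_mul, norm_mul] at h₁ h₂
  rw [← Complex.ofReal_add, Complex.Gamma_ofReal, Complex.Gamma_ofReal, Complex.Gamma_ofReal,
    Complex.norm_real, Complex.norm_real, Complex.norm_real,
    Real.norm_of_nonneg (Real.Gamma_pos_of_pos hs).le,
    Real.norm_of_nonneg (Real.Gamma_pos_of_pos ht).le,
    Real.norm_of_nonneg (Real.Gamma_pos_of_pos (add_pos hs ht)).le] at h₂
  rw [h₁, h₂, mul_assoc, mul_comm (‖Complex.betaIntegral s t‖)]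
  have := (Real.Gamma_pos_of_pos (add_pos hs ht)).le
  gcongr

/-- The reflection formula, since Γ(1-iy) is the conjugate of Γ(1+iy). -/
theorem norm_Gamma_one_add_sq (y : ℝ) (hy : y ≠ 0) :
    ‖Complex.Gamma (1 + y * Complex.I)‖ ^ 2 = Real.pi * |y| / |Real.sinh (Real.pi * y)| := by
  have hyI : (y : ℂ) * Complex.I ≠ 0 := mul_ne_zero (by exact_mod_cast hy) Complex.I_ne_zero
  have h₁ := Complex.Gamma_add_one _ hyI
  have h₂ := Complex.Gamma_mul_Gamma_one_sub (y * Complex.I)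
  have h₃ : Complex.Gamma (1 - y * Complex.I) =
      (starRingEnd ℂ) (Complex.Gamma (1 + y * Complex.I)) := by
    rw [← Complex.Gamma_conj]; simp [sub_eq_add_neg]
  have h₄ : ‖Complex.Gamma (1 + y * Complex.I)‖ ^ 2 =
      ‖Complex.Gamma (1 + y * Complex.I) * Complex.Gamma (1 - y * Complex.I)‖ := by
    rw [h₃, norm_mul, RCLike.norm_conj, sq]
  rw [h₄, add_comm 1, h₁, mul_assoc, h₂,
    show (Real.pi : ℂ) * (y * Complex.I) = ((Real.pi * y : ℝ) : ℂ) * Complex.I by push_cast; ring,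
    Complex.sin_mul_I, ← Complex.ofReal_sinh]
  simp only [norm_mul, norm_div, Complex.norm_real, Complex.norm_I, mul_one, Real.norm_eq_abs,
    abs_of_pos Real.pi_pos]
  ring

theorem norm_Gamma_one_add_le (y : ℝ) (hy : 1 ≤ |y|) :
    ‖Complex.Gamma (1 + y * Complex.I)‖ ^ 2 ≤
      4 * Real.pi * |y| * Real.exp (-(Real.pi * |y|)) := by
  have hy0 : y ≠ 0 := by rintro rfl; simp at hy; linarith
  have hs : Real.exp (Real.pi * |y|) / 4 ≤ |Real.sinh (Real.pi * y)| := by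
    have e : |Real.sinh (Real.pi * y)| = Real.sinh (Real.pi * |y|) := by
      rw [Real.abs_sinh, abs_mul, abs_of_pos Real.pi_pos]
    rw [e, Real.sinh_eq]
    have h₁ : 1 ≤ Real.pi * |y| := by nlinarith [Real.pi_gt_three]
    have h₂ : Real.exp (-(Real.pi * |y|)) ≤ 1 := Real.exp_le_one_iff.2 (by linarith)
    have h₃ : Real.pi * |y| + 1 ≤ Real.exp (Real.pi * |y|) := Real.add_one_le_exp _
    linarith
  rw [norm_Gamma_one_add_sq y hy0, Real.exp_neg, div_le_iff₀ (lt_of_lt_of_le (by positivity) hs)]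
  have : Real.pi * |y| = 4 * Real.pi * |y| * (Real.exp (Real.pi * |y|))⁻¹ *
      (Real.exp (Real.pi * |y|) / 4) := by
    have := Real.exp_pos (Real.pi * |y|)
    field_simp
  conv_lhs => rw [this]
  gcongr

/-- Each use of Γ(s+1) = sΓ(s) costs a factor linear in |y|, paid for by a slightly smaller rate;
hence the induction is uniform in `ρ`. -/
theorem norm_Gamma_vertical (m : ℕ) {ρ : ℝ} (hρ : ρ < Real.pi / 2) :
    ∃ C : ℝ, ∀ y : ℝ, 1 ≤ |y| →
      ‖Complex.Gamma (m + 1 + y * Complex.I)‖ ≤ C * Real.exp (-ρ * |y|) := by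
  induction m generalizing ρ with
  | zero =>
    set ε := Real.pi / 2 - ρ with hε
    have hε0 : 0 < ε := sub_pos.2 hρ
    refine ⟨Real.sqrt (4 * Real.pi / ε), fun y hy => ?_⟩
    refine le_of_sq_le_sq ?_ (by positivity)
    rw [mul_pow, Real.sq_sqrt (by positivity), ← Real.exp_nat_mul]
    simp only [Nat.cast_zero, zero_add]
    refine (norm_Gamma_one_add_le y hy).trans ?_
    have h₁ : ε * |y| ≤ Real.exp (2 * (ε * |y|)) := by
      have := Real.add_one_le_exp (2 * (ε * |y|))
      have : 0 ≤ ε * |y| := by positivity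
      linarith
    have h₂ : |y| ≤ Real.exp (2 * (ε * |y|)) / ε := by
      rw [le_div_iff₀ hε0]; linarith
    calc 4 * Real.pi * |y| * Real.exp (-(Real.pi * |y|))
        ≤ 4 * Real.pi * (Real.exp (2 * (ε * |y|)) / ε) * Real.exp (-(Real.pi * |y|)) := by gcongr
      _ = 4 * Real.pi / ε * (Real.exp (2 * (ε * |y|)) * Real.exp (-(Real.pi * |y|))) := by ring
      _ = _ := by
          rw [← Real.exp_add, hε]
          congr 2
          push_cast
          ring
  | succ m ih =>
    set ρ' := (ρ + Real.pi / 2) / 2 with hρ'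
    obtain ⟨C, hC⟩ := ih (ρ := ρ') (by rw [hρ']; linarith)
    have hε : 0 < ρ' - ρ := by rw [hρ']; linarith
    refine ⟨(m + 1 + 1 / (ρ' - ρ)) * C, fun y hy => ?_⟩
    have hne : (m + 1 + y * Complex.I : ℂ) ≠ 0 := by
      intro h
      have := congrArg Complex.im h
      simp at this
      rw [this] at hy
      simp at hy
      linarith
    have h₁ := Complex.Gamma_add_one _ hne
    rw [show ((m + 1 : ℕ) : ℂ) + 1 + y * Complex.I = m + 1 + y * Complex.I + 1 by push_cast; ring,
      h₁, norm_mul]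
    have h₂ : ‖(m + 1 + y * Complex.I : ℂ)‖ ≤ (m + 1 + 1 / (ρ' - ρ)) *
        Real.exp ((ρ' - ρ) * |y|) := by
      refine (norm_add_le _ _).trans ?_
      rw [norm_mul, Complex.norm_I, mul_one, Complex.norm_real, Real.norm_eq_abs]
      have a₁ : ‖(m + 1 : ℂ)‖ = m + 1 := by
        rw [show (m + 1 : ℂ) = ((m + 1 : ℕ) : ℂ) by push_cast; rfl, Complex.norm_natCast]
        push_cast; rfl
      have a₂ : (ρ' - ρ) * |y| + 1 ≤ Real.exp ((ρ' - ρ) * |y|) := Real.add_one_le_exp _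
      have a₃ : (1 : ℝ) ≤ Real.exp ((ρ' - ρ) * |y|) := Real.one_le_exp (by positivity)
      have a₄ : |y| ≤ 1 / (ρ' - ρ) * Real.exp ((ρ' - ρ) * |y|) := by
        rw [one_div, inv_mul_eq_div, le_div_iff₀ hε]; linarith
      have a₅ : (m + 1 : ℝ) ≤ (m + 1) * Real.exp ((ρ' - ρ) * |y|) :=
        le_mul_of_one_le_right (by positivity) a₃
      rw [a₁, add_mul]
      exact add_le_add a₅ a₄
    refine (mul_le_mul h₂ (hC y hy) (norm_nonneg _) ((norm_nonneg _).trans h₂)).trans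
      (le_of_eq ?_)
    rw [mul_mul_mul_comm, ← Real.exp_add]
    congr 2
    ring

/-- The Beta bound with the real second argument m + 1 - Re s compares Γ(s) with Γ on the line of
real part m + 1. The rate 3/2 is a convenient number below π/2. -/
theorem norm_Gamma_strip_pos {c₁ c₂ : ℝ} (hc : 0 < c₁) : ∃ C T : ℝ, ∀ s : ℂ,
    c₁ ≤ s.re → s.re ≤ c₂ → T ≤ |s.im| →
      ‖Complex.Gamma s‖ ≤ C * Real.exp (-(3 / 2) * |s.im|) := by
  obtain ⟨m, hm⟩ := exists_nat_gt c₂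
  obtain ⟨C, hC⟩ := norm_Gamma_vertical m (ρ := 3 / 2) (by linarith [Real.pi_gt_d2])
  have hcont : ContinuousOn Real.Gamma (Set.Icc c₁ c₂) := fun x hx =>
    (Real.differentiableAt_Gamma fun k h => by
      have : (0 : ℝ) ≤ k := k.cast_nonneg
      linarith [hx.1]).continuousAt.continuousWithinAt
  obtain ⟨B, hB⟩ := isCompact_Icc.exists_bound_of_continuousOn hcont
  refine ⟨C * (B / Real.Gamma (m + 1)), 1, fun s h₁ h₂ h₃ => ?_⟩
  have hs : 0 < s.re := hc.trans_le h₁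
  have ht : 0 < (m + 1 - s.re : ℝ) := by linarith
  have h := norm_Gamma_mul_le (s := s) (t := ((m + 1 - s.re : ℝ) : ℂ)) hs (by simpa using ht)
  have e : s + ((m + 1 - s.re : ℝ) : ℂ) = m + 1 + s.im * Complex.I := by
    apply Complex.ext <;> simp
  rw [e, Complex.Gamma_ofReal, Complex.norm_real, Complex.ofReal_re,
    Real.norm_of_nonneg (Real.Gamma_pos_of_pos ht).le, ← mul_assoc,
    show s.re + (m + 1 - s.re) = (m + 1 : ℝ) by ring, mul_right_comm] at h
  have h' := le_of_mul_le_mul_right h (Real.Gamma_pos_of_pos ht)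
  have hm1 : 0 < Real.Gamma (m + 1) := Real.Gamma_pos_of_pos (by positivity)
  rw [← le_div_iff₀ hm1] at h'
  refine h'.trans ?_
  have hB' : Real.Gamma s.re ≤ B := (le_abs_self _).trans (hB _ ⟨h₁, h₂⟩)
  have hC' := hC s.im h₃
  rw [mul_div_assoc, mul_right_comm]
  exact mul_le_mul hC' (by gcongr) (div_nonneg (Real.Gamma_pos_of_pos hs).le hm1.le)
    ((norm_nonneg _).trans hC')

theorem stripBound_Gamma : StripBound (-(3 / 2)) Complex.Gamma := by
  have key : ∀ (k : ℕ) (c₁ c₂ : ℝ), 0 < c₁ + k → ∃ C T : ℝ, ∀ s : ℂ,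
      c₁ ≤ s.re → s.re ≤ c₂ → T ≤ |s.im| →
        ‖Complex.Gamma s‖ ≤ C * Real.exp (-(3 / 2) * |s.im|) := by
    intro k
    induction k with
    | zero => exact fun c₁ c₂ h => norm_Gamma_strip_pos (by simpa using h)
    | succ k ih =>
      intro c₁ c₂ h
      obtain ⟨C, T, hC⟩ := ih (c₁ + 1) (c₂ + 1) (by push_cast at h; linarith)
      refine ⟨C, max T 1, fun s h₁ h₂ h₃ => ?_⟩
      have h₄ := hC (s + 1) (by simpa using h₁) (by simpa using h₂)
        (by simpa using (le_max_left _ _).trans h₃)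
      have h₅ : 1 ≤ ‖s‖ := ((le_max_right _ _).trans h₃).trans (Complex.abs_im_le_norm s)
      have h₆ : s ≠ 0 := fun h => by rw [h, norm_zero] at h₅; linarith
      rw [Complex.Gamma_add_one s h₆, norm_mul] at h₄
      simp only [Complex.add_im, Complex.one_im, add_zero] at h₄
      exact (le_mul_of_one_le_left (norm_nonneg _) h₅).trans h₄
  intro c₁ c₂
  obtain ⟨k, hk⟩ := exists_nat_gt (-c₁)
  exact key k c₁ c₂ (by linarith)

theorem norm_sin_le (z : ℂ) : ‖Complex.sin z‖ ≤ Real.exp |z.im| := by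
  rw [Complex.sin, norm_div, norm_mul, Complex.norm_I, mul_one, Complex.norm_ofNat,
    div_le_iff₀ two_pos]
  refine (norm_sub_le _ _).trans ?_
  rw [Complex.norm_exp, Complex.norm_exp]
  have h₁ : Real.exp (-z * Complex.I).re ≤ Real.exp |z.im| :=
    Real.exp_le_exp.2 (by simpa using le_abs_self z.im)
  have h₂ : Real.exp (z * Complex.I).re ≤ Real.exp |z.im| :=
    Real.exp_le_exp.2 (by simpa using neg_le_abs z.im)
  linarith

theorem stripBound_sin : StripBound (2 * Real.pi) (fun s => Complex.sin (2 * Real.pi * s)) := by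
  refine fun _ _ => ⟨1, 0, fun s _ _ _ => (norm_sin_le _).trans (le_of_eq ?_)⟩
  rw [one_mul, show (2 * Real.pi * s : ℂ) = ((2 * Real.pi : ℝ) : ℂ) * s by push_cast; ring,
    Complex.im_ofReal_mul, abs_mul, abs_of_pos (by positivity)]

/-! ### The Wilson weight along a contour -/

/-- The weight `∏ Γ(e + s) Γ(e - s) / (Γ(2s) Γ(-2s))` over the four parameters `e`. -/
noncomputable def wilsonW (a b c d s : ℂ) : ℂ :=
  Complex.Gamma (a + s) * Complex.Gamma (a - s) * (Complex.Gamma (b + s) * Complex.Gamma (b - s)) *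
    (Complex.Gamma (c + s) * Complex.Gamma (c - s)) *
      (Complex.Gamma (d + s) * Complex.Gamma (d - s)) *
        (-(2 * s * Complex.sin (2 * Real.pi * s)) / Real.pi)

theorem inv_Gamma_two_mul (s : ℂ) : (Complex.Gamma (2 * s) * Complex.Gamma (-(2 * s)))⁻¹ =
    -(2 * s * Complex.sin (2 * Real.pi * s)) / Real.pi := by
  rcases eq_or_ne s 0 with rfl | hs
  · simp
  have hs' : -(2 * s) ≠ 0 := neg_ne_zero.2 (mul_ne_zero two_ne_zero hs)
  have h₁ := Complex.Gamma_add_one _ hs'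
  have h₂ := Complex.Gamma_mul_Gamma_one_sub (2 * s)
  rw [show 1 - 2 * s = -(2 * s) + 1 by ring, h₁, show (Real.pi : ℂ) * (2 * s) = 2 * Real.pi * s by
    ring] at h₂
  have h₃ : Complex.Gamma (2 * s) * Complex.Gamma (-(2 * s)) =
      Real.pi / Complex.sin (2 * Real.pi * s) / (-(2 * s)) := by
    rw [← h₂]; field_simp
  rw [h₃, inv_div, div_div_eq_mul_div]
  ring

theorem wilsonWeight_eq (N : ℕ) (β γ δ z : ℂ) :
    wilsonWeight N β γ δ z = wilsonW (wpar N β γ δ 0) (wpar N β γ δ 1) (wpar N β γ δ 2)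
      (wpar N β γ δ 3) (z + (1 + (γ + δ + N) / 2)) := by
  set s := z + (1 + (γ + δ + N) / 2) with hs
  have e₁ : Complex.I * (Complex.I * (z + 1 + (γ + δ + N) / 2)) = -s := by
    rw [hs]; linear_combination (z + 1 + (γ + δ + N) / 2) * Complex.I_sq
  rw [wilsonWeight, nu, nu, Fin.prod_univ_four, Fin.prod_univ_four, mul_neg, mul_neg, e₁,
    mul_assoc 2 Complex.I, e₁, wilsonW, ← inv_Gamma_two_mul]
  simp only [neg_neg, mul_neg, ← sub_eq_add_neg, div_eq_mul_inv, mul_inv]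
  ring

/-- `K` is upward vertical with real part `x` outside a bounded set. -/
structure IsVerticalContour (K : ℝ → ℂ) (x : ℝ) : Prop where
  contDiff : ContDiff ℝ 1 K
  eq_line : ∃ T : ℝ, ∀ t : ℝ, T ≤ |t| → K t = x + t * Complex.I

/-- After translation by `σ`, the contour `K` has `a, a + 1, …` on its right and
`-a, -a - 1, …` on its left. -/
def Separates (K : ℝ → ℂ) (σ a : ℂ) : Prop := ∀ k : ℕ,
  (a + k - σ ∉ Set.range K ∧ HasIndexIntegral K (a + k - σ) (-(Real.pi * Complex.I))) ∧
    (-a - k - σ ∉ Set.range K ∧ HasIndexIntegral K (-a - k - σ) (Real.pi * Complex.I))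

theorem Separates.add_nat {K : ℝ → ℂ} {σ a : ℂ} (h : Separates K σ a) (n : ℕ) :
    Separates K σ (a + n) := by
  intro k
  have := h (n + k)
  push_cast at this
  convert! this using 4 <;> ring

theorem Separates.add_ne {K : ℝ → ℂ} {σ a : ℂ} (h : Separates K σ a) (t : ℝ) (k : ℕ) :
    a + (K t + σ) ≠ -k := fun e => (h k).2.1 ⟨t, by linear_combination e⟩

theorem Separates.sub_ne {K : ℝ → ℂ} {σ a : ℂ} (h : Separates K σ a) (t : ℝ) (k : ℕ) :
    a - (K t + σ) ≠ -k := fun e => (h k).1.1 ⟨t, by linear_combination -e⟩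

theorem Separates.continuous_add {K : ℝ → ℂ} {σ a : ℂ} (h : Separates K σ a)
    (hK : Continuous K) : Continuous fun t => Complex.Gamma (a + (K t + σ)) :=
  continuous_iff_continuousAt.2 fun t =>
    ContinuousAt.comp (f := fun t => a + (K t + σ))
      (Complex.differentiableAt_Gamma _ (h.add_ne t)).continuousAt (by fun_prop)

theorem Separates.continuous_sub {K : ℝ → ℂ} {σ a : ℂ} (h : Separates K σ a)
    (hK : Continuous K) : Continuous fun t => Complex.Gamma (a - (K t + σ)) :=
  continuous_iff_continuousAt.2 fun t =>
    ContinuousAt.comp (f := fun t => a - (K t + σ))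
      (Complex.differentiableAt_Gamma _ (h.sub_ne t)).continuousAt (by fun_prop)

theorem integrable_exp_mul_abs_neg {r : ℝ} (hr : r < 0) :
    Integrable fun t : ℝ => Real.exp (r * |t|) := by
  have hr0 : r ≠ 0 := hr.ne
  have hr2 : 0 < r ^ 2 := by positivity
  refine (integrable_inv_one_add_sq.const_mul (1 + 2 / r ^ 2)).mono' (by fun_prop)
    (Eventually.of_forall fun t => ?_)
  rw [Real.norm_of_nonneg (Real.exp_nonneg _), ← neg_neg (r * |t|), Real.exp_neg,
    ← div_eq_mul_inv, inv_le_comm₀ (Real.exp_pos _) (by positivity), inv_div]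
  have h := Real.quadratic_le_exp_of_nonneg (x := -(r * |t|))
    (by have := abs_nonneg t; nlinarith)
  refine le_trans ?_ h
  have h0 : 0 ≤ -(r * |t|) := by have := abs_nonneg t; nlinarith
  rw [div_le_iff₀ (by positivity), neg_sq, mul_pow, sq_abs]
  have e : (1 + -(r * |t|) + r ^ 2 * t ^ 2 / 2) * (1 + 2 / r ^ 2) =
      1 + t ^ 2 + (2 / r ^ 2 + r ^ 2 * t ^ 2 / 2 + -(r * |t|) * (1 + 2 / r ^ 2)) := by
    have : r ^ 2 * t ^ 2 / 2 * (2 / r ^ 2) = t ^ 2 := by field_simp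
    linear_combination this
  rw [e]
  have : 0 ≤ 2 / r ^ 2 + r ^ 2 * t ^ 2 / 2 + -(r * |t|) * (1 + 2 / r ^ 2) := by positivity
  linarith

theorem IsVerticalContour.integrable {K : ℝ → ℂ} {x : ℝ} (hK : IsVerticalContour K x)
    {f : ℂ → ℂ} (hf : Continuous fun t => f (K t)) {r : ℝ} (hr : r < 0) (hb : StripBound r f) :
    Integrable fun t => f (K t) * deriv K t := by
  obtain ⟨T₀, hT₀⟩ := hK.eq_line
  obtain ⟨C, T, hC⟩ := hb x x
  have hcont : Continuous fun t => f (K t) * deriv K t :=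
    hf.mul (hK.contDiff.continuous_deriv le_rfl)
  set M := max (T₀ + 1) T with hM
  obtain ⟨B, hB⟩ := (isCompact_Icc (a := -M) (b := M)).exists_bound_of_continuousOn
    hcont.continuousOn
  -- The second constant covers the deformed part |t| ≤ M, where exp(-rM)·exp(r|t|) ≥ 1.
  refine ((integrable_exp_mul_abs_neg hr).const_mul (|C| + |B| * Real.exp (-r * M))).mono'
    hcont.aestronglyMeasurable (Eventually.of_forall fun t => ?_)
  rw [add_mul]
  by_cases ht : |t| ≤ M
  · have h₁ := (hB t (abs_le.1 ht)).trans (le_abs_self B)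
    have h₂ : 1 ≤ Real.exp (-r * M) * Real.exp (r * |t|) := by
      rw [← Real.exp_add]
      exact Real.one_le_exp (by nlinarith)
    have h₃ : |B| ≤ |B| * Real.exp (-r * M) * Real.exp (r * |t|) := by
      rw [mul_assoc]; exact le_mul_of_one_le_right (abs_nonneg B) h₂
    have : 0 ≤ |C| * Real.exp (r * |t|) := by positivity
    linarith
  · push Not at ht
    have h₁ : T₀ < |t| := by linarith [le_max_left (T₀ + 1) T]
    have h₂ : T ≤ |t| := by linarith [le_max_right (T₀ + 1) T]
    have h₃ := hC (K t) (by rw [hT₀ t h₁.le]; simp) (by rw [hT₀ t h₁.le]; simp)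
      (by rw [hT₀ t h₁.le]; simpa using h₂)
    rw [norm_mul, vertical_of_abs_ge hT₀ h₁, Complex.norm_I, mul_one]
    rw [hT₀ t h₁.le] at h₃ ⊢
    have e : ((x : ℂ) + t * Complex.I).im = t := by simp
    rw [e] at h₃
    have h₄ : C * Real.exp (r * |t|) ≤ |C| * Real.exp (r * |t|) := by
      gcongr; exact le_abs_self C
    have : 0 ≤ |B| * Real.exp (-r * M) * Real.exp (r * |t|) := by positivity
    linarith

/-! ### Meromorphic functions with poles in a given set -/

/-- On every ball, `G` is the quotient of a holomorphic function by a product of linear factors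
with zeros in `Z`. -/
def HasPolesIn (Z : Set ℂ) (G : ℂ → ℂ) : Prop :=
  ∀ R : ℝ, ∃ (F : ℂ → ℂ) (m : Multiset ℂ), DifferentiableOn ℂ F (Metric.ball 0 R) ∧
    (∀ p ∈ m, p ∈ Z) ∧ ∀ z ∈ Metric.ball (0 : ℂ) R, (∀ p ∈ m, z ≠ p) →
      G z = F z * ((m.map fun p => z - p).prod)⁻¹

theorem HasPolesIn.mul {Z : Set ℂ} {G H : ℂ → ℂ} (hG : HasPolesIn Z G) (hH : HasPolesIn Z H) :
    HasPolesIn Z fun z => G z * H z := by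
  intro R
  obtain ⟨F₁, m₁, hF₁, hm₁, h₁⟩ := hG R
  obtain ⟨F₂, m₂, hF₂, hm₂, h₂⟩ := hH R
  refine ⟨fun z => F₁ z * F₂ z, m₁ + m₂, hF₁.mul hF₂, fun p hp => ?_, fun z hz hzm => ?_⟩
  · exact (Multiset.mem_add.1 hp).elim (hm₁ p) (hm₂ p)
  · beta_reduce
    rw [h₁ z hz fun p hp => hzm p (Multiset.mem_add.2 (Or.inl hp)),
      h₂ z hz fun p hp => hzm p (Multiset.mem_add.2 (Or.inr hp)), Multiset.map_add,
      Multiset.prod_add, mul_inv]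
    ring

theorem HasPolesIn.of_differentiable {Z : Set ℂ} {G : ℂ → ℂ} (hG : Differentiable ℂ G) :
    HasPolesIn Z G := fun _ => ⟨G, 0, hG.differentiableOn, by simp, by simp⟩

theorem Gamma_add_nat (s : ℂ) (n : ℕ) (h : ∀ j < n, s + j ≠ 0) :
    Complex.Gamma (s + n) = poch s n * Complex.Gamma s := by
  induction n with
  | zero => simp [poch_zero]
  | succ n ih =>
    rw [poch_succ, Nat.cast_succ, ← add_assoc, Complex.Gamma_add_one _ (h n n.lt_succ_self),
      ih fun j hj => h j (hj.trans n.lt_succ_self)]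
    ring

theorem hasPolesIn_Gamma_add {Z : Set ℂ} (w : ℂ) (hZ : ∀ k : ℕ, -w - k ∈ Z) :
    HasPolesIn Z fun z => Complex.Gamma (w + z) := by
  intro R
  -- With this `M` the argument w + z + M has positive real part on the ball, so all poles there
  -- come from the factor (w+z)_M.
  obtain ⟨M, hM⟩ := exists_nat_gt (R - w.re)
  refine ⟨fun z => Complex.Gamma (w + z + M), (Multiset.range M).map fun j : ℕ => -w - j, ?_, ?_, ?_⟩
  · intro z hz
    refine DifferentiableAt.differentiableWithinAt ?_
    refine DifferentiableAt.comp (f := fun z => w + z + M) z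
      (Complex.differentiableAt_Gamma _ fun k e => ?_) (by fun_prop)
    have := congrArg Complex.re e
    simp only [Complex.add_re, Complex.natCast_re, Complex.neg_re] at this
    have h₁ : ‖z‖ < R := by simpa using hz
    have h₂ := (abs_le.1 (Complex.abs_re_le_norm z)).1
    have : (0 : ℝ) ≤ k := k.cast_nonneg
    linarith
  · intro p hp
    obtain ⟨j, -, rfl⟩ := Multiset.mem_map.1 hp
    exact hZ j
  · intro z _ hzm
    have h : ∀ j < M, w + z + j ≠ 0 := fun j hj e =>
      hzm (-w - j) (Multiset.mem_map.2 ⟨j, Multiset.mem_range.2 hj, rfl⟩) (by linear_combination e)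
    have e : (((Multiset.range M).map fun j : ℕ => -w - j).map fun p => z - p).prod =
        poch (w + z) M := by
      rw [Multiset.map_map, poch_eq_prod]
      refine congrArg Multiset.prod (Multiset.map_congr rfl fun j _ => ?_)
      simp only [Function.comp_apply]
      ring
    beta_reduce
    rw [e, Gamma_add_nat _ _ h, mul_comm, inv_mul_cancel_left₀ ((poch_ne_zero_iff _ _).2 h)]

theorem hasPolesIn_Gamma_sub {Z : Set ℂ} (w : ℂ) (hZ : ∀ k : ℕ, w + k ∈ Z) :
    HasPolesIn Z fun z => Complex.Gamma (w - z) := by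
  intro R
  obtain ⟨F, m, hF, hm, h⟩ := hasPolesIn_Gamma_add (Z := {z | -z ∈ Z}) w
    (fun k => by simpa [add_comm] using hZ k) R
  refine ⟨fun z => (-1) ^ m.card * F (-z), m.map fun p => -p, ?_, ?_, ?_⟩
  · refine (differentiableOn_const _).mul (hF.comp (by fun_prop) fun z hz => ?_)
    simpa using hz
  · intro p hp
    obtain ⟨q, hq, rfl⟩ := Multiset.mem_map.1 hp
    exact hm q hq
  · intro z hz hzm
    have e : ((m.map fun p => -p).map fun p => z - p).prod =
        (-1) ^ m.card * (m.map fun p => -z - p).prod := by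
      rw [Multiset.map_map, ← Multiset.prod_replicate, ← Multiset.map_const',
        ← Multiset.prod_map_mul]
      refine congrArg Multiset.prod (Multiset.map_congr rfl fun j _ => ?_)
      simp only [Function.comp_apply]
      ring
    have h' := h (-z) (by simpa using hz) fun p hp hh =>
      hzm (-p) (Multiset.mem_map.2 ⟨p, hp, rfl⟩) (by rw [← hh, neg_neg])
    beta_reduce at h' ⊢
    rw [e, sub_eq_add_neg, h', mul_inv, mul_mul_mul_comm, mul_inv_cancel₀ (by simp), one_mul]

/-! ### The Wilson functional -/

/-- The contour `K`, translated by `σ`, is suitable for the Wilson weight. -/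
structure IsWilsonContour (K : ℝ → ℂ) (σ a b c d : ℂ) : Prop where
  vertical : ∃ x : ℝ, IsVerticalContour K x
  fst : Separates K σ a
  snd : Separates K σ b
  trd : Separates K σ c
  fth : Separates K σ d

theorem stripBound_Gamma_add (w : ℂ) : StripBound (-(3 / 2)) fun z => Complex.Gamma (w + z) :=
  stripBound_Gamma.comp_add w

theorem stripBound_Gamma_sub (w : ℂ) : StripBound (-(3 / 2)) fun z => Complex.Gamma (w - z) := by
  simpa [sub_eq_add_neg] using (stripBound_Gamma.comp_add w).comp_neg

theorem stripBound_eval_sq (p : ℂ[X]) (w : ℂ) {r : ℝ} (hr : 0 < r) :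
    StripBound r fun s => p.eval ((s + w) ^ 2) := by
  have := StripBound.polynomial (p.comp ((X + C w) ^ 2)) hr
  simpa [eval_comp] using this

theorem stripBound_Gamma_prod (a₁ b₁ c₁ d₁ a₂ b₂ c₂ d₂ : ℂ) :
    StripBound (-12) fun s => Complex.Gamma (a₁ + s) * Complex.Gamma (a₂ - s) *
      (Complex.Gamma (b₁ + s) * Complex.Gamma (b₂ - s)) *
      (Complex.Gamma (c₁ + s) * Complex.Gamma (c₂ - s)) *
      (Complex.Gamma (d₁ + s) * Complex.Gamma (d₂ - s)) := by
  have h := fun u v => (stripBound_Gamma_add u).mul (stripBound_Gamma_sub v)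
  exact ((((h a₁ a₂).mul (h b₁ b₂)).mul (h c₁ c₂)).mul (h d₁ d₂)).mono (by norm_num)

theorem stripBound_sin_factor : StripBound (2 * Real.pi + 1) fun s : ℂ =>
    -(2 * s * Complex.sin (2 * Real.pi * s)) / Real.pi := by
  have := (stripBound_sin.mul ((StripBound.const (-(2 / Real.pi)) one_half_pos.le).mul
    (StripBound.ident one_half_pos))).mono (r' := 2 * Real.pi + 1) (by linarith)
  convert! this using 2
  ring

/-- Eight Gamma factors contribute -12; the sine factor with its s contributes 2π + 1 and the
polynomial 1, and 2π < 8. -/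
theorem stripBound_wilsonW (p : ℂ[X]) (a b c d : ℂ) :
    StripBound (-1) fun s => p.eval (s ^ 2) * wilsonW a b c d s := by
  have h₂ := stripBound_eval_sq p 0 one_pos
  simp only [add_zero] at h₂
  have := (h₂.mul ((stripBound_Gamma_prod a b c d a b c d).mul stripBound_sin_factor))
  exact this.mono (by linarith [Real.pi_lt_four])

namespace IsWilsonContour

variable {K : ℝ → ℂ} {σ a b c d : ℂ}

theorem continuous (h : IsWilsonContour K σ a b c d) : Continuous K :=
  h.vertical.choose_spec.contDiff.continuous

theorem continuous_wilsonW (h : IsWilsonContour K σ a b c d) :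
    Continuous fun t => wilsonW a b c d (K t + σ) := by
  have hK := h.continuous
  have := h.fst.continuous_add hK
  have := h.fst.continuous_sub hK
  have := h.snd.continuous_add hK
  have := h.snd.continuous_sub hK
  have := h.trd.continuous_add hK
  have := h.trd.continuous_sub hK
  have := h.fth.continuous_add hK
  have := h.fth.continuous_sub hK
  have : Continuous fun t => Complex.sin (2 * Real.pi * (K t + σ)) :=
    Complex.continuous_sin.comp (by fun_prop)
  unfold wilsonW
  fun_prop

theorem integrable (h : IsWilsonContour K σ a b c d) (p : ℂ[X]) :
    Integrable fun t => p.eval ((K t + σ) ^ 2) * wilsonW a b c d (K t + σ) * deriv K t := by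
  obtain ⟨x, hx⟩ := h.vertical
  have hK := h.continuous
  have hp : Continuous fun t => p.eval ((K t + σ) ^ 2) := p.continuous.comp (by fun_prop)
  refine hx.integrable (f := fun z => p.eval ((z + σ) ^ 2) * wilsonW a b c d (z + σ))
    (hp.mul h.continuous_wilsonW) (r := -1) (by norm_num) ?_
  simpa [add_comm] using (stripBound_wilsonW p a b c d).comp_add σ

end IsWilsonContour

/-- Integration of polynomials in `s² = (z + σ)²` with the Wilson weight along `K`. -/
noncomputable def wilsonFunctional {K : ℝ → ℂ} {σ a b c d : ℂ}
    (h : IsWilsonContour K σ a b c d) : ℂ[X] →ₗ[ℂ] ℂ where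
  toFun p := ∫ t, p.eval ((K t + σ) ^ 2) * wilsonW a b c d (K t + σ) * deriv K t
  map_add' p q := by
    rw [← integral_add (h.integrable p) (h.integrable q)]
    simp only [eval_add, add_mul]
  map_smul' k p := by
    simp only [RingHom.id_apply, smul_eq_mul, ← integral_const_mul, eval_smul, mul_assoc]

theorem wilsonFunctional_apply {K : ℝ → ℂ} {σ a b c d : ℂ}
    (h : IsWilsonContour K σ a b c d) (p : ℂ[X]) : wilsonFunctional h p =
      ∫ t, p.eval ((K t + σ) ^ 2) * wilsonW a b c d (K t + σ) * deriv K t := rfl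

/-- The poles of the weight in the variable of the contour. -/
def wilsonPoles (σ a : ℂ) : Set ℂ := {p | ∃ k : ℕ, p = a + k - σ ∨ p = -a - k - σ}

theorem abs_im_le_of_mem_wilsonPoles {σ a p : ℂ} (h : p ∈ wilsonPoles σ a) :
    |p.im| ≤ |a.im| + |σ.im| := by
  obtain ⟨k, rfl | rfl⟩ := h
  · simpa using abs_sub a.im σ.im
  · simp only [Complex.sub_im, Complex.neg_im, Complex.natCast_im, sub_zero]
    rw [show -a.im - σ.im = -(a.im + σ.im) by ring, abs_neg]
    exact abs_add_le _ _

/-- The poles lie on finitely many horizontal lines, so one height bounds them all. -/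
theorem integral_eq_of_wilsonPoles {K₁ K₂ : ℝ → ℂ} {x₁ x₂ : ℝ} {σ a b c d : ℂ}
    (h₁ : IsVerticalContour K₁ x₁) (h₂ : IsVerticalContour K₂ x₂) {Z : Set ℂ}
    (hZ : Z ⊆ wilsonPoles σ a ∪ wilsonPoles σ b ∪ wilsonPoles σ c ∪ wilsonPoles σ d)
    (hK : ∀ p ∈ Z, p ∉ Set.range K₁ ∧ p ∉ Set.range K₂ ∧
      ∃ v, HasIndexIntegral K₁ p v ∧ HasIndexIntegral K₂ p v) {G : ℂ → ℂ}
    (hG : HasPolesIn Z G) {r : ℝ} (hr : r < 0) (hb : StripBound r G)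
    (c₁ : Continuous fun t => G (K₁ t)) (c₂ : Continuous fun t => G (K₂ t)) :
    ∫ t, G (K₁ t) * deriv K₁ t = ∫ t, G (K₂ t) * deriv K₂ t := by
  obtain ⟨T₁, e₁⟩ := h₁.eq_line
  obtain ⟨T₂, e₂⟩ := h₂.eq_line
  obtain ⟨C, T, hC⟩ := hb (min x₁ x₂) (max x₁ x₂)
  set B := |a.im| + |b.im| + |c.im| + |d.im| + |σ.im| with hB
  set T₀ := max (max T₁ T₂) (max T B) with hT₀
  have l₁ : T₁ ≤ T₀ := (le_max_left _ _).trans (le_max_left _ _)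
  have l₂ : T₂ ≤ T₀ := (le_max_right _ _).trans (le_max_left _ _)
  have l₃ : T ≤ T₀ := (le_max_left _ _).trans (le_max_right _ _)
  have l₄ : B ≤ T₀ := (le_max_right _ _).trans (le_max_right _ _)
  refine integral_contour_eq h₁.contDiff h₂.contDiff (T₀ := T₀)
    (fun t ht => e₁ t (l₁.trans ht)) (fun t ht => e₂ t (l₂.trans ht)) (Z := Z) (fun p hp => ?_) hG
    (g := fun y => C * Real.exp (r * y)) ?_ (fun z hz hz' => ?_)
    (h₁.integrable c₁ hr hb) (h₂.integrable c₂ hr hb)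
  · obtain ⟨k₁, k₂, k₃⟩ := hK p hp
    refine ⟨k₁, k₂, le_trans ?_ l₄, k₃⟩
    have := abs_nonneg a.im
    have := abs_nonneg b.im
    have := abs_nonneg c.im
    have := abs_nonneg d.im
    rcases hZ hp with ((h | h) | h) | h <;> have := abs_im_le_of_mem_wilsonPoles h <;> linarith
  · have : Tendsto (fun y : ℝ => Real.exp (r * y)) atTop (𝓝 0) :=
      Real.tendsto_exp_atBot.comp (tendsto_id.const_mul_atTop_of_neg hr)
    simpa using this.const_mul C
  · exact hC z hz.1 hz.2 (l₃.trans hz')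

theorem IsVerticalContour.sub_one {K : ℝ → ℂ} {x : ℝ} (h : IsVerticalContour K x) :
    IsVerticalContour (fun t => K t - 1) (x - 1) := by
  refine ⟨h.contDiff.sub contDiff_const, ?_⟩
  obtain ⟨T, hT⟩ := h.eq_line
  exact ⟨T, fun t ht => by rw [hT t ht]; push_cast; ring⟩

theorem HasIndexIntegral.sub_one {K : ℝ → ℂ} {p v : ℂ} (h : HasIndexIntegral K (p + 1) v) :
    HasIndexIntegral (fun t => K t - 1) p v := by
  unfold HasIndexIntegral at *
  simpa only [deriv_sub_const_fun, sub_sub, add_comm (1 : ℂ) p] using h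

/-- The product of Gamma functions whose difference is the Pearson equation of the Wilson weight. -/
noncomputable def pearsonPrimitive (a b c d : ℂ) (u : ℂ[X]) (s : ℂ) : ℂ :=
  Complex.Gamma (a + 1 + s) * Complex.Gamma (a - s) *
    (Complex.Gamma (b + 1 + s) * Complex.Gamma (b - s)) *
    (Complex.Gamma (c + 1 + s) * Complex.Gamma (c - s)) *
    (Complex.Gamma (d + 1 + s) * Complex.Gamma (d - s)) *
    (-Complex.sin (2 * Real.pi * s) / Real.pi * u.eval ((s + 1 / 2) ^ 2))

theorem stripBound_pearsonPrimitive (a b c d : ℂ) (u : ℂ[X]) :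
    StripBound (-1) (pearsonPrimitive a b c d u) := by
  have h₁ : StripBound (2 * Real.pi) fun s : ℂ => -Complex.sin (2 * Real.pi * s) / Real.pi := by
    have := (stripBound_sin.mul (StripBound.const (-(1 / Real.pi)) le_rfl)).mono
      (r' := 2 * Real.pi) (by linarith)
    convert! this using 2
    ring
  exact ((stripBound_Gamma_prod (a + 1) (b + 1) (c + 1) (d + 1) a b c d).mul
    (h₁.mul (stripBound_eval_sq u (1 / 2) one_pos))).mono (by linarith [Real.pi_lt_four])

theorem pearsonPrimitive_sub {a b c d : ℂ} {u p : ℂ[X]}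
    (hp : ∀ s : ℂ, 2 * s * p.eval (s ^ 2) =
      (a + s) * (b + s) * (c + s) * (d + s) * u.eval ((s + 1 / 2) ^ 2) -
        (a - s) * (b - s) * (c - s) * (d - s) * u.eval ((s - 1 / 2) ^ 2)) {s : ℂ}
    (a₁ : a + s ≠ 0) (b₁ : b + s ≠ 0) (c₁ : c + s ≠ 0) (d₁ : d + s ≠ 0)
    (a₂ : a - s ≠ 0) (b₂ : b - s ≠ 0) (c₂ : c - s ≠ 0) (d₂ : d - s ≠ 0) :
    pearsonPrimitive a b c d u s - pearsonPrimitive a b c d u (s - 1) =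
      p.eval (s ^ 2) * wilsonW a b c d s := by
  have e : ∀ {w : ℂ}, w + s ≠ 0 → Complex.Gamma (w + 1 + s) = (w + s) * Complex.Gamma (w + s) :=
    fun {w} h => by rw [← Complex.Gamma_add_one _ h]; congr 1; ring
  have e' : ∀ {w : ℂ}, w - s ≠ 0 → Complex.Gamma (w - (s - 1)) = (w - s) * Complex.Gamma (w - s) :=
    fun {w} h => by rw [← Complex.Gamma_add_one _ h]; congr 1; ring
  have e'' : ∀ w : ℂ, w + 1 + (s - 1) = w + s := fun w => by ring
  have hsin : Complex.sin (2 * Real.pi * (s - 1)) = Complex.sin (2 * Real.pi * s) := by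
    rw [mul_sub, mul_one, Complex.sin_sub_two_pi]
  rw [pearsonPrimitive, pearsonPrimitive, wilsonW, e a₁, e b₁, e c₁, e d₁, e' a₂, e' b₂, e' c₂,
    e' d₂, e'', e'', e'', e'', hsin, show s - 1 + 1 / 2 = s - 1 / 2 by ring]
  linear_combination (Complex.Gamma (a + s) * Complex.Gamma (a - s) *
    (Complex.Gamma (b + s) * Complex.Gamma (b - s)) *
    (Complex.Gamma (c + s) * Complex.Gamma (c - s)) *
    (Complex.Gamma (d + s) * Complex.Gamma (d - s)) *
    (Complex.sin (2 * Real.pi * s) / Real.pi)) * hp s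

/-- The integrand is g(z) - g(z-1), with g the shifted `pearsonPrimitive`, so its integral is the
difference of the integrals of g over K and K - 1, which agree. -/
theorem wilsonFunctional_isPearson {K : ℝ → ℂ} {σ a b c d : ℂ}
    (h : IsWilsonContour K σ a b c d) : IsPearson (wilsonFunctional h) a b c d := by
  intro u p hp
  obtain ⟨x, hx⟩ := h.vertical
  have hK := h.continuous
  set g : ℂ → ℂ := fun z => pearsonPrimitive a b c d u (z + σ) with hg
  have gb : StripBound (-1) g := by
    simpa [hg, add_comm] using (stripBound_pearsonPrimitive a b c d u).comp_add σ
  have hu : ∀ w : ℂ, Continuous fun t => u.eval ((K t + σ + w) ^ 2) := fun w =>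
    u.continuous.comp (by fun_prop)
  have hsin : ∀ w : ℂ, Continuous fun t => Complex.sin (2 * Real.pi * (K t + σ + w)) := fun w =>
    Complex.continuous_sin.comp (by fun_prop)
  have g₁ : Continuous fun t => g (K t) := by
    have e : ∀ {w}, Separates K σ w → Continuous fun t =>
        Complex.Gamma (w + 1 + (K t + σ)) * Complex.Gamma (w - (K t + σ)) := fun {w} hw => by
      have := (hw.add_nat 1).continuous_add hK
      rw [Nat.cast_one] at this
      exact this.mul (hw.continuous_sub hK)
    have hs0 := hsin 0
    simp only [add_zero] at hs0
    exact ((((e h.fst).mul (e h.snd)).mul (e h.trd)).mul (e h.fth)).mul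
      ((hs0.neg.div_const _).mul (hu (1 / 2)))
  have g₂ : Continuous fun t => g (K t - 1) := by
    have e : ∀ {w}, Separates K σ w → Continuous fun t =>
        Complex.Gamma (w + 1 + (K t - 1 + σ)) * Complex.Gamma (w - (K t - 1 + σ)) :=
        fun {w} hw => by
      have h₁ := hw.continuous_add hK
      have h₂ := (hw.add_nat 1).continuous_sub hK
      rw [Nat.cast_one] at h₂
      refine (h₁.mul h₂).congr fun t => ?_
      rw [show w + 1 + (K t - 1 + σ) = w + (K t + σ) by ring,
        show w - (K t - 1 + σ) = w + 1 - (K t + σ) by ring]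
      rfl
    have hs1 : Continuous fun t => Complex.sin (2 * Real.pi * (K t - 1 + σ)) :=
      Complex.continuous_sin.comp (by fun_prop)
    have hu1 : Continuous fun t => u.eval ((K t - 1 + σ + 1 / 2) ^ 2) :=
      u.continuous.comp (by fun_prop)
    exact ((((e h.fst).mul (e h.snd)).mul (e h.trd)).mul (e h.fth)).mul
      ((hs1.neg.div_const _).mul hu1)
  -- The decreasing poles of g start one step further left than those of the weight. Hence p and p +
  -- 1 are always on the same side of K, so K and K - 1 have equal index at p.
  set Y : ℂ → Set ℂ := fun w => {p | ∃ k : ℕ, p = w + k - σ ∨ p = -(w + 1) - k - σ} with hY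
  have hYp : ∀ w, Y w ⊆ wilsonPoles σ w := by
    rintro w p ⟨k, rfl | rfl⟩
    · exact ⟨k, Or.inl rfl⟩
    · exact ⟨k + 1, Or.inr (by push_cast; ring)⟩
  have hYK : ∀ {w}, Separates K σ w → ∀ p ∈ Y w, p ∉ Set.range K ∧
      p ∉ Set.range (fun t => K t - 1) ∧ ∃ v, HasIndexIntegral K p v ∧
        HasIndexIntegral (fun t => K t - 1) p v := by
    rintro w hw p ⟨k, rfl | rfl⟩
    · have k₁ := (hw k).1
      have k₂ := (hw (k + 1)).1
      rw [show w + ((k + 1 : ℕ) : ℂ) - σ = w + k - σ + 1 by push_cast; ring] at k₂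
      exact ⟨k₁.1, fun ⟨t, ht⟩ => k₂.1 ⟨t, by linear_combination ht⟩, _, k₁.2, k₂.2.sub_one⟩
    · have k₁ := (hw (k + 1)).2
      have k₂ := (hw k).2
      rw [show -w - ((k + 1 : ℕ) : ℂ) - σ = -(w + 1) - k - σ by push_cast; ring] at k₁
      rw [show -w - (k : ℂ) - σ = -(w + 1) - k - σ + 1 by ring] at k₂
      exact ⟨k₁.1, fun ⟨t, ht⟩ => k₂.1 ⟨t, by linear_combination ht⟩, _, k₁.2, k₂.2.sub_one⟩
  have hpoles : HasPolesIn (Y a ∪ Y b ∪ Y c ∪ Y d) g := by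
    have e : ∀ {w}, Y w ⊆ Y a ∪ Y b ∪ Y c ∪ Y d → HasPolesIn (Y a ∪ Y b ∪ Y c ∪ Y d) fun z =>
        Complex.Gamma (w + 1 + (z + σ)) * Complex.Gamma (w - (z + σ)) := fun {w} hw => by
      have h₁ := hasPolesIn_Gamma_add (Z := Y a ∪ Y b ∪ Y c ∪ Y d) (w + 1 + σ) fun k =>
        hw ⟨k, Or.inr (by ring)⟩
      have h₂ := hasPolesIn_Gamma_sub (Z := Y a ∪ Y b ∪ Y c ∪ Y d) (w - σ) fun k =>
        hw ⟨k, Or.inl (by ring)⟩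
      have h₃ := h₁.mul h₂
      simp only [sub_sub, add_assoc, add_comm σ] at h₃ ⊢
      exact h₃
    refine ((((e ?_).mul (e ?_)).mul (e ?_)).mul (e ?_)).mul (HasPolesIn.of_differentiable ?_)
    · exact fun z hz => Or.inl (Or.inl (Or.inl hz))
    · exact fun z hz => Or.inl (Or.inl (Or.inr hz))
    · exact fun z hz => Or.inl (Or.inr hz)
    · exact fun z hz => Or.inr hz
    · have hd : Differentiable ℂ fun z => u.eval ((z + σ + 1 / 2) ^ 2) :=
        u.differentiable.comp (by fun_prop)
      have hs : Differentiable ℂ fun z => Complex.sin (2 * Real.pi * (z + σ)) :=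
        Complex.differentiable_sin.comp (by fun_prop)
      exact (hs.neg.div_const _).mul hd
  have key := integral_eq_of_wilsonPoles hx hx.sub_one (a := a) (b := b) (c := c) (d := d)
    (Set.union_subset_union (Set.union_subset_union (Set.union_subset_union (hYp a) (hYp b))
      (hYp c)) (hYp d)) (fun p hp => by
        rcases hp with ((hp | hp) | hp) | hp
        exacts [hYK h.fst p hp, hYK h.snd p hp, hYK h.trd p hp, hYK h.fth p hp])
    hpoles (r := -1) (by norm_num) gb g₁ g₂
  have i₁ := hx.integrable g₁ (by norm_num) gb
  have i₂ := hx.sub_one.integrable g₂ (by norm_num) gb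
  simp only [deriv_sub_const_fun] at key i₂
  rw [wilsonFunctional_apply, ← sub_eq_zero.2 key, ← integral_sub i₁ i₂]
  refine integral_congr_ae (Eventually.of_forall fun t => ?_)
  beta_reduce
  have n₁ : ∀ {w}, Separates K σ w → w + (K t + σ) ≠ 0 := fun hw => by
    simpa using hw.add_ne t 0
  have n₂ : ∀ {w}, Separates K σ w → w - (K t + σ) ≠ 0 := fun hw => by
    simpa using hw.sub_ne t 0
  rw [← sub_mul, ← pearsonPrimitive_sub hp (n₁ h.fst) (n₁ h.snd) (n₁ h.trd) (n₁ h.fth) (n₂ h.fst)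
    (n₂ h.snd) (n₂ h.trd) (n₂ h.fth)]
  simp only [hg]
  rw [show K t - 1 + σ = K t + σ - 1 by ring]

/-! ### Vertical lines -/

/-- Dividing both arguments by T cancels log T and leaves log i - log(-i) in the limit. -/
theorem tendsto_log_sub_log {q : ℂ} (hq : 0 < q.re) :
    Tendsto (fun T : ℝ => Complex.log (q + T * Complex.I) - Complex.log (q - T * Complex.I)) atTop
      (𝓝 (Real.pi * Complex.I)) := by
  have h₀ : Tendsto (fun T : ℝ => q / T) atTop (𝓝 0) := by
    have := (Complex.continuous_ofReal.tendsto 0).comp tendsto_inv_atTop_zero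
    simpa [div_eq_mul_inv] using this.const_mul q
  have h : ∀ w : ℂ, w ∈ Complex.slitPlane →
      Tendsto (fun T : ℝ => Complex.log (q / T + w)) atTop (𝓝 (Complex.log w)) := fun w hw => by
    have h₁ := h₀.add_const w
    rw [zero_add] at h₁
    exact (continuousAt_clog hw).tendsto.comp h₁
  have h₁ := (h Complex.I (by simp [Complex.slitPlane])).sub
    (h (-Complex.I) (by simp [Complex.slitPlane]))
  rw [Complex.log_I, Complex.log_neg_I,
    show (Real.pi / 2 * Complex.I - -(Real.pi / 2) * Complex.I : ℂ) = Real.pi * Complex.I by ring]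
    at h₁
  refine h₁.congr' ?_
  filter_upwards [eventually_gt_atTop 0] with T hT
  have hT' : (T : ℂ) ≠ 0 := by exact_mod_cast hT.ne'
  have e : ∀ w : ℂ, w.re = 0 → Complex.log (q + T * w) =
      Real.log T + Complex.log (q / T + w) := fun w hw => by
    rw [← Complex.log_ofReal_mul hT]
    · congr 1
      field_simp
    · intro h
      have := congrArg Complex.re h
      rw [Complex.add_re, hw, add_zero, Complex.div_ofReal_re, Complex.zero_re] at this
      exact (div_pos hq hT).ne' this
  rw [e _ Complex.I_re, show q - T * Complex.I = q + T * (-Complex.I) by ring,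
    e (-Complex.I) (by simp)]
  ring

theorem hasDerivAt_line (x t : ℝ) :
    HasDerivAt (fun t : ℝ => (x + t * Complex.I : ℂ)) Complex.I t := by
  simpa using ((Complex.ofRealCLM.hasDerivAt (x := t)).mul_const Complex.I).const_add (x : ℂ)

theorem isVerticalContour_line (x : ℝ) :
    IsVerticalContour (fun t : ℝ => (x + t * Complex.I : ℂ)) x :=
  ⟨contDiff_const.add (Complex.ofRealCLM.contDiff.mul contDiff_const), 0, fun _ _ => rfl⟩

theorem hasIndexIntegral_line_of_lt {x : ℝ} {p : ℂ} (hp : p.re < x) :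
    HasIndexIntegral (fun t : ℝ => (x + t * Complex.I : ℂ)) p (Real.pi * Complex.I) := by
  have hq : 0 < (x - p : ℂ).re := by simpa using hp
  refine (tendsto_log_sub_log hq).congr fun T => ?_
  have hd : ∀ t : ℝ, HasDerivAt (fun t : ℝ => Complex.log (x - p + t * Complex.I))
      (deriv (fun t : ℝ => (x + t * Complex.I : ℂ)) t / (x + t * Complex.I - p)) t := fun t => by
    have hs : (x + t * Complex.I - p : ℂ) ∈ Complex.slitPlane := Or.inl (by simpa using hp)
    rw [(hasDerivAt_line x t).deriv]
    have := ((hasDerivAt_line x t).sub_const p).clog_real hs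
    simpa only [add_sub_right_comm] using this
  symm
  convert! intervalIntegral.integral_eq_sub_of_hasDerivAt (fun t _ => hd t) ?_ using 2
  · push_cast; ring_nf
  · simp only [(hasDerivAt_line x _).deriv]
    refine (Continuous.div continuous_const (by fun_prop) fun t h => ?_).intervalIntegrable _ _
    have := congrArg Complex.re h
    simp at this
    linarith

theorem hasIndexIntegral_line_of_gt {x : ℝ} {p : ℂ} (hp : x < p.re) :
    HasIndexIntegral (fun t : ℝ => (x + t * Complex.I : ℂ)) p (-(Real.pi * Complex.I)) := by
  have h := (hasIndexIntegral_line_of_lt (x := -x) (p := -p) (by simpa using hp)).neg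
  refine h.congr fun T => ?_
  have e := intervalIntegral.integral_comp_neg (a := -T) (b := T) fun t : ℝ =>
    deriv (fun t : ℝ => (x + t * Complex.I : ℂ)) t / (x + t * Complex.I - p)
  rw [neg_neg] at e
  rw [← e, ← intervalIntegral.integral_neg]
  refine intervalIntegral.integral_congr fun t _ => ?_
  simp only [(hasDerivAt_line _ _).deriv]
  rw [← div_neg]
  congr 1
  push_cast
  ring

theorem separates_line {σ a : ℂ} (ha : 0 < a.re) :
    Separates (fun t : ℝ => ((-σ.re : ℝ) + t * Complex.I : ℂ)) σ a := by
  intro k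
  have hk : (0 : ℝ) ≤ k := k.cast_nonneg
  have e₁ : (-σ.re : ℝ) < (a + k - σ).re := by simp; linarith
  have e₂ : (-a - k - σ).re < (-σ.re : ℝ) := by simp; linarith
  refine ⟨⟨?_, hasIndexIntegral_line_of_gt e₁⟩, ?_, hasIndexIntegral_line_of_lt e₂⟩
  · rintro ⟨t, ht⟩
    rw [← ht] at e₁
    simp at e₁
  · rintro ⟨t, ht⟩
    rw [← ht] at e₂
    simp at e₂

theorem isWilsonContour_line {σ a b c d : ℂ} (ha : 0 < a.re) (hb : 0 < b.re) (hc : 0 < c.re)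
    (hd : 0 < d.re) :
    IsWilsonContour (fun t : ℝ => ((-σ.re : ℝ) + t * Complex.I : ℂ)) σ a b c d :=
  ⟨⟨_, isVerticalContour_line _⟩, separates_line ha, separates_line hb, separates_line hc,
    separates_line hd⟩

/-- The integral of the Wilson weight along the imaginary axis. -/
noncomputable def axisInt (a b c d : ℂ) : ℂ := ∫ t : ℝ, wilsonW a b c d (t * Complex.I)

theorem wilsonFunctional_line {σ a b c d : ℂ}
    (h : IsWilsonContour (fun t : ℝ => ((-σ.re : ℝ) + t * Complex.I : ℂ)) σ a b c d) :
    wilsonFunctional h 1 = axisInt a b c d * Complex.I := by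
  rw [wilsonFunctional_apply, axisInt, ← integral_mul_const,
    ← integral_add_right_eq_self (fun t : ℝ => wilsonW a b c d (t * Complex.I) * Complex.I) σ.im]
  refine integral_congr_ae (Eventually.of_forall fun t => ?_)
  simp only [(hasDerivAt_line _ _).deriv, eval_one, one_mul]
  congr 2
  apply Complex.ext <;> simp

theorem wilsonFunctional_eq_axisInt {K : ℝ → ℂ} {σ a b c d : ℂ} (h : IsWilsonContour K σ a b c d)
    (ha : 0 < a.re) (hb : 0 < b.re) (hc : 0 < c.re) (hd : 0 < d.re) :
    wilsonFunctional h 1 = axisInt a b c d * Complex.I := by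
  have h₀ := isWilsonContour_line (σ := σ) ha hb hc hd
  rw [← wilsonFunctional_line h₀, wilsonFunctional_apply, wilsonFunctional_apply]
  simp only [eval_one, one_mul]
  obtain ⟨x, hx⟩ := h.vertical
  have hsep : ∀ {w : ℂ}, Separates K σ w → 0 < w.re → ∀ p ∈ wilsonPoles σ w,
      p ∉ Set.range K ∧ p ∉ Set.range (fun t : ℝ => ((-σ.re : ℝ) + t * Complex.I : ℂ)) ∧
        ∃ v, HasIndexIntegral K p v ∧
          HasIndexIntegral (fun t : ℝ => ((-σ.re : ℝ) + t * Complex.I : ℂ)) p v := by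
    rintro w hw hw0 p ⟨k, rfl | rfl⟩
    · have h₁ := (hw k).1
      have h₂ := (separates_line (σ := σ) hw0 k).1
      exact ⟨h₁.1, h₂.1, _, h₁.2, h₂.2⟩
    · have h₁ := (hw k).2
      have h₂ := (separates_line (σ := σ) hw0 k).2
      exact ⟨h₁.1, h₂.1, _, h₁.2, h₂.2⟩
  refine integral_eq_of_wilsonPoles hx (isVerticalContour_line _) (a := a) (b := b) (c := c) (d := d)
    (σ := σ) subset_rfl ?_ (G := fun z => wilsonW a b c d (z + σ)) ?_ (r := -1) (by norm_num) ?_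
    h.continuous_wilsonW h₀.continuous_wilsonW
  · rintro p (((hp | hp) | hp) | hp)
    exacts [hsep h.fst ha p hp, hsep h.snd hb p hp, hsep h.trd hc p hp, hsep h.fth hd p hp]
  · have e : ∀ {w}, wilsonPoles σ w ⊆
        wilsonPoles σ a ∪ wilsonPoles σ b ∪ wilsonPoles σ c ∪ wilsonPoles σ d →
        HasPolesIn (wilsonPoles σ a ∪ wilsonPoles σ b ∪ wilsonPoles σ c ∪ wilsonPoles σ d) fun z =>
          Complex.Gamma (w + (z + σ)) * Complex.Gamma (w - (z + σ)) := fun {w} hw => by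
      have h₁ := hasPolesIn_Gamma_add (Z := _) (w + σ) fun k =>
        hw ⟨k, Or.inr (by ring)⟩
      have h₂ := hasPolesIn_Gamma_sub (Z := _) (w - σ) fun k =>
        hw ⟨k, Or.inl (by ring)⟩
      have h₃ := h₁.mul h₂
      simp only [sub_sub, add_assoc, add_comm σ] at h₃ ⊢
      exact h₃
    refine ((((e ?_).mul (e ?_)).mul (e ?_)).mul (e ?_)).mul (HasPolesIn.of_differentiable ?_)
    · exact fun z hz => Or.inl (Or.inl (Or.inl hz))
    · exact fun z hz => Or.inl (Or.inl (Or.inr hz))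
    · exact fun z hz => Or.inl (Or.inr hz)
    · exact fun z hz => Or.inr hz
    · have hs : Differentiable ℂ fun z => Complex.sin (2 * Real.pi * (z + σ)) :=
        Complex.differentiable_sin.comp (by fun_prop)
      fun_prop
  · have := (stripBound_wilsonW 1 a b c d).comp_add σ
    simpa [add_comm] using this

/-! ### Shifts of the parameters -/

namespace IsWilsonContour

variable {K : ℝ → ℂ} {σ a b c d : ℂ}

theorem add_nat (h : IsWilsonContour K σ a b c d) (n : ℕ) : IsWilsonContour K σ (a + n) b c d :=
  ⟨h.vertical, h.fst.add_nat n, h.snd, h.trd, h.fth⟩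

theorem rotate (h : IsWilsonContour K σ a b c d) : IsWilsonContour K σ b c d a :=
  ⟨h.vertical, h.snd, h.trd, h.fth, h.fst⟩

end IsWilsonContour

theorem wilsonW_rotate (a b c d s : ℂ) : wilsonW b c d a s = wilsonW a b c d s := by
  rw [wilsonW, wilsonW]; ring

theorem axisInt_rotate (a b c d : ℂ) : axisInt b c d a = axisInt a b c d := by
  simp only [axisInt, wilsonW_rotate a]

theorem wilsonFunctional_rotate {K : ℝ → ℂ} {σ a b c d : ℂ} (h : IsWilsonContour K σ a b c d) :
    wilsonFunctional h.rotate = wilsonFunctional h := by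
  refine LinearMap.ext fun p => ?_
  simp only [wilsonFunctional_apply, wilsonW_rotate a]

/-- Multiplying the weight by (a-s)_n (a+s)_n raises a to a + n, so the total mass for the raised
parameter is a moment for the original one. -/
theorem wilsonFunctional_add_nat {K : ℝ → ℂ} {σ a b c d : ℂ} (h : IsWilsonContour K σ a b c d)
    (n : ℕ) : poch (a + b + c + d) n * wilsonFunctional (h.add_nat n) 1 =
      poch (a + b) n * poch (a + c) n * poch (a + d) n * wilsonFunctional h 1 := by
  rw [← (wilsonFunctional_isPearson h).moment n]
  congr 1
  simp only [wilsonFunctional_apply]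
  refine integral_congr_ae (Eventually.of_forall fun t => ?_)
  have h₁ := Gamma_add_nat (a + (K t + σ)) n fun j _ e => h.fst.add_ne t j (by linear_combination e)
  have h₂ := Gamma_add_nat (a - (K t + σ)) n fun j _ e => h.fst.sub_ne t j (by linear_combination e)
  simp only [eval_one, one_mul, phi_eval_sq]
  rw [wilsonW, wilsonW, add_right_comm a, h₁, add_sub_right_comm, h₂]
  ring

theorem wilsonFunctional_add_nat_eq_zero {K : ℝ → ℂ} {σ a b c d : ℂ}
    (h : IsWilsonContour K σ a b c d) (hS : ∀ j : ℕ, a + b + c + d + j ≠ 0)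
    (h₀ : wilsonFunctional h 1 = 0) (n : ℕ) : wilsonFunctional (h.add_nat n) 1 = 0 := by
  have := wilsonFunctional_add_nat h n
  rw [h₀, mul_zero] at this
  exact (mul_eq_zero.1 this).resolve_left (poch_ne_zero hS n)

/-! ### The limit of a large parameter -/

/-- Euler's product in disguise: it makes the large-parameter limit of the normalized Gamma factor
equal to 1. -/
theorem Gamma_div_eq {s : ℂ} (hs : 0 < s.re) (n : ℕ) :
    Complex.Gamma (s + (n + 1 : ℕ)) / ((n : ℂ) ^ s * (n.factorial : ℂ)) =
      Complex.Gamma s / Complex.GammaSeq s n := by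
  have h := Gamma_add_nat s (n + 1) fun j _ e => by
    have := congrArg Complex.re e
    have hj : (0 : ℝ) ≤ j := j.cast_nonneg
    simp at this
    linarith
  rw [h, Complex.GammaSeq, ← poch_eq_prod, div_div_eq_mul_div, mul_comm]

theorem tendsto_Gamma_div {s : ℂ} (hs : 0 < s.re) :
    Tendsto (fun n : ℕ => Complex.Gamma (s + (n + 1 : ℕ)) / ((n : ℂ) ^ s * (n.factorial : ℂ))) atTop
      (𝓝 1) := by
  have hne := Complex.Gamma_ne_zero_of_re_pos hs
  simp only [Gamma_div_eq hs]
  have := (tendsto_const_nhds (x := Complex.Gamma s)).div (Complex.GammaSeq_tendsto_Gamma s) hne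
  rwa [div_self hne] at this

theorem norm_Gamma_div_le {s : ℂ} (hs : 0 < s.re) {n : ℕ} (hn : 0 < n) :
    ‖Complex.Gamma (s + (n + 1 : ℕ)) / ((n : ℂ) ^ s * (n.factorial : ℂ))‖ ≤
      ‖Complex.Gamma (s.re + (n + 1 : ℕ)) / ((n : ℂ) ^ (s.re : ℂ) * (n.factorial : ℂ))‖ := by
  rw [norm_div, norm_div, norm_mul, norm_mul, Complex.norm_natCast_cpow_of_pos hn,
    Complex.norm_natCast_cpow_of_pos hn, Complex.ofReal_re]
  refine div_le_div_of_nonneg_right ?_ (by positivity)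
  have h₀ : 0 < (s + (n + 1 : ℕ)).re := by
    rw [Complex.add_re, Complex.natCast_re]; positivity
  refine (norm_Gamma_le h₀).trans ?_
  rw [show (s.re + (n + 1 : ℕ) : ℂ) = ((s + (n + 1 : ℕ)).re : ℝ) by simp, Complex.Gamma_ofReal,
    Complex.norm_real]
  exact le_abs_self _

/-- The Wilson weight without its first parameter. -/
noncomputable def wilsonW₃ (b c d s : ℂ) : ℂ :=
  Complex.Gamma (b + s) * Complex.Gamma (b - s) * (Complex.Gamma (c + s) * Complex.Gamma (c - s)) *
      (Complex.Gamma (d + s) * Complex.Gamma (d - s)) *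
        (-(2 * s * Complex.sin (2 * Real.pi * s)) / Real.pi)

theorem wilsonW_eq_mul (a b c d s : ℂ) :
    wilsonW a b c d s = Complex.Gamma (a + s) * Complex.Gamma (a - s) * wilsonW₃ b c d s := by
  rw [wilsonW, wilsonW₃]; ring

theorem integrable_wilsonW₃ {b c d : ℂ} (hb : 0 < b.re) (hc : 0 < c.re) (hd : 0 < d.re) :
    Integrable fun t : ℝ => wilsonW₃ b c d (t * Complex.I) := by
  have h := fun u => (stripBound_Gamma_add u).mul (stripBound_Gamma_sub u)
  have hbound : StripBound (-(1 / 2)) (wilsonW₃ b c d) :=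
    ((((h b).mul (h c)).mul (h d)).mul stripBound_sin_factor).mono (by linarith [Real.pi_lt_d2])
  have hK : Continuous fun t : ℝ => (t * Complex.I : ℂ) := by fun_prop
  have e : ∀ {w : ℂ}, 0 < w.re → Continuous fun t : ℝ =>
      Complex.Gamma (w + t * Complex.I) * Complex.Gamma (w - t * Complex.I) := fun {w} hw => by
    have hs := separates_line (σ := 0) hw
    have h₁ := hs.continuous_add (by fun_prop)
    have h₂ := hs.continuous_sub (by fun_prop)
    simp only [Complex.zero_re, neg_zero, Complex.ofReal_zero, zero_add, add_zero] at h₁ h₂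
    exact h₁.mul h₂
  have hs : Continuous fun t : ℝ => Complex.sin (2 * Real.pi * (t * Complex.I)) :=
    Complex.continuous_sin.comp (by fun_prop)
  have hcont : Continuous fun t : ℝ => wilsonW₃ b c d (t * Complex.I) := by
    have := e hb
    have := e hc
    have := e hd
    unfold wilsonW₃
    fun_prop
  have := (isVerticalContour_line 0).integrable (f := wilsonW₃ b c d) (by simpa using hcont)
    (by norm_num) hbound
  simp only [(hasDerivAt_line _ _).deriv] at this
  simp only [Complex.ofReal_zero, zero_add] at this
  simpa [mul_assoc] using this.mul_const (-Complex.I)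

theorem continuous_wilsonW_axis {a b c d : ℂ} (ha : 0 < a.re) (hb : 0 < b.re) (hc : 0 < c.re)
    (hd : 0 < d.re) : Continuous fun t : ℝ => wilsonW a b c d (t * Complex.I) := by
  simpa using (isWilsonContour_line (σ := 0) ha hb hc hd).continuous_wilsonW

theorem tendsto_axisInt {a b c d : ℂ} (ha : 0 < a.re) (hb : 0 < b.re) (hc : 0 < c.re)
    (hd : 0 < d.re) :
    Tendsto (fun n : ℕ => axisInt (a + (n + 1 : ℕ)) b c d /
      ((n : ℂ) ^ (2 * a) * (n.factorial : ℂ) ^ 2)) atTop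
      (𝓝 (∫ t : ℝ, wilsonW₃ b c d (t * Complex.I))) := by
  simp only [axisInt, ← integral_div]
  have hre : ∀ t : ℝ, (a + t * Complex.I).re = a.re ∧ (a - t * Complex.I).re = a.re := fun t => by
    simp
  have key : ∀ {n : ℕ}, 0 < n → ∀ t : ℝ, wilsonW (a + (n + 1 : ℕ)) b c d (t * Complex.I) /
      ((n : ℂ) ^ (2 * a) * (n.factorial : ℂ) ^ 2) =
      Complex.Gamma (a + t * Complex.I + (n + 1 : ℕ)) /
          ((n : ℂ) ^ (a + t * Complex.I) * (n.factorial : ℂ)) *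
        (Complex.Gamma (a - t * Complex.I + (n + 1 : ℕ)) /
          ((n : ℂ) ^ (a - t * Complex.I) * (n.factorial : ℂ))) *
        wilsonW₃ b c d (t * Complex.I) := by
    intro n hn t
    rw [wilsonW_eq_mul, add_right_comm, add_sub_right_comm,
      show 2 * a = (a + t * Complex.I) + (a - t * Complex.I) by ring,
      Complex.cpow_add _ _ (Nat.cast_ne_zero.2 hn.ne')]
    simp only [div_eq_mul_inv, mul_inv]
    ring
  -- Each of the two normalized Gamma factors is bounded by its value at t = 0 with a replaced by Re
  -- a, which is eventually at most 2; hence the constant 4.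
  refine tendsto_integral_filter_of_dominated_convergence
    (fun t => 4 * ‖wilsonW₃ b c d (t * Complex.I)‖) (Eventually.of_forall fun n => ?_) ?_
    ((integrable_wilsonW₃ hb hc hd).norm.const_mul 4) (Eventually.of_forall fun t => ?_)
  · refine ((continuous_wilsonW_axis ?_ hb hc hd).div_const _).aestronglyMeasurable
    rw [Complex.add_re, Complex.natCast_re]
    positivity
  · have h := (tendsto_Gamma_div (s := (a.re : ℂ)) (by simpa using ha)).norm
    rw [norm_one] at h
    filter_upwards [eventually_gt_atTop 0, h.eventually (ge_mem_nhds one_lt_two)] with n hn hn2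
    refine Eventually.of_forall fun t => ?_
    rw [key hn, norm_mul, norm_mul]
    have h₁ := norm_Gamma_div_le (s := a + t * Complex.I) (by rw [(hre t).1]; exact ha) hn
    have h₂ := norm_Gamma_div_le (s := a - t * Complex.I) (by rw [(hre t).2]; exact ha) hn
    rw [(hre t).1] at h₁
    rw [(hre t).2] at h₂
    refine mul_le_mul_of_nonneg_right ?_ (norm_nonneg _)
    calc _ ≤ (2 : ℝ) * 2 := mul_le_mul (h₁.trans hn2) (h₂.trans hn2) (norm_nonneg _) two_pos.le
      _ = 4 := by norm_num
  · have h₁ := tendsto_Gamma_div (s := a + t * Complex.I) (by rw [(hre t).1]; exact ha)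
    have h₂ := tendsto_Gamma_div (s := a - t * Complex.I) (by rw [(hre t).2]; exact ha)
    have h₃ := (h₁.mul h₂).mul_const (wilsonW₃ b c d (t * Complex.I))
    rw [one_mul, one_mul] at h₃
    refine h₃.congr' ?_
    filter_upwards [eventually_gt_atTop 0] with n hn
    exact (key hn t).symm

/-- The shift relation gives a second evaluation of the limit of large a. The left side does not
involve a, which fixes the dependence of the Wilson integral on a. -/
theorem integral_wilsonW₃_eq {a b c d : ℂ} (ha : 0 < a.re) (hb : 0 < b.re) (hc : 0 < c.re)
    (hd : 0 < d.re) :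
    ∫ t : ℝ, wilsonW₃ b c d (t * Complex.I) = Complex.Gamma (a + b + c + d) /
      (Complex.Gamma (a + b) * Complex.Gamma (a + c) * Complex.Gamma (a + d)) *
        axisInt a b c d := by
  have pos : ∀ {u v : ℂ}, 0 < u.re → 0 < v.re → 0 < (u + v).re := fun hu hv => by
    rw [Complex.add_re]; exact add_pos hu hv
  have hab := pos ha hb
  have hac := pos ha hc
  have had := pos ha hd
  have hS := pos (pos hab hc) hd
  refine tendsto_nhds_unique (tendsto_axisInt ha hb hc hd) ?_
  have hlim := ((Complex.GammaSeq_tendsto_Gamma (a + b + c + d)).div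
    (((Complex.GammaSeq_tendsto_Gamma (a + b)).mul (Complex.GammaSeq_tendsto_Gamma (a + c))).mul
      (Complex.GammaSeq_tendsto_Gamma (a + d)))
    (mul_ne_zero (mul_ne_zero (Complex.Gamma_ne_zero_of_re_pos hab)
      (Complex.Gamma_ne_zero_of_re_pos hac)) (Complex.Gamma_ne_zero_of_re_pos had))).mul_const
    (axisInt a b c d)
  refine hlim.congr' ?_
  filter_upwards [eventually_gt_atTop 0] with n hn
  have hn' : (n : ℂ) ≠ 0 := Nat.cast_ne_zero.2 hn.ne'
  have hpo : ∀ {w : ℂ}, 0 < w.re → poch w (n + 1) ≠ 0 := fun {w} hw => poch_ne_zero (fun j e => by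
    have := congrArg Complex.re e
    have hj : (0 : ℝ) ≤ j := j.cast_nonneg
    simp at this
    linarith) _
  have h₀ := isWilsonContour_line (σ := 0) ha hb hc hd
  have h := wilsonFunctional_add_nat h₀ (n + 1)
  rw [wilsonFunctional_line, wilsonFunctional_line, ← mul_assoc, ← mul_assoc] at h
  have h' := mul_right_cancel₀ Complex.I_ne_zero h
  have q₁ := hpo hab
  have q₂ := hpo hac
  have q₃ := hpo had
  have q₄ := hpo hS
  have hf : (n.factorial : ℂ) ≠ 0 := Nat.cast_ne_zero.2 n.factorial_ne_zero
  have hc₁ : ∀ w : ℂ, (n : ℂ) ^ w ≠ 0 := fun w => by simp [Complex.cpow_eq_zero_iff, hn']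
  -- The powers of n from the four Gamma sequences cancel the normalization of `tendsto_axisInt`.
  have hpow : (n : ℂ) ^ (a + b + c + d) * (n : ℂ) ^ (2 * a) =
      (n : ℂ) ^ (a + b) * (n : ℂ) ^ (a + c) * (n : ℂ) ^ (a + d) := by
    simp only [← Complex.cpow_add _ _ hn']
    congr 1
    ring
  rw [eq_div_iff (mul_ne_zero (hc₁ _) (pow_ne_zero 2 hf)), ← mul_right_inj' q₄, h']
  simp only [Complex.GammaSeq, ← poch_eq_prod, Pi.div_apply]
  have k₁ := hc₁ (a + b)
  have k₂ := hc₁ (a + c)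
  have k₃ := hc₁ (a + d)
  generalize (n : ℂ) ^ (a + b) = A₁ at *
  generalize (n : ℂ) ^ (a + c) = A₂ at *
  generalize (n : ℂ) ^ (a + d) = A₃ at *
  generalize (n : ℂ) ^ (a + b + c + d) = A₄ at *
  generalize (n : ℂ) ^ (2 * a) = A₅ at *
  field_simp
  linear_combination axisInt a b c d * hpow

theorem axisInt_one_eq_zero {a b c d : ℂ} (ha : 0 < a.re) (hb : 0 < b.re) (hc : 0 < c.re)
    (hd : 0 < d.re) (h : axisInt a b c d = 0) : axisInt 1 b c d = 0 := by
  have h₁ := integral_wilsonW₃_eq ha hb hc hd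
  have o : 0 < (1 : ℂ).re := by simp
  rw [h, mul_zero, integral_wilsonW₃_eq o hb hc hd] at h₁
  have pos : ∀ {u v : ℂ}, 0 < u.re → 0 < v.re → 0 < (u + v).re := fun hu hv => by
    rw [Complex.add_re]; exact add_pos hu hv
  exact (mul_eq_zero.1 h₁).resolve_left (div_ne_zero
    (Complex.Gamma_ne_zero_of_re_pos (pos (pos (pos o hb) hc) hd))
    (mul_ne_zero (mul_ne_zero (Complex.Gamma_ne_zero_of_re_pos (pos o hb))
      (Complex.Gamma_ne_zero_of_re_pos (pos o hc))) (Complex.Gamma_ne_zero_of_re_pos (pos o hd))))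

theorem wilsonW_one (t : ℝ) : wilsonW 1 1 1 1 (t * Complex.I) =
    ((‖Complex.Gamma (1 + t * Complex.I)‖ ^ 8 * (2 * t * Real.sinh (2 * Real.pi * t) / Real.pi) :
      ℝ) : ℂ) := by
  have h₁ : Complex.Gamma (1 + t * Complex.I) * Complex.Gamma (1 - t * Complex.I) =
      ((‖Complex.Gamma (1 + t * Complex.I)‖ ^ 2 : ℝ) : ℂ) := by
    have e : (1 - t * Complex.I : ℂ) = starRingEnd ℂ (1 + t * Complex.I) := by
      simp [sub_eq_add_neg]
    rw [e, Complex.Gamma_conj, Complex.mul_conj, Complex.normSq_eq_norm_sq]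
  have h₂ : Complex.sin (2 * Real.pi * (t * Complex.I)) =
      Complex.sinh (2 * Real.pi * t) * Complex.I := by
    rw [← mul_assoc, Complex.sin_mul_I]
  rw [wilsonW, h₁, h₂]
  push_cast
  linear_combination (-(‖Complex.Gamma (1 + t * Complex.I)‖ : ℂ) ^ 8 *
    (2 * t * Complex.sinh (2 * Real.pi * t) / Real.pi)) * Complex.I_sq

theorem axisInt_one_ne_zero : axisInt 1 1 1 1 ≠ 0 := by
  have o : 0 < (1 : ℂ).re := by simp
  set f : ℝ → ℝ := fun t =>
    ‖Complex.Gamma (1 + t * Complex.I)‖ ^ 8 * (2 * t * Real.sinh (2 * Real.pi * t) / Real.pi) with hf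
  have hfi : Integrable f := by
    have := (isWilsonContour_line (σ := 0) o o o o).integrable 1
    simp only [(hasDerivAt_line _ _).deriv] at this
    simp only [eval_one, one_mul, add_zero, Complex.zero_re, neg_zero,
      Complex.ofReal_zero, zero_add, wilsonW_one] at this
    have := (this.mul_const (-Complex.I)).re
    simpa [mul_assoc, ← Complex.ofReal_mul, hf] using this
  have hts : ∀ t : ℝ, 0 ≤ t * Real.sinh (2 * Real.pi * t) := fun t => by
    rcases le_total 0 t with h | h
    · exact mul_nonneg h (Real.sinh_nonneg_iff.2 (by positivity))
    · exact mul_nonneg_of_nonpos_of_nonpos h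
        (Real.sinh_nonpos_iff.2 (mul_nonpos_of_nonneg_of_nonpos (by positivity) h))
  have hnn : ∀ t, 0 ≤ f t := fun t => by
    have := hts t
    simp only [hf, mul_assoc 2 t]
    positivity
  have hpos : 0 < ∫ t, f t := by
    rw [integral_pos_iff_support_of_nonneg hnn hfi]
    refine lt_of_lt_of_le (b := volume (Set.Ioi (0 : ℝ))) (by simp) (measure_mono fun t ht => ?_)
    have ht : 0 < t := ht
    have h₁ : 0 < Real.sinh (2 * Real.pi * t) := Real.sinh_pos_iff.2 (by positivity)
    have h₂ : Complex.Gamma (1 + t * Complex.I) ≠ 0 :=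
      Complex.Gamma_ne_zero_of_re_pos (by simp)
    have h₃ := norm_pos_iff.2 h₂
    exact (show 0 < f t by positivity).ne'
  rw [axisInt]
  simp only [wilsonW_one]
  rw [integral_complex_ofReal]
  exact_mod_cast hpos.ne'

theorem axisInt_ne_zero {a b c d : ℂ} (ha : 0 < a.re) (hb : 0 < b.re) (hc : 0 < c.re)
    (hd : 0 < d.re) : axisInt a b c d ≠ 0 := fun h => by
  have o : 0 < (1 : ℂ).re := by simp
  have h₁ := axisInt_one_eq_zero ha hb hc hd h
  rw [← axisInt_rotate] at h₁
  have h₂ := axisInt_one_eq_zero hb hc hd o h₁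
  rw [← axisInt_rotate] at h₂
  have h₃ := axisInt_one_eq_zero hc hd o o h₂
  rw [← axisInt_rotate] at h₃
  exact axisInt_one_ne_zero (axisInt_one_eq_zero hd o o o h₃)

/-- A zero would survive raising each parameter in turn by a large n. All real parts are then
positive and the contour can be replaced by a vertical line, where the integral is nonzero. -/
theorem wilsonFunctional_one_ne_zero {K : ℝ → ℂ} {σ a b c d : ℂ} (h : IsWilsonContour K σ a b c d)
    (hS : ∀ j : ℕ, a + b + c + d + j ≠ 0) : wilsonFunctional h 1 ≠ 0 := by
  intro h₀
  obtain ⟨n, hn⟩ := exists_nat_gt (|a.re| + |b.re| + |c.re| + |d.re|)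
  have pos : ∀ {w : ℂ}, |w.re| ≤ |a.re| + |b.re| + |c.re| + |d.re| → 0 < (w + n).re := fun hw => by
    rw [Complex.add_re, Complex.natCast_re]
    have := (abs_le.1 hw).1
    linarith
  have := abs_nonneg a.re
  have := abs_nonneg b.re
  have := abs_nonneg c.re
  have := abs_nonneg d.re
  have h₁ := wilsonFunctional_add_nat_eq_zero h hS h₀ n
  rw [← wilsonFunctional_rotate] at h₁
  have h₂ := wilsonFunctional_add_nat_eq_zero _ (fun j e => hS (n + j) (by
    push_cast; linear_combination e)) h₁ n
  rw [← wilsonFunctional_rotate] at h₂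
  have h₃ := wilsonFunctional_add_nat_eq_zero _ (fun j e => hS (n + n + j) (by
    push_cast; linear_combination e)) h₂ n
  rw [← wilsonFunctional_rotate] at h₃
  have h₄ := wilsonFunctional_add_nat_eq_zero _ (fun j e => hS (n + n + n + j) (by
    push_cast; linear_combination e)) h₃ n
  rw [wilsonFunctional_eq_axisInt _ (pos (by linarith)) (pos (by linarith)) (pos (by linarith))
    (pos (by linarith))] at h₄
  exact mul_ne_zero (axisInt_ne_zero (pos (by linarith)) (pos (by linarith)) (pos (by linarith))
    (pos (by linarith))) Complex.I_ne_zero h₄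

/-! ### The Sobolev product -/

/-- There are countably many exceptional points and a simple curve meets each at most once, so the
value of a quotient with zero denominator does not affect the integral. -/
theorem ae_isRegularPoint {K : ℝ → ℂ} (hK : Function.Injective K) (γ δ : ℂ) :
    ∀ᵐ t : ℝ, IsRegularPoint γ δ (K t) := by
  refine ae_all_iff.2 fun i => ?_
  have h : (K ⁻¹' {-(γ + δ + 2 + i) / 2}).Subsingleton :=
    Set.subsingleton_singleton.preimage hK
  filter_upwards [h.countable.ae_notMem volume] with t ht e
  exact ht (by
    rw [Set.mem_preimage, Set.mem_singleton_iff]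
    linear_combination e / 2)

theorem IsSeparatingContour.isWilsonContour {N : ℕ} {β γ δ : ℂ} {K : ℝ → ℂ}
    (hK : IsSeparatingContour K (increasingPoles N β γ δ) (decreasingPoles N β γ δ)) :
    IsWilsonContour K (1 + (γ + δ + N) / 2) (wpar N β γ δ 0) (wpar N β γ δ 1) (wpar N β γ δ 2)
      (wpar N β γ δ 3) := by
  have e₀ : wpar N β γ δ 0 = 1 + (γ + δ + N) / 2 := rfl
  have e₁ : wpar N β γ δ 1 = -(γ + δ + N) / 2 := rfl
  have e₂ : wpar N β γ δ 2 = β + 1 + (-γ + δ + N) / 2 := rfl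
  have e₃ : wpar N β γ δ 3 = 1 + (γ - δ + N) / 2 := rfl
  refine ⟨⟨0, hK.contDiff, ?_⟩, fun k => ⟨hK.right _ ⟨k, ?_⟩, hK.left _ ⟨k, ?_⟩⟩,
    fun k => ⟨hK.right _ ⟨k, ?_⟩, hK.left _ ⟨k, ?_⟩⟩,
    fun k => ⟨hK.right _ ⟨k, ?_⟩, hK.left _ ⟨k, ?_⟩⟩,
    fun k => ⟨hK.right _ ⟨k, ?_⟩, hK.left _ ⟨k, ?_⟩⟩⟩
  · obtain ⟨T, hT⟩ := hK.eq_axis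
    exact ⟨T, fun t ht => by rw [hT t ht, Complex.ofReal_zero, zero_add]⟩
  · left; rw [e₀]; ring
  · left; rw [e₀]; ring
  · right; left; rw [e₁]; ring
  · right; left; rw [e₁]; ring
  · right; right; left; rw [e₂]; ring
  · right; right; left; rw [e₂]; ring
  · right; right; right; rw [e₃]; ring
  · right; right; right; rw [e₃]; ring

section

variable {N : ℕ} {α β γ δ : ℂ} {K : ℝ → ℂ}

theorem integrable_sobolevIntegrand
    (hK : IsSeparatingContour K (increasingPoles N β γ δ) (decreasingPoles N β γ δ)) (p q : ℂ[X]) :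
    Integrable (sobolevIntegrand N β γ δ K
      (fun x => p.eval (lam γ δ x)) (fun x => q.eval (lam γ δ x))) := by
  obtain ⟨p', hp⟩ := exists_divDiff_eval_lam γ δ (N + 1) p
  obtain ⟨q', hq⟩ := exists_divDiff_eval_lam γ δ (N + 1) q
  refine (hK.isWilsonContour.integrable (p' * q')).congr ?_
  filter_upwards [ae_isRegularPoint hK.injective γ δ] with t ht
  rw [sobolevIntegrand, hp _ ht, hq _ ht, wilsonWeight_eq, eval_mul,
    show (γ + δ + 1 + (N + 1 : ℕ)) / 2 = 1 + (γ + δ + N) / 2 by push_cast; ring]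

theorem integral_sobolevIntegrand_of_le (hK : Function.Injective K) {n m : ℕ}
    (hnm : n ≤ N ∨ m ≤ N) :
    ∫ t : ℝ, sobolevIntegrand N β γ δ K (fun x => (racah n α β γ δ).eval (lam γ δ x))
      (fun x => (racah m α β γ δ).eval (lam γ δ x)) t = 0 := by
  refine integral_eq_zero_of_ae ?_
  filter_upwards [ae_isRegularPoint hK γ δ] with t ht
  rw [sobolevIntegrand, Pi.zero_apply]
  rcases hnm with h | h <;> rw [divDiff_racah_of_lt α β γ δ (Nat.lt_succ_of_le h) ht] <;> ring

theorem integral_sobolevIntegrand_racah (hα : α + 1 = -(N : ℂ))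
    (hαβ : ∀ m : ℕ, α + β + 2 + m ≠ 0)
    (hK : IsSeparatingContour K (increasingPoles N β γ δ) (decreasingPoles N β γ δ)) (n m : ℕ) :
    ∃ c : ℂ, c ≠ 0 ∧
      ∫ t : ℝ, sobolevIntegrand N β γ δ K
        (fun x => (racah (N + 1 + n) α β γ δ).eval (lam γ δ x))
        (fun x => (racah (N + 1 + m) α β γ δ).eval (lam γ δ x)) t =
      c * wilsonFunctional hK.isWilsonContour
        (wilsonRacah n (wpar N β γ δ 0) (wpar N β γ δ 1) (wpar N β γ δ 2) (wpar N β γ δ 3) *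
          wilsonRacah m (wpar N β γ δ 0) (wpar N β γ δ 1) (wpar N β γ δ 2) (wpar N β γ δ 3)) := by
  obtain ⟨c₁, h₁, k₁⟩ := exists_divDiff_racah γ δ hα hαβ n
  obtain ⟨c₂, h₂, k₂⟩ := exists_divDiff_racah γ δ hα hαβ m
  refine ⟨c₁ * c₂, mul_ne_zero h₁ h₂, ?_⟩
  rw [wilsonFunctional_apply, ← integral_const_mul]
  refine integral_congr_ae ?_
  filter_upwards [ae_isRegularPoint hK.injective γ δ] with t ht
  rw [sobolevIntegrand, k₁ _ ht, k₂ _ ht, wilsonWeight_eq, eval_mul]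
  ring

/-- The factor `phi` split off for n > N contains (-x)_{N+1}. -/
theorem racah_eval_node (γ δ : ℂ) (hα : α + 1 = -(N : ℂ)) {n : ℕ} (hn : N < n) {x : ℕ}
    (hx : x ≤ N) : (racah n α β γ δ).eval (lam γ δ x) = 0 := by
  obtain ⟨m, rfl⟩ := Nat.exists_eq_add_of_le (Nat.succ_le_of_lt hn)
  rw [Nat.succ_eq_add_one, racah_eval_lam, wilsonRacah_factor N m _ _ _ _ (by rw [← hα]; ring),
    eval_mul, eval_mul, phi_eval_sq, poch_eq_zero (a := (γ + δ + 1) / 2 - (x + (γ + δ + 1) / 2))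
      (Nat.lt_succ_of_le hx) (by ring)]
  ring

theorem sum_racah_eq_zero (γ δ : ℂ) (hα : α + 1 = -(N : ℂ)) {n m : ℕ} (hnm : N < n ∨ N < m) :
    ∑ x ∈ Finset.range (N + 1), (racah n α β γ δ).eval (lam γ δ x) *
      (racah m α β γ δ).eval (lam γ δ x) * racahWeight α β γ δ x = 0 := by
  refine Finset.sum_eq_zero fun x hx => ?_
  have hx := Nat.lt_succ_iff.1 (Finset.mem_range.1 hx)
  rcases hnm with h | h <;> rw [racah_eval_node γ δ hα h hx] <;> ring

theorem wpar_sum_ne_zero (γ δ : ℂ) (hα : α + 1 = -(N : ℂ))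
    (hαβ : ∀ m : ℕ, α + β + 2 + m ≠ 0) (j : ℕ) :
    wpar N β γ δ 0 + wpar N β γ δ 1 + wpar N β γ δ 2 + wpar N β γ δ 3 + j ≠ 0 := fun e => by
  refine hαβ (2 * N + 2 + j) ?_
  have e' : 1 + (γ + δ + N) / 2 + -(γ + δ + N) / 2 + (β + 1 + (-γ + δ + N) / 2) +
    (1 + (γ - δ + N) / 2) + j = 0 := e
  push_cast
  linear_combination e' + hα

theorem sobolevProd_racah_eq_zero (hα : α + 1 = -(N : ℂ)) (hαβ : ∀ m : ℕ, α + β + 2 + m ≠ 0)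
    (h₁ : poch (-α + γ + δ + 1) N ≠ 0) (h₂ : poch (-β + γ + 1) N ≠ 0)
    (h₃ : poch ((γ + δ + 1) / 2) N ≠ 0) (h₄ : poch (δ + 1) N ≠ 0)
    (hK : IsSeparatingContour K (increasingPoles N β γ δ) (decreasingPoles N β γ δ)) {n m : ℕ}
    (hnm : n ≠ m) :
    sobolevProd N α β γ δ K (fun x => (racah n α β γ δ).eval (lam γ δ x))
      (fun x => (racah m α β γ δ).eval (lam γ δ x)) = 0 := by
  rw [sobolevProd]
  by_cases hn : n ≤ N
  · rw [integral_sobolevIntegrand_of_le hK.injective (Or.inl hn), add_zero]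
    by_cases hm : m ≤ N
    · exact sum_racah_orthogonal hα hαβ h₁ h₂ h₃ h₄ hn hm hnm
    · exact sum_racah_eq_zero γ δ hα (Or.inr (not_le.1 hm))
  · rw [sum_racah_eq_zero γ δ hα (Or.inl (not_le.1 hn)), zero_add]
    by_cases hm : m ≤ N
    · exact integral_sobolevIntegrand_of_le hK.injective (Or.inr hm)
    · obtain ⟨n, rfl⟩ := Nat.exists_eq_add_of_le (Nat.succ_le_of_lt (not_le.1 hn))
      obtain ⟨m, rfl⟩ := Nat.exists_eq_add_of_le (Nat.succ_le_of_lt (not_le.1 hm))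
      obtain ⟨c, -, h⟩ := integral_sobolevIntegrand_racah hα hαβ hK n m
      rw [h, (wilsonFunctional_isPearson hK.isWilsonContour).wilsonRacah_orthogonal
        (wpar_sum_ne_zero γ δ hα hαβ) (by omega), mul_zero]

theorem sobolevProd_racah_self_of_gt (hα : α + 1 = -(N : ℂ))
    (hαβ : ∀ m : ℕ, α + β + 2 + m ≠ 0)
    (hw : ∀ i j : Fin 4, ∀ k : ℕ, wpar N β γ δ i + wpar N β γ δ j ≠ -(k : ℂ))
    (hK : IsSeparatingContour K (increasingPoles N β γ δ) (decreasingPoles N β γ δ)) {n : ℕ}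
    (hn : N < n) :
    sobolevProd N α β γ δ K (fun x => (racah n α β γ δ).eval (lam γ δ x))
      (fun x => (racah n α β γ δ).eval (lam γ δ x)) ≠ 0 := by
  rw [sobolevProd, sum_racah_eq_zero γ δ hα (Or.inl hn), zero_add]
  obtain ⟨n, rfl⟩ := Nat.exists_eq_add_of_le (Nat.succ_le_of_lt hn)
  obtain ⟨c, hc, h⟩ := integral_sobolevIntegrand_racah hα hαβ hK n n
  have hp : ∀ i j : Fin 4, poch (wpar N β γ δ i + wpar N β γ δ j) n ≠ 0 := fun i j =>
    poch_ne_zero (fun k e => hw i j k (by linear_combination e)) n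
  have hS := wpar_sum_ne_zero γ δ hα hαβ
  rw [h]
  exact mul_ne_zero hc ((wilsonFunctional_isPearson hK.isWilsonContour).wilsonRacah_sq_ne_zero hS
    (wilsonFunctional_one_ne_zero _ hS) (hp _ _) (hp _ _) (hp _ _) (hp _ _) (hp _ _) (hp _ _))

end

/-! ### The full theorem. -/

theorem mainTheorem5 (N : ℕ) (α β γ δ : ℂ) (hα : α + 1 = -(N : ℂ))
    (hαβ : ∀ m : ℕ, α + β + 2 + m ≠ 0) :
    -- a monic polynomial in `λ` of every degree
    (∀ n : ℕ, (racah n α β γ δ).Monic ∧ (racah n α β γ δ).natDegree = n) ∧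
    -- factorization
    (∀ n : ℕ, N < n → ∀ x : ℂ,
      (racah n α β γ δ).eval (lam γ δ x) =
        (racah (N + 1) (-N - 1) β γ δ).eval (lam γ δ x) * (-1) ^ (n - N - 1) *
          (wilson (n - N - 1) (N + (γ + δ + 3) / 2) ((-γ - δ + 1) / 2)
            (β + (-γ + δ + 1) / 2) ((γ - δ + 1) / 2)).eval
              ((Complex.I * (x + (γ + δ + 1) / 2)) ^ 2)) ∧
    -- Sobolev orthogonality
    ((∀ i j : Fin 4, ∀ k : ℕ, wpar N β γ δ i + wpar N β γ δ j ≠ -(k : ℂ)) →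
      poch (-α + γ + δ + 1) N ≠ 0 → poch (-β + γ + 1) N ≠ 0 → poch ((γ + δ + 1) / 2) N ≠ 0 →
      poch (δ + 1) N ≠ 0 →
      ∀ K : ℝ → ℂ,
        IsSeparatingContour K (increasingPoles N β γ δ) (decreasingPoles N β γ δ) →
        (∀ p q : ℂ[X], MeasureTheory.Integrable (sobolevIntegrand N β γ δ K
          (fun x => p.eval (lam γ δ x)) (fun x => q.eval (lam γ δ x)))) ∧
        (∀ n m : ℕ, n ≠ m → sobolevProd N α β γ δ K
          (fun x => (racah n α β γ δ).eval (lam γ δ x))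
          (fun x => (racah m α β γ δ).eval (lam γ δ x)) = 0) ∧
        (∀ n : ℕ, N < n → sobolevProd N α β γ δ K
          (fun x => (racah n α β γ δ).eval (lam γ δ x))
          (fun x => (racah n α β γ δ).eval (lam γ δ x)) ≠ 0) ∧
        (poch (β + δ + 1) N ≠ 0 → poch (γ + 1) N ≠ 0 → poch (γ + δ + 2) N ≠ 0 →
          ∀ n : ℕ, n ≤ N → sobolevProd N α β γ δ K
            (fun x => (racah n α β γ δ).eval (lam γ δ x))
            (fun x => (racah n α β γ δ).eval (lam γ δ x)) ≠ 0)) ∧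
    -- generating functions
    ((∀ m : ℕ, β + δ + 1 ≠ -(m : ℂ)) → (∀ m : ℕ, α - δ + 1 ≠ -(m : ℂ)) →
      ∀ x t : ℂ, ‖t‖ < 1 →
        HasSum (fun n : ℕ => poch (n + α + β + 1) n /
            (poch (β + δ + 1) n * poch (α - δ + 1) n * (n.factorial : ℂ)) *
            (racah n α β γ δ).eval (lam γ δ x) * t ^ n)
          (₂F₁ (-x) (-x + β - γ) (β + δ + 1) t * ₂F₁ (x + α + 1) (x + γ + 1) (α - δ + 1) t)) ∧
    ((∀ m : ℕ, γ + 1 ≠ -(m : ℂ)) → (∀ m : ℕ, α + β - γ + 1 ≠ -(m : ℂ)) →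
      ∀ x t : ℂ, ‖t‖ < 1 →
        HasSum (fun n : ℕ => poch (n + α + β + 1) n /
            (poch (γ + 1) n * poch (α + β - γ + 1) n * (n.factorial : ℂ)) *
            (racah n α β γ δ).eval (lam γ δ x) * t ^ n)
          (₂F₁ (-x) (-x - δ) (γ + 1) t *
            ₂F₁ (x + α + 1) (x + β + δ + 1) (α + β - γ + 1) t)) := by
  refine ⟨fun n => racah_monic n α β γ δ (poch_top_ne_zero hαβ n),
    racah_factorization N α β γ δ hα hαβ, fun hw h₁ h₂ h₃ h₄ K hK =>
      ⟨integrable_sobolevIntegrand hK, fun n m => sobolevProd_racah_eq_zero hα hαβ h₁ h₂ h₃ h₄ hK,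
        fun n => sobolevProd_racah_self_of_gt hα hαβ hw hK, fun h₅ h₆ h₇ n hn => ?_⟩,
    racah_generating α β γ δ hαβ, fun h₁ h₂ x t ht => ?_⟩
  · rw [sobolevProd, integral_sobolevIntegrand_of_le hK.injective (Or.inl hn), add_zero]
    exact sum_racah_sq_ne_zero hα hαβ h₁ h₂ h₃ h₄ h₅ h₆ h₇ hn
  -- The second generating function is the first one with (γ, δ) replaced by (β+δ, γ-β).
  · have e₁ : β + (γ - β) + 1 = γ + 1 := by ring
    have e₂ : α - (γ - β) + 1 = α + β - γ + 1 := by ring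
    have e₃ : -x + β - (β + δ) = -x - δ := by ring
    have e₄ : x + (β + δ) + 1 = x + β + δ + 1 := by ring
    have h := racah_generating α β (β + δ) (γ - β) hαβ (by rwa [e₁]) (by rwa [e₂]) x t ht
    simpa only [e₁, e₂, e₃, e₄, ← racah_eval_swap] using h
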